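/- Let $D\subset\mathbb R^d$ ($d\ge 2$) be a bounded domain, $T>0$, $Q_T=D\times(0,T)$, and let $\mu>0$, $\eta\ge 0$, $\rho_0>0$ be constants. Let $H_0^1(D)^d$ and $V(D)$ be the closures in the $H^1$-norm of $C_0^\infty(D)^d$ and of $\{v\in C_0^\infty(D)^d:\operatorname{div}v=0\}$, let $J(D)$ be the closure of the latter set in $L^2(D)^d$, and let $H^{-1}(D)^d=(H_0^1(D)^d)^*$. Write $(\cdot,\cdot)$ for the $L^2(D)$ scalar products and $((u,v))=\int_D\nabla u:\nabla v\,dx$. Let $f\in L^\infty(Q_T)^d$, $u_0\in J(D)$ and $p_0\in L^2(D)$. For $0<\alpha<1$ let $u_\alpha\in L^2(0,T;H_0^1(D)^d)$, $p_\alpha\in L^2(0,T;L^2(D))$ be the weak solution of the linearized equations of a compressible fluid $$\rho_t+\rho_0\operatorname{div}u=0,\qquad \rho_0u_t+\nabla p=\mu\Delta u+\eta\nabla\operatorname{div}u+\rho f,\qquad \rho=\rho_0+\alpha p,$$ $$u|_{\partial D}=0,\qquad u|_{t=0}=u_0,\qquad p|_{t=0}=p_0,$$ that is, for all $\varphi\in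 C_0^\infty([0,T))$, $r\in L^2(D)$ and $v\in H_0^1(D)^d$, $$-\int_0^T\alpha(p_\alpha,r)\varphi_t\,dt-\alpha(p_0,r)\varphi(0)+\int_0^T\rho_0(\operatorname{div}u_\alpha,r)\varphi\,dt=0,$$ $$-\int_0^T\rho_0(u_\alpha,v)\varphi_t\,dt-\rho_0(u_0,v)\varphi(0)-\int_0^T(p_\alpha,\operatorname{div}v)\varphi\,dt$$ $$=-\mu\int_0^T((u_\alpha,v))\varphi\,dt-\eta\int_0^T(\operatorname{div}u_\alpha,\operatorname{div}v)\varphi\,dt+\int_0^T((\rho_0+\alpha p_\alpha)f,v)\varphi\,dt.$$ Let $u_{\rm inc}\in L^2(0,T;V(D))$ and $p_{\rm inc}$ be a weak solution of the nonsteady Stokes equations with the same initial velocity $u_0$, $$\operatorname{div}u_{\rm inc}=0,\qquad \rho_0\,\partial_tu_{\rm inc}+\nabla p_{\rm inc}=\mu\Delta u_{\rm inc}+\rho_0f,\qquad u_{\rm inc}|_{\partial D}=0,\qquad u_{\rm inc}|_{t=0}=u_0,$$ that is, the two equations hold in $\mathcal D'(Q_T)$, and for all $\varphi\in C_0^\infty([0,T))$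 and $v\in V(D)$ $$-\int_0^T\rho_0(u_{\rm inc},v)\varphi_t\,dt-\rho_0(u_0,v)\varphi(0)=-\mu\int_0^T((u_{\rm inc},v))\varphi\,dt+\int_0^T(\rho_0f,v)\varphi\,dt.$$ Suppose that $u_{\rm inc}\in L^2(0,T;H_0^1(D)^d)$ has a weak time derivative in $L^2(0,T;H^{-1}(D)^d)$, that $p_{\rm inc}\in W^{1,2}(0,T;L^2(D))$, and that $$\int_Dp_{\rm inc}(t)\,dx=\int_Dp_0\,dx\quad\text{for a.e. }t\in(0,T).$$ Then, as $\alpha\to0$, $p_\alpha\to p_{\rm inc}$ weak-$*$ in $L^\infty(0,T;L^2(D))$; these functions belong to this space, and for every $g\in L^1(0,T;L^2(D))$, $\int_0^T(p_\alpha,g)\,dt\to\int_0^T(p_{\rm inc},g)\,dt$. Moreover, there is a constant $C$, independent of $\alpha$, such that for all $0<\alpha<1$ $$\|u_\alpha-u_{\rm inc}\|_{L^2(0,T;H_0^1(D)^d)}+\|u_\alpha-u_{\rm inc}\|_{L^\infty(0,T;L^2(D)^d)}\le C\sqrt\alpha .$$ -/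

import Mathlib

open MeasureTheory Set Filter Topology
open scoped ContDiff ENNReal RealInnerProductSpace

noncomputable section

namespace LowCompressible

/-! ### Test functions -/

/-- `φ ∈ C₀^∞(Ω)`: a smooth function on the whole space whose support is a compact subset of `Ω`.
For `Ω = Iio T` in `ℝ`, the restrictions of these functions to `[0,T)` form `C₀^∞([0,T))`. -/
def IsTest {X F : Type*} [NormedAddCommGroup X] [NormedSpace ℝ X]
    [NormedAddCommGroup F] [NormedSpace ℝ F] (Ω : Set X) (φ : X → F) : Prop :=
  ContDiff ℝ ∞ φ ∧ HasCompactSupport φ ∧ tsupport φ ⊆ Ω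

/-! ### Spaces of functions on `D ⊆ ℝ^d` -/

/-- `ℝ^d` with its Euclidean norm. -/
abbrev Vec (d : ℕ) : Type := EuclideanSpace ℝ (Fin d)

/-- Real `d × d` matrices with the Frobenius norm and the scalar product `A : B`. -/
abbrev Mat (d : ℕ) : Type := EuclideanSpace ℝ (Fin d × Fin d)

/-- The Hilbert space `L²(D; F)`. -/
abbrev L2 {d : ℕ} (D : Set (Vec d)) (F : Type) [NormedAddCommGroup F] : Type :=
  Lp F 2 (volume.restrict D)

/-- The matrix `(∂ᵢ vⱼ)` of first derivatives of a classical vector field `v`. -/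
def gradField {d : ℕ} (v : Vec d → Vec d) (x : Vec d) : Mat d :=
  WithLp.toLp 2 fun ij => fderiv ℝ v x (EuclideanSpace.single ij.1 1) ij.2

/-- The divergence `∑ᵢ ∂ᵢ vᵢ` of a classical vector field `v`. -/
def divField {d : ℕ} (v : Vec d → Vec d) (x : Vec d) : ℝ :=
  ∑ i, fderiv ℝ v x (EuclideanSpace.single i 1) i

theorem gradField_add {d : ℕ} {v w : Vec d → Vec d} (hv : Differentiable ℝ v)
    (hw : Differentiable ℝ w) : gradField (v + w) = gradField v + gradField w := by
  funext x
  ext ij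
  simp [gradField, fderiv_add (hv x) (hw x)]

theorem gradField_smul {d : ℕ} {v : Vec d → Vec d} (c : ℝ) (hv : Differentiable ℝ v) :
    gradField (c • v) = c • gradField v := by
  funext x
  ext ij
  simp [gradField, fderiv_const_smul (hv x)]

theorem divField_add {d : ℕ} {v w : Vec d → Vec d} (hv : Differentiable ℝ v)
    (hw : Differentiable ℝ w) : divField (v + w) = divField v + divField w := by
  funext x
  simp [divField, fderiv_add (hv x) (hw x), Finset.sum_add_distrib]

theorem divField_smul {d : ℕ} {v : Vec d → Vec d} (c : ℝ) (hv : Differentiable ℝ v) :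
    divField (c • v) = c • divField v := by
  funext x
  simp [divField, fderiv_const_smul (hv x), Finset.mul_sum]

/-- The linear space of test fields `C₀^∞(D)^d`. -/
def testFields {d : ℕ} (D : Set (Vec d)) : Submodule ℝ (Vec d → Vec d) where
  carrier := {v | IsTest D v}
  zero_mem' := ⟨contDiff_const, HasCompactSupport.zero, by simp [tsupport]⟩
  add_mem' := by
    rintro v w ⟨hv, hv', hv''⟩ ⟨hw, hw', hw''⟩
    exact ⟨hv.add hw, hv'.add hw',
      (tsupport_add v w).trans (union_subset hv'' hw'')⟩
  smul_mem' := by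
    rintro c v ⟨hv, hv', hv''⟩
    exact ⟨contDiff_const.smul hv, hv'.smul_left (f := fun _ => c),
      (tsupport_smul_subset_right (fun _ => c) v).trans hv''⟩

theorem differentiable_of_mem {d : ℕ} {D : Set (Vec d)} {v : Vec d → Vec d}
    (hv : v ∈ testFields D) : Differentiable ℝ v :=
  ContDiff.differentiable hv.1 (by simp)

/-- The linear space of solenoidal test fields, `{v ∈ C₀^∞(D)^d : div v = 0}`. -/
def solenoidalTestFields {d : ℕ} (D : Set (Vec d)) : Submodule ℝ (Vec d → Vec d) where
  carrier := {v | v ∈ testFields D ∧ divField v = 0}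
  zero_mem' := ⟨zero_mem _, by funext x; simp [divField]⟩
  add_mem' := by
    rintro v w ⟨hv, hv'⟩ ⟨hw, hw'⟩
    exact ⟨add_mem hv hw, by
      rw [divField_add (differentiable_of_mem hv) (differentiable_of_mem hw), hv', hw', add_zero]⟩
  smul_mem' := by
    rintro c v ⟨hv, hv'⟩
    exact ⟨Submodule.smul_mem _ c hv, by
      rw [divField_smul c (differentiable_of_mem hv), hv', smul_zero]⟩

/-- The Hilbert space of pairs (vector field, matrix field) with square integrable entries. A
Sobolev field `u` is represented by the pair `(u, ∇u)`, so the norm induced from this space is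
the full `H¹`-norm `(|u|² + |∇u|²)^{1/2}`. -/
abbrev Pairs {d : ℕ} (D : Set (Vec d)) : Type := WithLp 2 (L2 D (Vec d) × L2 D (Mat d))

/-- The pairs `(v, ∇v)` where `v` runs through a linear space of test fields. -/
def graphOver {d : ℕ} (D : Set (Vec d)) (S : Submodule ℝ (Vec d → Vec d))
    (hS : S ≤ testFields D) : Submodule ℝ (Pairs D) where
  carrier := {w | ∃ v ∈ S, (⇑w.fst =ᵐ[volume.restrict D] v) ∧
    (⇑w.snd =ᵐ[volume.restrict D] gradField v)}
  zero_mem' := by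
    refine ⟨0, zero_mem _, Lp.coeFn_zero _ _ _, ?_⟩
    have h : gradField (0 : Vec d → Vec d) = 0 := by
      funext x
      ext ij
      simp [gradField]
    rw [h]
    exact Lp.coeFn_zero _ _ _
  add_mem' := by
    rintro a b ⟨v, hv, h1, h2⟩ ⟨w, hw, h3, h4⟩
    refine ⟨v + w, add_mem hv hw, (Lp.coeFn_add _ _).trans (h1.add h3), ?_⟩
    rw [gradField_add (differentiable_of_mem (hS hv)) (differentiable_of_mem (hS hw))]
    exact (Lp.coeFn_add _ _).trans (h2.add h4)
  smul_mem' := by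
    rintro c a ⟨v, hv, h1, h2⟩
    refine ⟨c • v, Submodule.smul_mem _ c hv, (Lp.coeFn_smul _ _).trans (h1.const_smul c), ?_⟩
    rw [gradField_smul c (differentiable_of_mem (hS hv))]
    exact (Lp.coeFn_smul _ _).trans (h2.const_smul c)

/-- `H₀¹(D)^d`, the closure of `C₀^∞(D)^d` in the `H¹`-norm. -/
def H01 {d : ℕ} (D : Set (Vec d)) : Submodule ℝ (Pairs D) :=
  (graphOver D (testFields D) le_rfl).topologicalClosure

/-- `V(D)`, the closure in the `H¹`-norm of the solenoidal test fields. -/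
def V {d : ℕ} (D : Set (Vec d)) : Submodule ℝ (Pairs D) :=
  (graphOver D (solenoidalTestFields D) fun _ h => h.1).topologicalClosure

/-- The field `u ∈ L²(D)^d` underlying the pair `(u, ∇u)`, as a continuous linear map. -/
def field {d : ℕ} (D : Set (Vec d)) : Pairs D →L[ℝ] L2 D (Vec d) :=
  WithLp.fstL 2 ℝ (L2 D (Vec d)) (L2 D (Mat d))

/-- The gradient `∇u ∈ L²(D)^{d×d}` contained in the pair `(u, ∇u)`. -/
def grad {d : ℕ} (D : Set (Vec d)) : Pairs D →L[ℝ] L2 D (Mat d) :=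
  WithLp.sndL 2 ℝ (L2 D (Vec d)) (L2 D (Mat d))

/-- The trace of a matrix. -/
def trace (d : ℕ) : Mat d →L[ℝ] ℝ := ∑ i : Fin d, EuclideanSpace.proj (i, i)

/-- The divergence `div u ∈ L²(D)` of a Sobolev field: the trace of its gradient. -/
def div {d : ℕ} (D : Set (Vec d)) : Pairs D →L[ℝ] L2 D ℝ :=
  ((trace d).compLpL 2 (volume.restrict D)).comp (grad D)

/-- `J(D)`, the closure in `L²(D)^d` of the solenoidal test fields. -/
def J {d : ℕ} (D : Set (Vec d)) : Submodule ℝ (L2 D (Vec d)) :=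
  ((graphOver D (solenoidalTestFields D) fun _ h => h.1).map
    (field D : Pairs D →ₗ[ℝ] L2 D (Vec d))).topologicalClosure

/-- `H^{-1}(D)^d`, the dual space of `H₀¹(D)^d`. -/
abbrev Hneg1 {d : ℕ} (D : Set (Vec d)) : Type := StrongDual ℝ (H01 D)

/-- The underlying `L²`-field of an element of `H₀¹(D)^d`. -/
def embL2 {d : ℕ} (D : Set (Vec d)) : H01 D →L[ℝ] L2 D (Vec d) :=
  (field D).comp (H01 D).subtypeL

/-- The embedding `u ↦ ∫_D (u, ·) dx` of `H₀¹(D)^d` into `H^{-1}(D)^d`. -/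
def embDual {d : ℕ} (D : Set (Vec d)) (u : H01 D) : Hneg1 D :=
  (innerSL ℝ (embL2 D u)).comp (embL2 D)

/-! ### Functions of time with values in a Banach space -/

/-- Lebesgue measure on `(0,T)`; `u ∈ L^p(0,T;X)` is `MemLp u p (timeMeasure T)`. -/
abbrev timeMeasure (T : ℝ) : Measure ℝ := volume.restrict (Ioo 0 T)

/-- `u ∈ W^{1,2}(0,T;X)`: `u ∈ L²(0,T;X)` has a weak derivative `g ∈ L²(0,T;X)`. -/
def MemW12 {X : Type*} [NormedAddCommGroup X] [NormedSpace ℝ X] (T : ℝ) (u : ℝ → X) : Prop :=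
  MemLp u 2 (timeMeasure T) ∧ ∃ g : ℝ → X, MemLp g 2 (timeMeasure T) ∧
    ∀ φ : ℝ → ℝ, IsTest (Ioo 0 T) φ →
      ∫ t in Ioo 0 T, deriv φ t • u t = - ∫ t in Ioo 0 T, φ t • g t

/-- The Sobolev–Lions space: `u ∈ L²(0,T;H₀¹(D)^d)` whose image in `H^{-1}(D)^d` belongs to
`W^{1,2}(0,T;H^{-1}(D)^d)`. -/
def MemSobolevLions {d : ℕ} (D : Set (Vec d)) (T : ℝ) (u : ℝ → H01 D) : Prop :=
  MemLp u 2 (timeMeasure T) ∧ MemW12 T fun t => embDual D (u t)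

/-- For a Hilbert space `X`: convergence `F i ⇀* G` in `L^∞(0,T;X) = L¹(0,T;X)^*`. All the
functions have to belong to `L^∞(0,T;X)` (the `F i` for `i` far along the filter `l`). -/
def WeakStarTendsto {X ι : Type*} [NormedAddCommGroup X] [InnerProductSpace ℝ X] (T : ℝ)
    (F : ι → ℝ → X) (l : Filter ι) (G : ℝ → X) : Prop :=
  (∀ᶠ i in l, MemLp (F i) ∞ (timeMeasure T)) ∧ MemLp G ∞ (timeMeasure T) ∧
    ∀ g : ℝ → X, MemLp g 1 (timeMeasure T) →
      Tendsto (fun i => ∫ t in Ioo 0 T, ⟪F i t, g t⟫) l (𝓝 (∫ t in Ioo 0 T, ⟪G t, g t⟫))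

/-! ### The two initial--boundary value problems -/

/-- `(u, p)` is a weak solution of the linearized equations of a compressible fluid
`ρ_t + ρ₀ div u = 0`, `ρ₀ u_t + ∇p = μ Δu + η ∇ div u + ρ f`, `ρ = ρ₀ + α p` in `D × (0,T)`
with `u = 0` on `∂D`, `u(0) = u₀`, `p(0) = p₀`. -/
structure IsCompressibleWeakSolution {d : ℕ} (D : Set (Vec d)) (T μ η ρ₀ α : ℝ)
    (f : Vec d × ℝ → Vec d) (u₀ : L2 D (Vec d)) (p₀ : L2 D ℝ)
    (u : ℝ → H01 D) (p : ℝ → L2 D ℝ) : Prop where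
  velocity_mem : MemLp u 2 (timeMeasure T)
  pressure_mem : MemLp p 2 (timeMeasure T)
  continuity : ∀ φ : ℝ → ℝ, IsTest (Iio T) φ → ∀ r : L2 D ℝ,
    - (∫ t in Ioo 0 T, α * ⟪p t, r⟫ * deriv φ t) - α * ⟪p₀, r⟫ * φ 0
      + ∫ t in Ioo 0 T, ρ₀ * ⟪div D (u t), r⟫ * φ t = 0
  momentum : ∀ φ : ℝ → ℝ, IsTest (Iio T) φ → ∀ v : H01 D,
    - (∫ t in Ioo 0 T, ρ₀ * ⟪field D (u t), field D v⟫ * deriv φ t)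
      - ρ₀ * ⟪u₀, field D v⟫ * φ 0
      - ∫ t in Ioo 0 T, ⟪p t, div D v⟫ * φ t
    = - μ * (∫ t in Ioo 0 T, ⟪grad D (u t), grad D v⟫ * φ t)
      - η * (∫ t in Ioo 0 T, ⟪div D (u t), div D v⟫ * φ t)
      + ∫ t in Ioo 0 T, (∫ x in D, (ρ₀ + α * p t x) * ⟪f (x, t), field D v x⟫) * φ t

/-- `(u, p)`, with a pressure `p ∈ L²(0,T;L²(D))`, is a weak solution of the nonsteady Stokes
equations `div u = 0`, `ρ₀ u_t + ∇p = μ Δu + ρ₀ f` in `D × (0,T)` with `u = 0` on `∂D` and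
`u(0) = u₀`. The fields `incompressible` and `momentum` are the two equations in the sense of
distributions on `D × (0,T)`, with `⟨Δu, Φ⟩ = -∫∫ ∇u : ∇Φ`. -/
structure IsStokesWeakSolution {d : ℕ} (D : Set (Vec d)) (T μ ρ₀ : ℝ)
    (f : Vec d × ℝ → Vec d) (u₀ : L2 D (Vec d))
    (u : ℝ → H01 D) (p : ℝ → L2 D ℝ) : Prop where
  velocity_mem : MemLp u 2 (timeMeasure T)
  velocity_mem_V : ∀ᵐ t ∂(timeMeasure T), (u t : Pairs D) ∈ V D
  pressure_mem : MemLp p 2 (timeMeasure T)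
  incompressible : ∀ ψ : Vec d × ℝ → ℝ, IsTest (D ×ˢ Ioo 0 T) ψ →
    - (∫ t in Ioo 0 T, ∫ x in D, ⟪field D (u t) x, gradient (fun y => ψ (y, t)) x⟫) = 0
  momentum : ∀ Φ : Vec d × ℝ → Vec d, IsTest (D ×ˢ Ioo 0 T) Φ →
    - (∫ t in Ioo 0 T, ∫ x in D, ρ₀ * ⟪field D (u t) x, deriv (fun s => Φ (x, s)) t⟫)
      - (∫ t in Ioo 0 T, ∫ x in D, p t x * divField (fun y => Φ (y, t)) x)
    = - μ * (∫ t in Ioo 0 T, ∫ x in D, ⟪grad D (u t) x, gradField (fun y => Φ (y, t)) x⟫)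
      + ∫ t in Ioo 0 T, ∫ x in D, ρ₀ * ⟪f (x, t), Φ (x, t)⟫
  weak : ∀ φ : ℝ → ℝ, IsTest (Iio T) φ → ∀ v ∈ V D,
    - (∫ t in Ioo 0 T, ρ₀ * ⟪field D (u t), field D v⟫ * deriv φ t)
      - ρ₀ * ⟪u₀, field D v⟫ * φ 0
    = - μ * (∫ t in Ioo 0 T, ⟪grad D (u t), grad D v⟫ * φ t)
      + ∫ t in Ioo 0 T, (∫ x in D, ρ₀ * ⟪f (x, t), field D v x⟫) * φ t

end LowCompressible

end

open LowCompressible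

noncomputable section

namespace LowCompressible

/-! ### Calculus of vector-valued functions of time -/

/-! Put `w = u_α - u_inc`, `q = p_α - p_inc`. Subtracting the two systems and using `div u_inc = 0`
gives `ρ₀ w_t + ∇q = μ Δw + η ∇ div w + α p_α f` and `α q_t + ρ₀ div w = -α ∂_t p_inc`, with `w(0) =
0` and `q(0) = p₀ - p_inc(0)`. Test the first equation with `w` and the second with `q / ρ₀`. The
terms `(q, div w)` cancel. The initial pressure mismatch, the force and `∂_t p_inc` all carry a
factor `α`. Grönwall's inequality then bounds `ρ₀ ‖w‖² + (α/ρ₀) ‖q‖² + 2μ ∫ ‖∇w‖²` by a constant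
times `α` (`coupled_energy_estimate`). Hence `w = O(√α)` in both norms, while `q` is only bounded in
`L^∞(0,T;L²)`.

For the pressure, integrate the momentum equation over `(0,τ)` and test it with a fixed `v`. Every
term except `∫ (q, div v)` contains `w` or `α`, so this integral is `O(√α)`
(`abs_integral_pressure_le`). Moreover `q` has mean zero, because divergences of `H₀¹` fields have
mean zero and the mean of `p_inc` is that of `p₀`. Divergences and constants span a dense subspace
of `L²(D)`: a function orthogonal to all divergences has vanishing weak gradient, hence is constant
on the connected set `D` (`dense_range_div_sup_const`). Boundedness of `q` and density give
weak-star convergence (`tendsto_integral_inner_zero`). Only density is used, not closedness of the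
range of `div`, so no regularity of the boundary enters.

Two points need care. The solutions have no time derivative that may be paired with them directly.
The equations are therefore rewritten as identities between `H`-valued primitives, and Steklov
averages yield the energy inequality (`energy_inequality`), the only half of the energy identity
that is needed. Secondly, the Stokes initial condition is prescribed only against `V(D)`, whereas
`w` must be tested with all of `H₀¹`. The full equation gives `ρ₀ u_inc(t) = c + ∫₀ᵗ …` in the dual
of `H₀¹` with an unknown `c`. The energy inequality and `u₀ ∈ J(D)` give strong convergence
`u_inc(t_n) → u₀` in `L²` along a sequence `t_n → 0`, and this identifies `c` (`initial_value_eq`).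
-/

theorem intervalIntegrable_of_integrableOn_Ioo {E : Type*} [NormedAddCommGroup E]
    {T a b : ℝ} {k : ℝ → E}
    (hk : IntegrableOn k (Ioo 0 T)) (ha : a ∈ Icc 0 T) (hb : b ∈ Icc 0 T) :
    IntervalIntegrable k volume a b := by
  rw [← integrableOn_Icc_iff_integrableOn_Ioo] at hk
  rw [intervalIntegrable_iff']
  exact hk.mono_set (uIcc_subset_Icc ha hb)

theorem continuousOn_primitive_Icc {E : Type*} [NormedAddCommGroup E] [NormedSpace ℝ E]
    {T : ℝ} (hT : 0 ≤ T) {k : ℝ → E} (hk : IntegrableOn k (Ioo 0 T)) :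
    ContinuousOn (fun t => ∫ s in (0 : ℝ)..t, k s) (Icc 0 T) := by
  rw [← integrableOn_Icc_iff_integrableOn_Ioo, ← uIcc_of_le hT] at hk
  simpa [uIcc_of_le hT] using intervalIntegral.continuousOn_primitive_interval hk

theorem integrableOn_Ioo_of_continuous {F : Type*} [NormedAddCommGroup F]
    {f : ℝ → F} (hf : Continuous f) (T : ℝ) : IntegrableOn f (Ioo 0 T) :=
  (hf.integrableOn_Icc (a := 0) (b := T)).mono_set Ioo_subset_Icc_self

theorem IsTest.continuous_deriv {Ω : Set ℝ} {φ : ℝ → ℝ} (hφ : IsTest Ω φ) :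
    Continuous (deriv φ) :=
  hφ.1.continuous_deriv (by simp)

theorem IsTest.mono {X F : Type*} [NormedAddCommGroup X] [NormedSpace ℝ X]
    [NormedAddCommGroup F] [NormedSpace ℝ F] {Ω Ω' : Set X} {φ : X → F} (hφ : IsTest Ω φ)
    (h : Ω ⊆ Ω') : IsTest Ω' φ :=
  ⟨hφ.1, hφ.2.1, hφ.2.2.trans h⟩

theorem IsTest.eq_zero_of_notMem {X F : Type*} [NormedAddCommGroup X] [NormedSpace ℝ X]
    [NormedAddCommGroup F] [NormedSpace ℝ F] {Ω : Set X} {φ : X → F} (hφ : IsTest Ω φ)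
    {x : X} (hx : x ∉ Ω) : φ x = 0 :=
  image_eq_zero_of_notMem_tsupport fun h => hx (hφ.2.2 h)

theorem integrableOn_smul_of_continuous {E : Type*} [NormedAddCommGroup E] [NormedSpace ℝ E]
    {T : ℝ} {φ : ℝ → ℝ} (hφ : Continuous φ) {k : ℝ → E} (hk : IntegrableOn k (Ioo 0 T)) :
    IntegrableOn (fun t => φ t • k t) (Ioo 0 T) := by
  obtain ⟨C, hC⟩ := isCompact_Icc.exists_bound_of_continuousOn
    (s := Icc (0 : ℝ) T) hφ.continuousOn
  refine Integrable.bdd_smul hk C hφ.aestronglyMeasurable ?_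
  exact (ae_restrict_iff' measurableSet_Ioo).2
    (Eventually.of_forall fun t ht => hC t (Ioo_subset_Icc_self ht))

/-- Integration by parts against the primitive of an integrable function. -/
theorem integral_deriv_smul_primitive {E : Type*} [NormedAddCommGroup E] [NormedSpace ℝ E]
    [CompleteSpace E] {T : ℝ} {k : ℝ → E} (hk : IntegrableOn k (Ioo 0 T))
    {φ : ℝ → ℝ} (hφ : ContDiff ℝ ∞ φ) (hφT : φ T = 0) :
    ∫ t in Ioo 0 T, deriv φ t • ∫ s in (0 : ℝ)..t, k s = - ∫ t in Ioo 0 T, φ t • k t := by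
  have hd : Continuous (deriv φ) := hφ.continuous_deriv (by simp)
  set m : Measure ℝ := volume.restrict (Ioo 0 T) with hm
  -- Fubini on the triangle `s < t`. Integrating `φ'` over `(s,T)` leaves `-φ(s)` because `φ T = 0`;
  -- the primitive vanishes at `0`, so no boundary term appears.
  let F : ℝ → ℝ → E := fun t s => (Iio t).indicator (fun s => deriv φ t • k s) s
  have hF : Integrable (Function.uncurry F) (m.prod m) := by
    have h1 : Integrable (fun z : ℝ × ℝ => deriv φ z.1 • k z.2) (m.prod m) :=
      Integrable.smul_prod (integrableOn_Ioo_of_continuous hd T) hk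
    have h2 : MeasurableSet {z : ℝ × ℝ | z.2 < z.1} :=
      measurableSet_lt measurable_snd measurable_fst
    refine (h1.indicator h2).congr (Eventually.of_forall fun z => ?_)
    simp [Function.uncurry, F, indicator]
  have hswap := integral_integral_swap hF
  have hL : ∫ t, ∫ s, F t s ∂m ∂m = ∫ t in Ioo 0 T, deriv φ t • ∫ s in (0 : ℝ)..t, k s := by
    refine setIntegral_congr_fun measurableSet_Ioo fun t ht => ?_
    simp only [F]
    rw [integral_indicator measurableSet_Iio, hm, Measure.restrict_restrict measurableSet_Iio,
      integral_smul, intervalIntegral.integral_of_le ht.1.le, integral_Ioc_eq_integral_Ioo]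
    congr 3
    ext s
    simp only [mem_inter_iff, mem_Iio, mem_Ioo]
    constructor
    · rintro ⟨h1, h2, h3⟩; exact ⟨h2, h1⟩
    · rintro ⟨h1, h2⟩; exact ⟨h2, h1, h2.trans ht.2⟩
  have hR : ∫ s, ∫ t, F t s ∂m ∂m = ∫ s in Ioo 0 T, -(φ s • k s) := by
    refine setIntegral_congr_fun measurableSet_Ioo fun s hs => ?_
    have h1 : (fun t => F t s) = (Ioi s).indicator (fun t => deriv φ t • k s) := by
      funext t
      simp [F, indicator]
    rw [h1, integral_indicator measurableSet_Ioi, hm, Measure.restrict_restrict measurableSet_Ioi]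
    have h2 : Ioi s ∩ Ioo 0 T = Ioo s T := by
      ext t
      simp only [mem_inter_iff, mem_Ioi, mem_Ioo]
      constructor
      · rintro ⟨h1, h2, h3⟩; exact ⟨h1, h3⟩
      · rintro ⟨h1, h2⟩; exact ⟨h1, hs.1.trans h1, h2⟩
    rw [h2, integral_smul_const, ← integral_Ioc_eq_integral_Ioo,
      ← intervalIntegral.integral_of_le hs.2.le,
      intervalIntegral.integral_deriv_eq_sub (fun x _ => (hφ.differentiable (by simp)) x)
        (hd.intervalIntegrable _ _), hφT, zero_sub, neg_smul]
  rw [← hL, hswap, hR, integral_neg]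

theorem exists_isTest_Ioo_integral_one {T : ℝ} (hT : 0 < T) :
    ∃ φ : ℝ → ℝ, IsTest (Ioo 0 T) φ ∧ ∫ t, φ t = 1 := by
  let b : ContDiffBump (T / 2) := ⟨T / 8, T / 4, by positivity, by linarith⟩
  refine ⟨b.normed volume, ⟨b.contDiff_normed, b.hasCompactSupport_normed, ?_⟩,
    b.integral_normed⟩
  rw [b.tsupport_normed_eq]
  intro x hx
  have : |x - T / 2| ≤ T / 4 := by simpa [Real.dist_eq] using hx
  rw [abs_le] at this
  constructor <;> linarith [this.1, this.2]

theorem exists_isTest_Iio_zero_one {T : ℝ} (hT : 0 < T) :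
    ∃ φ : ℝ → ℝ, IsTest (Iio T) φ ∧ φ 0 = 1 := by
  let b : ContDiffBump (0 : ℝ) := ⟨T / 8, T / 4, by positivity, by linarith⟩
  refine ⟨b, ⟨b.contDiff, b.hasCompactSupport, ?_⟩,
    b.one_of_mem_closedBall (by simp; positivity)⟩
  rw [b.tsupport_eq]
  intro x hx
  have : |x| ≤ T / 4 := by simpa [Real.dist_eq] using hx
  rw [abs_le] at this
  simp only [mem_Iio]
  linarith [this.1, this.2]

/-- A test function on `(0,T)` with vanishing integral is the derivative of a test function. -/
theorem IsTest.exists_deriv_eq {T : ℝ} (hT : 0 < T) {ψ : ℝ → ℝ} (hψ : IsTest (Ioo 0 T) ψ)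
    (h0 : ∫ t, ψ t = 0) : ∃ φ : ℝ → ℝ, IsTest (Ioo 0 T) φ ∧ deriv φ = ψ := by
  have hc : Continuous ψ := hψ.1.continuous
  have hD : ∀ t, HasDerivAt (fun t => ∫ s in (0 : ℝ)..t, ψ s) (ψ t) t := fun t =>
    intervalIntegral.integral_hasDerivAt_right (hc.intervalIntegrable _ _)
      (hc.stronglyMeasurableAtFilter _ _) hc.continuousAt
  have hder : deriv (fun t => ∫ s in (0 : ℝ)..t, ψ s) = ψ := funext fun t => (hD t).deriv
  have hz : ∀ t ∉ Ioo 0 T, ψ t = 0 := fun t ht => hψ.eq_zero_of_notMem ht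
  -- The primitive must have support compact inside the open interval, so the support of `ψ` is
  -- first enclosed in `[a,b]`. The point `T / 2` serves when that support is empty.
  obtain ⟨a, b, ha, hab, hb, hsub⟩ : ∃ a b : ℝ, 0 < a ∧ a ≤ b ∧ b < T ∧ tsupport ψ ⊆ Icc a b := by
    have hK : IsCompact (tsupport ψ) := hψ.2.1
    rcases (tsupport ψ).eq_empty_or_nonempty with he | hne
    · exact ⟨T / 2, T / 2, by linarith, le_rfl, by linarith, by simp [he]⟩
    · have h1 := hK.sInf_mem hne
      have h2 := hK.sSup_mem hne
      exact ⟨sInf (tsupport ψ), sSup (tsupport ψ), (hψ.2.2 h1).1,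
        csInf_le hK.bddBelow h2, (hψ.2.2 h2).2,
        fun x hx => ⟨csInf_le hK.bddBelow hx, le_csSup hK.bddAbove hx⟩⟩
  have hz' : ∀ t ∉ Icc a b, ψ t = 0 := fun t ht =>
    image_eq_zero_of_notMem_tsupport fun h => ht (hsub h)
  have hsupp : Function.support (fun t => ∫ s in (0 : ℝ)..t, ψ s) ⊆ Icc a b := by
    intro t ht
    by_contra hn
    apply ht
    rw [mem_Icc, not_and_or, not_le, not_le] at hn
    rcases hn with hn | hn
    · refine (intervalIntegral.integral_congr (g := fun _ => 0) fun s hs => hz' s fun h => ?_).trans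
        (by simp)
      rw [uIcc, mem_Icc] at hs
      have : max 0 t < a := max_lt ha hn
      linarith [hs.2, h.1]
    -- To the right of the support the primitive has collected the whole integral, which is zero.
    -- The limit `max t T` is used because `t` may lie on either side of `T`.
    · have h3 : ∫ s in t..(max t T), ψ s = 0 := by
        refine (intervalIntegral.integral_congr (g := fun _ => 0)
          fun s hs => hz' s fun h => ?_).trans (by simp)
        rw [uIcc_of_le (le_max_left _ _)] at hs
        linarith [hs.1, h.2]
      have h4 : ∫ s in (0 : ℝ)..(max t T), ψ s = ∫ s, ψ s := by
        rw [intervalIntegral.integral_of_le (hT.le.trans (le_max_right _ _))]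
        refine setIntegral_eq_integral_of_forall_compl_eq_zero fun s hs => hz s fun h => hs ?_
        exact ⟨h.1, h.2.le.trans (le_max_right _ _)⟩
      have h5 := intervalIntegral.integral_add_adjacent_intervals
        (hc.intervalIntegrable 0 t) (hc.intervalIntegrable (μ := volume) t (max t T))
      simp only
      linarith
  have hts : tsupport (fun t => ∫ s in (0 : ℝ)..t, ψ s) ⊆ Icc a b :=
    closure_minimal hsupp isClosed_Icc
  refine ⟨_, ⟨?_, ?_, ?_⟩, hder⟩
  · rw [contDiff_infty_iff_deriv, hder]
    exact ⟨fun t => (hD t).differentiableAt, hψ.1⟩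
  · exact HasCompactSupport.intro isCompact_Icc fun x hx => by
      by_contra h
      exact hx (hsupp h)
  · exact hts.trans fun x hx => ⟨ha.trans_le hx.1, hx.2.trans_lt hb⟩

/-- If the weak derivative of `h` on `(0,T)` is an integrable function `k`, then `h` is a
primitive of `k`. -/
theorem ae_eq_const_add_primitive {E : Type*} [NormedAddCommGroup E] [NormedSpace ℝ E]
    [CompleteSpace E] {T : ℝ} (hT : 0 < T) {h k : ℝ → E} (hh : IntegrableOn h (Ioo 0 T))
    (hk : IntegrableOn k (Ioo 0 T))
    (hweak : ∀ φ : ℝ → ℝ, IsTest (Ioo 0 T) φ →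
      ∫ t in Ioo 0 T, deriv φ t • h t = - ∫ t in Ioo 0 T, φ t • k t) :
    ∃ c : E, ∀ᵐ t ∂(timeMeasure T), h t = c + ∫ s in (0 : ℝ)..t, k s := by
  have hP : IntegrableOn (fun t => ∫ s in (0 : ℝ)..t, k s) (Ioo 0 T) :=
    ((continuousOn_primitive_Icc hT.le hk).integrableOn_Icc).mono_set Ioo_subset_Icc_self
  set z : ℝ → E := fun t => h t - ∫ s in (0 : ℝ)..t, k s with hz
  have hzi : IntegrableOn z (Ioo 0 T) := hh.sub hP
  have hz0 : ∀ φ : ℝ → ℝ, IsTest (Ioo 0 T) φ → ∫ t in Ioo 0 T, deriv φ t • z t = 0 := by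
    intro φ hφ
    have h1 := integral_deriv_smul_primitive hk hφ.1 (hφ.eq_zero_of_notMem (x := T) (by simp))
    simp only [hz, smul_sub]
    rw [integral_sub, hweak φ hφ, h1, sub_self]
    · exact integrableOn_smul_of_continuous hφ.continuous_deriv hh
    · exact integrableOn_smul_of_continuous hφ.continuous_deriv hP
  obtain ⟨φ₀, hφ₀, hint⟩ := exists_isTest_Ioo_integral_one hT
  set c : E := ∫ t in Ioo 0 T, φ₀ t • z t with hc
  have key : ∀ᵐ t, t ∈ Ioo 0 T → z t - c = 0 := by
    refine isOpen_Ioo.ae_eq_zero_of_integral_contDiff_smul_eq_zero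
      (hzi.sub (integrableOn_const (by simp))).locallyIntegrableOn ?_
    intro ψ h1 h2 h3
    have hψ : IsTest (Ioo 0 T) ψ := ⟨h1, h2, h3⟩
    have hset : ∀ χ : ℝ → ℝ, IsTest (Ioo 0 T) χ → ∀ y : ℝ → E,
        ∫ t, χ t • y t = ∫ t in Ioo 0 T, χ t • y t := fun χ hχ y =>
      (setIntegral_eq_integral_of_forall_compl_eq_zero fun s hs => by
        rw [hχ.eq_zero_of_notMem hs, zero_smul]).symm
    set I : ℝ := ∫ t, ψ t with hI
    -- Du Bois-Reymond: subtracting the right multiple of `φ₀` makes the integral vanish, so the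
    -- result is a derivative and annihilates `z`. This forces `z` to equal its `φ₀`-weighted mean
    -- `c`.
    have hχ : IsTest (Ioo 0 T) (fun t => ψ t - I * φ₀ t) := by
      refine ⟨h1.sub (contDiff_const.mul hφ₀.1), h2.sub (hφ₀.2.1.mul_left), ?_⟩
      refine (tsupport_sub _ _).trans (union_subset h3 ?_)
      exact (closure_mono fun x hx => by
        simp only [Function.mem_support] at hx ⊢
        exact right_ne_zero_of_mul hx).trans hφ₀.2.2
    obtain ⟨φ, hφ, hd⟩ := hχ.exists_deriv_eq hT (by
      rw [integral_sub (h1.continuous.integrable_of_hasCompactSupport h2)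
        ((hφ₀.1.continuous.integrable_of_hasCompactSupport hφ₀.2.1).const_mul _),
        integral_const_mul, hint, mul_one, sub_self])
    have h4 := hz0 φ hφ
    rw [hd] at h4
    rw [hset ψ hψ]
    have i1 : IntegrableOn (fun t => ψ t • z t) (Ioo 0 T) :=
      integrableOn_smul_of_continuous h1.continuous hzi
    have i2 : IntegrableOn (fun t => φ₀ t • z t) (Ioo 0 T) :=
      integrableOn_smul_of_continuous hφ₀.1.continuous hzi
    simp only [sub_smul, mul_smul] at h4
    rw [integral_sub i1 (g := fun t => I • φ₀ t • z t) (i2.smul I), integral_smul, ← hc] at h4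
    simp only [smul_sub]
    rw [integral_sub i1 (integrableOn_smul_of_continuous h1.continuous
      (integrableOn_const (by simp))), ← hset ψ hψ (fun _ => c), integral_smul_const, ← hI, h4]
  refine ⟨c, (ae_restrict_iff' measurableSet_Ioo).2 ?_⟩
  filter_upwards [key] with t ht hmem
  have := ht hmem
  rw [sub_eq_zero, hz, sub_eq_iff_eq_add] at this
  exact this

/-- If the weak derivative of `h` on `[0,T)` with initial value `a` is an integrable function
`k`, then `h` is the primitive of `k` with `h(0) = a`. -/
theorem ae_eq_initial_add_primitive {E : Type*} [NormedAddCommGroup E] [NormedSpace ℝ E]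
    [CompleteSpace E] {T : ℝ} (hT : 0 < T) {h k : ℝ → E} {a : E}
    (hh : IntegrableOn h (Ioo 0 T)) (hk : IntegrableOn k (Ioo 0 T))
    (hweak : ∀ φ : ℝ → ℝ, IsTest (Iio T) φ →
      - (∫ t in Ioo 0 T, deriv φ t • h t) - φ 0 • a = ∫ t in Ioo 0 T, φ t • k t) :
    ∀ᵐ t ∂(timeMeasure T), h t = a + ∫ s in (0 : ℝ)..t, k s := by
  obtain ⟨c, hc⟩ := ae_eq_const_add_primitive hT hh hk fun φ hφ => by
    have h1 := hweak φ (hφ.mono fun x hx => hx.2)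
    rw [hφ.eq_zero_of_notMem (x := 0) (by simp), zero_smul, sub_zero] at h1
    rw [← h1, neg_neg]
  obtain ⟨φ, hφ, h0⟩ := exists_isTest_Iio_zero_one hT
  have hP : IntegrableOn (fun t => ∫ s in (0 : ℝ)..t, k s) (Ioo 0 T) :=
    ((continuousOn_primitive_Icc hT.le hk).integrableOn_Icc).mono_set Ioo_subset_Icc_self
  have hφT : φ T = 0 := hφ.eq_zero_of_notMem (by simp)
  -- With `φ 0 = 1`, the boundary term at `0` reads off the constant of integration and compares it
  -- with `a`.
  have h1 := hweak φ hφ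
  have h2 : ∫ t in Ioo 0 T, deriv φ t • h t = -c - ∫ t in Ioo 0 T, φ t • k t := by
    have h3 : ∫ t in Ioo 0 T, deriv φ t • h t
        = ∫ t in Ioo 0 T, (deriv φ t • c + deriv φ t • ∫ s in (0 : ℝ)..t, k s) := by
      refine integral_congr_ae ?_
      filter_upwards [hc] with t ht
      rw [ht, smul_add]
    rw [h3, integral_add
      (integrableOn_smul_of_continuous hφ.continuous_deriv (integrableOn_const (by simp)))
      (integrableOn_smul_of_continuous hφ.continuous_deriv hP),
      integral_deriv_smul_primitive hk hφ.1 hφT, integral_smul_const,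
      ← integral_Ioc_eq_integral_Ioo, ← intervalIntegral.integral_of_le hT.le,
      intervalIntegral.integral_deriv_eq_sub (fun x _ => (hφ.1.differentiable (by simp)) x)
        (hφ.continuous_deriv.intervalIntegrable _ _), hφT, h0]
    simp [sub_eq_add_neg]
  have h4 : c = a := by
    rw [h2, h0, one_smul] at h1
    rw [← sub_eq_zero, ← sub_eq_zero.2 h1]
    abel
  rwa [h4] at hc

/-! ### Square integrable functions with values in a Hilbert space -/

theorem integrable_inner_of_memLp {α H : Type*} [MeasurableSpace α] {m : Measure α}
    [NormedAddCommGroup H] [InnerProductSpace ℝ H] {x y : α → H} (hx : MemLp x 2 m)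
    (hy : MemLp y 2 m) : Integrable (fun t => ⟪x t, y t⟫) m := by
  refine (L2.integrable_inner (𝕜 := ℝ) (hx.toLp x) (hy.toLp y)).congr ?_
  filter_upwards [hx.coeFn_toLp, hy.coeFn_toLp] with t h1 h2
  rw [h1, h2]

theorem integrable_norm_sq_of_memLp {α H : Type*} [MeasurableSpace α] {m : Measure α}
    [NormedAddCommGroup H] {x : α → H} (hx : MemLp x 2 m) :
    Integrable (fun t => ‖x t‖ ^ 2) m :=
  MemLp.integrable_norm_pow (p := 2) (by exact_mod_cast hx) two_ne_zero

/-- The Cauchy--Schwarz inequality for the integral of a scalar product. -/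
theorem abs_integral_inner_le {α H : Type*} [MeasurableSpace α] {m : Measure α}
    [NormedAddCommGroup H] [InnerProductSpace ℝ H] {x y : α → H} (hx : MemLp x 2 m)
    (hy : MemLp y 2 m) :
    |∫ t, ⟪x t, y t⟫ ∂m| ≤ √(∫ t, ‖x t‖ ^ 2 ∂m) * √(∫ t, ‖y t‖ ^ 2 ∂m) := by
  have key : ∀ {a b : α → H} (ha : MemLp a 2 m) (hb : MemLp b 2 m),
      ⟪ha.toLp a, hb.toLp b⟫ = ∫ t, ⟪a t, b t⟫ ∂m := by
    intro a b ha hb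
    rw [L2.inner_def]
    refine integral_congr_ae ?_
    filter_upwards [ha.coeFn_toLp, hb.coeFn_toLp] with t h1 h2
    rw [h1, h2]
  have hn : ∀ {a : α → H} (ha : MemLp a 2 m), ‖ha.toLp a‖ = √(∫ t, ‖a t‖ ^ 2 ∂m) := by
    intro a ha
    have := key ha ha
    simp only [real_inner_self_eq_norm_sq] at this
    rw [← this, Real.sqrt_sq (norm_nonneg _)]
  rw [← key hx hy, ← hn hx, ← hn hy]
  exact abs_real_inner_le_norm _ _

theorem sq_norm_intervalIntegral_le {H : Type*} [NormedAddCommGroup H] [NormedSpace ℝ H]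
    {g : ℝ → H} (hg : MemLp g 2) {a b : ℝ} (hab : a ≤ b) :
    ‖∫ s in a..b, g s‖ ^ 2 ≤ (b - a) * ∫ s in a..b, ‖g s‖ ^ 2 := by
  have h1 : ‖∫ s in a..b, g s‖ ≤ ∫ s in a..b, ‖g s‖ :=
    intervalIntegral.norm_integral_le_integral_norm hab
  have h2 : MemLp (fun s => ‖g s‖) 2 (volume.restrict (Ioc a b)) := hg.norm.restrict _
  have h3 := abs_integral_inner_le (memLp_const (1 : ℝ)) h2
  have h4 : (0 : ℝ) ≤ ∫ s in Ioc a b, ‖g s‖ ^ 2 := integral_nonneg fun _ => by positivity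
  simp only [Real.norm_eq_abs, sq_abs] at h3
  rw [← Real.sqrt_mul (integral_nonneg fun _ => by positivity)] at h3
  simp only [RCLike.inner_apply, conj_trivial, mul_one, one_pow, integral_const] at h3
  simp only [intervalIntegral.integral_of_le hab] at h1 ⊢
  have h5 : ((volume.restrict (Ioc a b)).real univ) = b - a := by
    simp [Measure.real, hab]
  rw [h5, smul_eq_mul, mul_one] at h3
  have h6 := h1.trans ((le_abs_self _).trans h3)
  calc ‖∫ s in Ioc a b, g s‖ ^ 2 ≤ (√((b - a) * ∫ s in Ioc a b, ‖g s‖ ^ 2)) ^ 2 :=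
        pow_le_pow_left₀ (norm_nonneg _) h6 2
    _ = _ := Real.sq_sqrt (mul_nonneg (sub_nonneg.2 hab) h4)

/-! ### Steklov averages -/

/-- The backward Steklov average of `g`. -/
def steklov {H : Type*} [NormedAddCommGroup H] [NormedSpace ℝ H] (h : ℝ) (g : ℝ → H) (t : ℝ) :
    H :=
  h⁻¹ • ∫ s in (t - h)..t, g s

theorem continuous_steklov {H : Type*} [NormedAddCommGroup H] [NormedSpace ℝ H] (h : ℝ)
    {g : ℝ → H} (hg : Integrable g) : Continuous (steklov h g) := by
  have hG : Continuous fun t => ∫ s in (0 : ℝ)..t, g s :=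
    intervalIntegral.continuous_primitive (fun _ _ => hg.intervalIntegrable) 0
  have : steklov h g = fun t =>
      h⁻¹ • ((∫ s in (0 : ℝ)..t, g s) - ∫ s in (0 : ℝ)..(t - h), g s) := by
    funext t
    rw [steklov, intervalIntegral.integral_interval_sub_left hg.intervalIntegrable
      hg.intervalIntegrable]
  rw [this]
  exact (hG.sub (hG.comp (continuous_id.sub continuous_const))).const_smul _

/-- The two integrals cancel on their overlap, leaving strips of length `h` at the ends. This
replaces differentiation of the energy in time. -/
theorem integral_sub_shift {f : ℝ → ℝ} (hf : ∀ a b, IntervalIntegrable f volume a b)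
    (a b h : ℝ) : ∫ t in a..b, (f t - f (t - h)) = (∫ t in (b - h)..b, f t) -
      ∫ t in (a - h)..a, f t := by
  have h1 : IntervalIntegrable (fun t => f (t - h)) volume a b := by
    simpa using (hf (a - h) (b - h)).comp_sub_right h
  rw [intervalIntegral.integral_sub (hf _ _) h1, intervalIntegral.integral_comp_sub_right]
  have h2 := intervalIntegral.integral_add_adjacent_intervals (hf (a - h) a) (hf a b)
  have h3 := intervalIntegral.integral_add_adjacent_intervals (hf (a - h) (b - h)) (hf (b - h) b)
  linarith

/-- Steklov averages do not increase the `L²`-norm. -/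
theorem integral_sq_steklov_le {H : Type*} [NormedAddCommGroup H] [NormedSpace ℝ H]
    {h : ℝ} (hh : 0 < h) {g : ℝ → H} (hg : Integrable g) (hg2 : MemLp g 2) {a b : ℝ}
    (hab : a ≤ b) :
    ∫ t in a..b, ‖steklov h g t‖ ^ 2 ≤ ∫ t, ‖g t‖ ^ 2 := by
  have hi : Integrable (fun t => ‖g t‖ ^ 2) := integrable_norm_sq_of_memLp hg2
  -- `ν` is the accumulated energy. Cauchy–Schwarz bounds the squared average by `h⁻¹ (ν t - ν (t -
  -- h))`, whose integral telescopes; monotonicity of `ν` supplies integrability.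
  set ν : ℝ → ℝ := fun t => ∫ s in Iic t, ‖g s‖ ^ 2 with hν
  have hνsub : ∀ x y, ν y - ν x = ∫ s in x..y, ‖g s‖ ^ 2 := fun x y =>
    intervalIntegral.integral_Iic_sub_Iic hi.integrableOn hi.integrableOn
  have hmono : Monotone ν := fun x y hxy =>
    setIntegral_mono_set hi.integrableOn (Eventually.of_forall fun _ => by positivity)
      (Eventually.of_forall fun s (hs : s ∈ Iic x) => mem_Iic.2 (le_trans (mem_Iic.1 hs) hxy))
  have hν0 : ∀ x, 0 ≤ ν x := fun x => integral_nonneg fun _ => by positivity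
  have hν1 : ∀ x, ν x ≤ ∫ t, ‖g t‖ ^ 2 := fun x =>
    setIntegral_le_integral hi (Eventually.of_forall fun _ => by positivity)
  have hII : ∀ a b, IntervalIntegrable ν volume a b := fun a b => hmono.intervalIntegrable
  have hII' : ∀ a b, IntervalIntegrable (fun t => ν (t - h)) volume a b := fun a b => by
    simpa using (hII (a - h) (b - h)).comp_sub_right h
  have h1 : ∀ t, ‖steklov h g t‖ ^ 2 ≤ h⁻¹ * (ν t - ν (t - h)) := by
    intro t
    rw [steklov, norm_smul, mul_pow, norm_inv, Real.norm_of_nonneg hh.le, hνsub]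
    have := sq_norm_intervalIntegral_le hg2 (a := t - h) (b := t) (by linarith)
    calc (h⁻¹) ^ 2 * ‖∫ s in (t - h)..t, g s‖ ^ 2
        ≤ (h⁻¹) ^ 2 * ((t - (t - h)) * ∫ s in (t - h)..t, ‖g s‖ ^ 2) := by gcongr
      _ = _ := by field_simp; ring
  have h2 : ∫ t in a..b, ‖steklov h g t‖ ^ 2 ≤ ∫ t in a..b, h⁻¹ * (ν t - ν (t - h)) :=
    intervalIntegral.integral_mono_on hab
      ((((continuous_steklov h hg).norm).pow 2).intervalIntegrable _ _)
      (((hII _ _).sub (hII' _ _)).const_mul _) fun t _ => h1 t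
  rw [intervalIntegral.integral_const_mul, integral_sub_shift hII] at h2
  have h3 : ∫ t in (b - h)..b, ν t ≤ h * ∫ t, ‖g t‖ ^ 2 := by
    refine (intervalIntegral.integral_mono_on (by linarith) (hII _ _)
      intervalIntegrable_const fun t _ => hν1 t).trans_eq ?_
    simp
  have h4 : 0 ≤ ∫ t in (a - h)..a, ν t :=
    intervalIntegral.integral_nonneg (by linarith) fun t _ => hν0 t
  calc ∫ t in a..b, ‖steklov h g t‖ ^ 2
      ≤ h⁻¹ * ((∫ t in (b - h)..b, ν t) - ∫ t in (a - h)..a, ν t) := h2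
    _ ≤ h⁻¹ * (h * ∫ t, ‖g t‖ ^ 2) := by gcongr; linarith
    _ = _ := by field_simp

theorem norm_steklov_sub_le {H : Type*} [NormedAddCommGroup H] [NormedSpace ℝ H]
    [CompleteSpace H] {h ε : ℝ} (hh : 0 < h) {g : ℝ → H} (hg : Continuous g) {t : ℝ}
    (hε : ∀ s ∈ Icc (t - h) t, ‖g s - g t‖ ≤ ε) : ‖steklov h g t - g t‖ ≤ ε := by
  have h1 : steklov h g t - g t = h⁻¹ • ∫ s in (t - h)..t, (g s - g t) := by
    rw [intervalIntegral.integral_sub (hg.intervalIntegrable _ _) intervalIntegrable_const,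
      intervalIntegral.integral_const, sub_sub_cancel, smul_sub, smul_smul,
      inv_mul_cancel₀ hh.ne', one_smul, steklov]
  rw [h1, norm_smul, norm_inv, Real.norm_of_nonneg hh.le]
  have h2 : ‖∫ s in (t - h)..t, (g s - g t)‖ ≤ ε * |t - (t - h)| :=
    intervalIntegral.norm_integral_le_of_norm_le_const fun s hs => by
      rw [uIoc_of_le (by linarith)] at hs
      exact hε s (Ioc_subset_Icc_self hs)
  rw [sub_sub_cancel, abs_of_pos hh] at h2
  calc h⁻¹ * ‖∫ s in (t - h)..t, (g s - g t)‖ ≤ h⁻¹ * (ε * h) := by gcongr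
    _ = ε := by field_simp

/-- Steklov averages converge in `L²` on bounded intervals. -/
theorem tendsto_integral_sq_steklov_sub {H : Type*} [NormedAddCommGroup H] [NormedSpace ℝ H]
    [CompleteSpace H] {g : ℝ → H} (hg : Integrable g) (hg2 : MemLp g 2) {a b : ℝ} (hab : a ≤ b) :
    Tendsto (fun h => ∫ t in a..b, ‖steklov h g t - g t‖ ^ 2) (𝓝[>] (0 : ℝ)) (𝓝 0) := by
  rw [Metric.tendsto_nhds]
  intro ε hε
  -- Approximate by a continuous compactly supported `k`, for which the averages converge uniformly.
  -- Squaring a sum of three terms costs a factor `3`, so the two approximation errors contribute `3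
  -- · ε/12` each and the uniform error less than `ε/2`.
  obtain ⟨k, hkc, hkε, hk, hk2⟩ := MemLp.exists_hasCompactSupport_integral_rpow_sub_le
    (p := 2) two_pos (f := g) (μ := volume) (by simpa using hg2) (ε := ε / 12) (by positivity)
  have hk2 : MemLp k 2 := by simpa using hk2
  have hki : Integrable k := hk.integrable_of_hasCompactSupport hkc
  simp only [Real.rpow_ofNat] at hkε
  -- The added `1` keeps the denominator positive when `a = b`.
  obtain ⟨r, hr, hr2⟩ : ∃ r : ℝ, 0 < r ∧ 3 * (r ^ 2 * (b - a)) < ε / 2 := by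
    refine ⟨√(ε / (12 * (b - a + 1))), Real.sqrt_pos.2 (by
      have : 0 < b - a + 1 := by linarith
      positivity), ?_⟩
    have : 0 < b - a + 1 := by linarith
    rw [Real.sq_sqrt (by positivity)]
    have : ε / (12 * (b - a + 1)) * (b - a) ≤ ε / 12 := by
      rw [div_mul_eq_mul_div, div_le_div_iff₀ (by positivity) (by norm_num)]
      nlinarith
    linarith
  have huc : UniformContinuous k := hkc.uniformContinuous_of_continuous hk
  obtain ⟨δ, hδ, hδk⟩ := Metric.uniformContinuous_iff.1 huc r hr
  filter_upwards [Ioo_mem_nhdsGT hδ] with h hh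
  have hpos : 0 < h := hh.1
  have hlin : ∀ t, steklov h g t = steklov h (g - k) t + steklov h k t := by
    intro t
    simp only [steklov, Pi.sub_apply]
    rw [intervalIntegral.integral_sub hg.intervalIntegrable hki.intervalIntegrable, ← smul_add,
      sub_add_cancel]
  have hpt : ∀ t, ‖steklov h g t - g t‖ ^ 2 ≤
      3 * (‖steklov h (g - k) t‖ ^ 2 + r ^ 2 + ‖g t - k t‖ ^ 2) := by
    intro t
    have h1 : steklov h g t - g t =
        steklov h (g - k) t + (steklov h k t - k t) - (g t - k t) := by
      rw [hlin]; abel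
    have h2 : ‖steklov h k t - k t‖ ≤ r := by
      refine norm_steklov_sub_le hpos hk fun s hs => ?_
      rw [← dist_eq_norm]
      refine (hδk ?_).le
      rw [Real.dist_eq, abs_lt]
      constructor <;> linarith [hs.1, hs.2, hh.2]
    have h3 : ‖steklov h g t - g t‖ ≤ ‖steklov h (g - k) t‖ + r + ‖g t - k t‖ := by
      rw [h1]
      refine (norm_sub_le _ _).trans ?_
      gcongr
      exact (norm_add_le _ _).trans (by gcongr)
    calc ‖steklov h g t - g t‖ ^ 2 ≤ (‖steklov h (g - k) t‖ + r + ‖g t - k t‖) ^ 2 := by gcongr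
      _ ≤ _ := by
        nlinarith [sq_nonneg (‖steklov h (g - k) t‖ - r), sq_nonneg (r - ‖g t - k t‖),
          sq_nonneg (‖steklov h (g - k) t‖ - ‖g t - k t‖)]
  have i1 : IntervalIntegrable (fun t => ‖steklov h (g - k) t‖ ^ 2) volume a b :=
    ((((continuous_steklov h (hg.sub hki)).norm).pow 2).intervalIntegrable _ _)
  have hi3 : Integrable fun t => ‖g t - k t‖ ^ 2 := integrable_norm_sq_of_memLp (hg2.sub hk2)
  have i3 : IntervalIntegrable (fun t => ‖g t - k t‖ ^ 2) volume a b := hi3.intervalIntegrable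
  have i0 : IntervalIntegrable (fun t => ‖steklov h g t - g t‖ ^ 2) volume a b := by
    have hs : MemLp (steklov h g) 2 (volume.restrict (Icc a b)) := by
      obtain ⟨C, hC⟩ := isCompact_Icc.exists_bound_of_continuousOn
        (s := Icc a b) (continuous_steklov h hg).continuousOn
      exact MemLp.of_bound (continuous_steklov h hg).aestronglyMeasurable C
        ((ae_restrict_iff' measurableSet_Icc).2 (Eventually.of_forall hC))
    rw [intervalIntegrable_iff_integrableOn_Icc_of_le hab]
    exact integrable_norm_sq_of_memLp (hs.sub (hg2.restrict _))
  have hbound : ∫ t in a..b, ‖steklov h g t - g t‖ ^ 2 ≤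
      3 * ((∫ t in a..b, ‖steklov h (g - k) t‖ ^ 2) + r ^ 2 * (b - a)
        + ∫ t in a..b, ‖g t - k t‖ ^ 2) := by
    refine (intervalIntegral.integral_mono_on hab i0
      (((i1.add intervalIntegrable_const).add i3).const_mul 3) fun t _ => hpt t).trans_eq ?_
    rw [intervalIntegral.integral_const_mul,
      intervalIntegral.integral_add (i1.add intervalIntegrable_const) i3,
      intervalIntegral.integral_add i1 intervalIntegrable_const, intervalIntegral.integral_const,
      smul_eq_mul, mul_comm (b - a)]
  have b1 : ∫ t in a..b, ‖steklov h (g - k) t‖ ^ 2 ≤ ε / 12 :=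
    (integral_sq_steklov_le hpos (hg.sub hki) (hg2.sub hk2) hab).trans hkε
  have b3 : ∫ t in a..b, ‖g t - k t‖ ^ 2 ≤ ε / 12 := by
    rw [intervalIntegral.integral_of_le hab]
    exact (setIntegral_le_integral hi3 (Eventually.of_forall fun _ => by positivity)).trans hkε
  have h0 : 0 ≤ ∫ t in a..b, ‖steklov h g t - g t‖ ^ 2 :=
    intervalIntegral.integral_nonneg hab fun _ _ => by positivity
  rw [Real.dist_eq, sub_zero, abs_of_nonneg h0]
  linarith

theorem tendsto_integral_inner_steklov {H : Type*} [NormedAddCommGroup H] [InnerProductSpace ℝ H]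
    [CompleteSpace H] {g u : ℝ → H} (hg : Integrable g) (hg2 : MemLp g 2) (hu : MemLp u 2)
    {a b : ℝ} (hab : a ≤ b) :
    Tendsto (fun h => ∫ t in a..b, ⟪steklov h g t, u t⟫) (𝓝[>] (0 : ℝ))
      (𝓝 (∫ t in a..b, ⟪g t, u t⟫)) := by
  rw [tendsto_iff_norm_sub_tendsto_zero]
  have hs : ∀ h, MemLp (steklov h g) 2 (volume.restrict (Ioc a b)) := by
    intro h
    obtain ⟨C, hC⟩ := isCompact_Icc.exists_bound_of_continuousOn
      (s := Icc a b) (continuous_steklov h hg).continuousOn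
    exact MemLp.of_bound (continuous_steklov h hg).aestronglyMeasurable C
      ((ae_restrict_iff' measurableSet_Ioc).2
        (Eventually.of_forall fun t ht => hC t (Ioc_subset_Icc_self ht)))
  have hlim := (Real.continuous_sqrt.tendsto 0).comp (tendsto_integral_sq_steklov_sub hg hg2 hab)
  have hlim' := hlim.mul_const (√(∫ t in Ioc a b, ‖u t‖ ^ 2))
  rw [Real.sqrt_zero, zero_mul] at hlim'
  refine squeeze_zero (fun _ => norm_nonneg _) (fun h => ?_) hlim'
  have h1 := abs_integral_inner_le ((hs h).sub (hg2.restrict _)) (hu.restrict (Ioc a b))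
  simp only [Pi.sub_apply, inner_sub_left] at h1
  rw [integral_sub (integrable_inner_of_memLp (hs h) (hu.restrict _))
    (integrable_inner_of_memLp (hg2.restrict _) (hu.restrict _))] at h1
  simpa [intervalIntegral.integral_of_le hab] using h1

/-! ### The energy inequality and Grönwall's inequality -/

/-- The energy inequality: if `⟪e u(t), e v⟫ = ⟪a, e v⟫ + ∫₀ᵗ ⟪g, v⟫` for all `v` in a subspace
containing the values of `u`, then `‖e u(τ)‖² ≤ ‖a‖² + 2 ∫₀^τ ⟪g, u⟫` for almost every `τ`. -/
theorem energy_inequality {H K : Type*} [NormedAddCommGroup H] [InnerProductSpace ℝ H]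
    [CompleteSpace H] [NormedAddCommGroup K] [InnerProductSpace ℝ K] (e : H →L[ℝ] K)
    (S : Submodule ℝ H) {T : ℝ} {u g : ℝ → H} {a : K} (hu : MemLp u 2 (timeMeasure T))
    (hg : MemLp g 2 (timeMeasure T)) (huS : ∀ᵐ t ∂(timeMeasure T), u t ∈ S)
    (heq : ∀ᵐ t ∂(timeMeasure T), ∀ v ∈ S,
      ⟪e (u t), e v⟫ = ⟪a, e v⟫ + ⟪∫ s in (0 : ℝ)..t, g s, v⟫) :
    ∀ᵐ τ ∂(timeMeasure T), ‖e (u τ)‖ ^ 2 ≤ ‖a‖ ^ 2 + 2 * ∫ s in (0 : ℝ)..τ, ⟪g s, u s⟫ := by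
  set G : ℝ → H := (Ioo 0 T).indicator g with hG
  set W : ℝ → H := (Ioo 0 T).indicator u with hW
  have hG2 : MemLp G 2 := (memLp_indicator_iff_restrict measurableSet_Ioo).2 hg
  have hW2 : MemLp W 2 := (memLp_indicator_iff_restrict measurableSet_Ioo).2 hu
  have hGi : Integrable G :=
    (integrable_indicator_iff measurableSet_Ioo).2 (hg.integrable one_le_two)
  have hG0 : ∀ t ≤ 0, ∫ s in (0 : ℝ)..t, G s = 0 := by
    intro t ht
    refine (intervalIntegral.integral_congr (g := fun _ => 0) fun s hs => ?_).trans (by simp)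
    rw [uIcc_of_ge ht] at hs
    exact indicator_of_notMem (fun h => absurd h.1 (not_lt.2 hs.2)) _
  have hGpos : ∀ t ∈ Ioo 0 T, ∫ s in (0 : ℝ)..t, G s = ∫ s in (0 : ℝ)..t, g s := by
    intro t ht
    rw [intervalIntegral.integral_of_le ht.1.le, intervalIntegral.integral_of_le ht.1.le]
    exact setIntegral_congr_fun measurableSet_Ioc fun s hs =>
      indicator_of_mem (show s ∈ Ioo 0 T from ⟨hs.1, hs.2.trans_lt ht.2⟩) _
  -- The solution is continued to negative times by its initial value, and `g` by zero. The
  -- integrated equation then holds for almost every `t < T`, so it can be shifted by `h`.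
  set U : ℝ → K := fun t => if t ≤ 0 then a else e (u t) with hU
  have hrep : ∀ᵐ t, t < T → ∀ v ∈ S, ⟪U t, e v⟫ = ⟪a, e v⟫ + ⟪∫ s in (0 : ℝ)..t, G s, v⟫ := by
    filter_upwards [(ae_restrict_iff' measurableSet_Ioo).1 heq] with t ht htT v hv
    by_cases h0 : t ≤ 0
    · simp [hU, h0, hG0 t h0]
    · have hmem : t ∈ Ioo 0 T := ⟨not_le.1 h0, htT⟩
      simp only [hU, h0, if_false]
      rw [ht hmem v hv, hGpos t hmem]
  -- `E` agrees with `‖U‖²` for `t < T`, but is written so that local integrability on the whole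
  -- line is immediate.
  set E : ℝ → ℝ := fun t => (Iic 0).indicator (fun _ => ‖a‖ ^ 2) t + ‖e (W t)‖ ^ 2 with hE
  have hEU : ∀ t < T, E t = ‖U t‖ ^ 2 := by
    intro t ht
    by_cases h0 : t ≤ 0
    · have : W t = 0 := indicator_of_notMem (fun h => absurd h.1 (not_lt.2 h0)) _
      simp [hE, hU, h0, this]
    · have : W t = u t := indicator_of_mem (show t ∈ Ioo 0 T from ⟨not_le.1 h0, ht⟩) _
      simp [hE, hU, h0, this]
  have hElp : Integrable fun t => ‖e (W t)‖ ^ 2 :=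
    integrable_norm_sq_of_memLp (e.comp_memLp' hW2)
  have hEloc : LocallyIntegrable E :=
    ((locallyIntegrable_const (‖a‖ ^ 2)).indicator measurableSet_Iic).add hElp.locallyIntegrable
  have hEII : ∀ x y, IntervalIntegrable E volume x y := fun x y =>
    (hEloc.integrableOn_isCompact isCompact_uIcc).intervalIntegrable
  rw [ae_restrict_iff' measurableSet_Ioo]
  filter_upwards [LocallyIntegrable.ae_hasDerivAt_integral hEloc] with τ hder hτ
  -- The energy inequality at level `h`: subtract the equations at times `t` and `t - h`, test with
  -- `u t`, integrate over `(0,τ)` and divide by `h`.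
  have hineq : ∀ h ∈ Ioo 0 τ, h⁻¹ * (∫ t in (τ - h)..τ, E t) - ‖a‖ ^ 2 ≤
      2 * ∫ t in (0 : ℝ)..τ, ⟪steklov h G t, W t⟫ := by
    intro h hh
    have hpt : ∀ᵐ t, t ∈ Ioc 0 τ → E t - E (t - h) ≤ 2 * (h * ⟪steklov h G t, W t⟫) := by
      have hshift := (measurePreserving_sub_right volume h).quasiMeasurePreserving.ae hrep
      filter_upwards [hrep, hshift, (ae_restrict_iff' measurableSet_Ioo).1 huS] with t h1 h2 h3 ht
      have htT : t < T := ht.2.trans_lt hτ.2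
      have hmem : t ∈ Ioo 0 T := ⟨ht.1, htT⟩
      have h4 := h1 htT (u t) (h3 hmem)
      have h5 := h2 (by linarith [hh.1]) (u t) (h3 hmem)
      have hUt : U t = e (u t) := by simp [hU, not_le.2 ht.1]
      have hWt : W t = u t := indicator_of_mem hmem _
      have h6 : h * ⟪steklov h G t, W t⟫ = ⟪U t - U (t - h), U t⟫ := by
        rw [hUt] at h4 ⊢
        rw [inner_sub_left, h5, h4, hWt, steklov, ← intervalIntegral.integral_interval_sub_left
          hGi.intervalIntegrable (hGi.intervalIntegrable (a := 0) (b := t - h)),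
          real_inner_smul_left, inner_sub_left, mul_inv_cancel_left₀ hh.1.ne']
        ring
      rw [hEU t htT, hEU (t - h) (by linarith [hh.1]), h6]
      -- This gives `‖x‖² - ‖y‖² ≤ 2 ⟪x - y, x⟫`; the discarded square is why only an inequality
      -- results. Only the later value, which lies in `S` almost everywhere, is used as a test
      -- element.
      have h7 : ‖U (t - h)‖ ^ 2 = ‖U t - (U t - U (t - h))‖ ^ 2 := by rw [sub_sub_cancel]
      rw [h7, norm_sub_sq_real, real_inner_comm]
      nlinarith [sq_nonneg ‖U t - U (t - h)‖]
    have hmemS : MemLp (steklov h G) 2 (volume.restrict (Ioc 0 τ)) := by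
      obtain ⟨C, hC⟩ := isCompact_Icc.exists_bound_of_continuousOn
        (s := Icc 0 τ) (continuous_steklov h hGi).continuousOn
      exact MemLp.of_bound (continuous_steklov h hGi).aestronglyMeasurable C
        ((ae_restrict_iff' measurableSet_Ioc).2
          (Eventually.of_forall fun t ht => hC t (Ioc_subset_Icc_self ht)))
    have hII' : IntervalIntegrable (fun t => E (t - h)) volume 0 τ := by
      simpa using (hEII (0 - h) (τ - h)).comp_sub_right h
    have h8 : ∫ t in (0 : ℝ)..τ, (E t - E (t - h)) ≤
        ∫ t in (0 : ℝ)..τ, 2 * (h * ⟪steklov h G t, W t⟫) := by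
      rw [intervalIntegral.integral_of_le hτ.1.le, intervalIntegral.integral_of_le hτ.1.le]
      refine integral_mono_ae ((hEII 0 τ).sub hII').1
        (((integrable_inner_of_memLp hmemS (hW2.restrict _)).const_mul _).const_mul _) ?_
      exact (ae_restrict_iff' measurableSet_Ioc).2 hpt
    rw [integral_sub_shift hEII, intervalIntegral.integral_const_mul,
      intervalIntegral.integral_const_mul] at h8
    have h9 : ∫ t in (0 - h)..0, E t = h * ‖a‖ ^ 2 := by
      rw [intervalIntegral.integral_congr (g := fun _ => ‖a‖ ^ 2)]
      · simp
      · intro t ht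
        rw [uIcc_of_le (by linarith [hh.1])] at ht
        have hT : t < T := by linarith [ht.2, hτ.1, hτ.2]
        simp [hEU t hT, hU, ht.2]
    rw [h9] at h8
    have hh0 : 0 < h := hh.1
    calc h⁻¹ * (∫ t in (τ - h)..τ, E t) - ‖a‖ ^ 2
        = h⁻¹ * ((∫ t in (τ - h)..τ, E t) - h * ‖a‖ ^ 2) := by field_simp
      _ ≤ h⁻¹ * (2 * (h * ∫ t in (0 : ℝ)..τ, ⟪steklov h G t, W t⟫)) := by gcongr
      _ = _ := by field_simp
  have hlimR : Tendsto (fun h => 2 * ∫ t in (0 : ℝ)..τ, ⟪steklov h G t, W t⟫) (𝓝[>] (0 : ℝ))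
      (𝓝 (2 * ∫ t in (0 : ℝ)..τ, ⟪G t, W t⟫)) :=
    (tendsto_integral_inner_steklov hGi hG2 hW2 hτ.1.le).const_mul 2
  have hlimL : Tendsto (fun h => h⁻¹ * (∫ t in (τ - h)..τ, E t) - ‖a‖ ^ 2) (𝓝[>] (0 : ℝ))
      (𝓝 (E τ - ‖a‖ ^ 2)) := by
    refine Tendsto.sub_const ?_ _
    have h1 := hasDerivAt_iff_tendsto_slope_zero.1 (hder 0)
    -- The averages are backward ones, so the difference quotient of the primitive of `E` is
    -- evaluated at increments `-h`.
    have h2 : Tendsto (fun h : ℝ => -h) (𝓝[>] (0 : ℝ)) (𝓝[≠] (0 : ℝ)) := by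
      refine tendsto_nhdsWithin_iff.2 ⟨?_, ?_⟩
      · have : Tendsto (fun h : ℝ => -h) (𝓝 (0 : ℝ)) (𝓝 (-0)) := continuous_neg.tendsto 0
        rw [neg_zero] at this
        exact this.mono_left nhdsWithin_le_nhds
      · filter_upwards [self_mem_nhdsWithin] with h hh
        exact neg_ne_zero.2 (ne_of_gt hh)
    refine (h1.comp h2).congr fun h => ?_
    simp only [Function.comp, ← sub_eq_add_neg, smul_eq_mul]
    rw [intervalIntegral.integral_interval_sub_left (hEII _ _) (hEII _ _),
      intervalIntegral.integral_symm, inv_neg, neg_mul_neg]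
  have hfin := le_of_tendsto_of_tendsto hlimL hlimR (by
    filter_upwards [Ioo_mem_nhdsGT hτ.1] with h hh using hineq h hh)
  have hUτ : E τ = ‖e (u τ)‖ ^ 2 := by rw [hEU τ hτ.2]; simp [hU, not_le.2 hτ.1]
  have hint : ∫ t in (0 : ℝ)..τ, ⟪G t, W t⟫ = ∫ t in (0 : ℝ)..τ, ⟪g t, u t⟫ := by
    rw [intervalIntegral.integral_of_le hτ.1.le, intervalIntegral.integral_of_le hτ.1.le]
    refine setIntegral_congr_fun measurableSet_Ioc fun s hs => ?_
    have hs' : s ∈ Ioo 0 T := ⟨hs.1, hs.2.trans_lt hτ.2⟩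
    simp only [hG, hW, indicator_of_mem hs']
  rw [hUτ, hint] at hfin
  linarith

/-- Grönwall's inequality for an integrable function. -/
theorem gronwall_integral {T A C : ℝ} (hA : 0 ≤ A) (hC : 0 < C) {y : ℝ → ℝ}
    (hy : IntegrableOn y (Ioo 0 T))
    (h : ∀ᵐ t ∂(timeMeasure T), y t ≤ A + C * ∫ s in (0 : ℝ)..t, y s) :
    ∀ t ∈ Icc 0 T, A + C * ∫ s in (0 : ℝ)..t, y s ≤ A * Real.exp (C * T) := by
  set Y : ℝ → ℝ := (Ioo 0 T).indicator y with hY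
  have hYi : Integrable Y := (integrable_indicator_iff measurableSet_Ioo).2 hy
  have hYeq : ∀ t ∈ Icc 0 T, ∫ s in (0 : ℝ)..t, Y s = ∫ s in (0 : ℝ)..t, y s := by
    intro t ht
    rw [intervalIntegral.integral_of_le ht.1, intervalIntegral.integral_of_le ht.1,
      integral_Ioc_eq_integral_Ioo, integral_Ioc_eq_integral_Ioo]
    exact setIntegral_congr_fun measurableSet_Ioo fun s hs =>
      indicator_of_mem (show s ∈ Ioo 0 T from ⟨hs.1, hs.2.trans_le ht.2⟩) _
  -- `y` is merely integrable, so the differential Grönwall lemma is applied to the primitive of the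
  -- continuous majorant `z`, which satisfies `Z' ≤ C Z + A` and `Z(0) = 0`.
  set z : ℝ → ℝ := fun t => A + C * ∫ s in (0 : ℝ)..t, Y s with hz
  have hzc : Continuous z := continuous_const.add (continuous_const.mul
    (intervalIntegral.continuous_primitive (fun _ _ => hYi.intervalIntegrable) 0))
  have hyz : ∀ᵐ t ∂(timeMeasure T), Y t ≤ z t := by
    filter_upwards [h, ae_restrict_mem measurableSet_Ioo] with t ht hmem
    rw [hz]
    simp only
    rw [hYeq t (Ioo_subset_Icc_self hmem), hY, indicator_of_mem hmem]
    exact ht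
  have hzz : ∀ t ∈ Icc 0 T, z t ≤ C * (∫ s in (0 : ℝ)..t, z s) + A := by
    intro t ht
    have : ∫ s in (0 : ℝ)..t, Y s ≤ ∫ s in (0 : ℝ)..t, z s := by
      rw [intervalIntegral.integral_of_le ht.1, intervalIntegral.integral_of_le ht.1,
        integral_Ioc_eq_integral_Ioo, integral_Ioc_eq_integral_Ioo]
      exact integral_mono_ae hYi.integrableOn
        ((hzc.integrableOn_Icc (a := 0) (b := t)).mono_set Ioo_subset_Icc_self)
        (ae_restrict_of_ae_restrict_of_subset (Ioo_subset_Ioo_right ht.2) hyz)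
    rw [add_comm, hz]
    simp only
    gcongr
  have hD : ∀ t, HasDerivAt (fun t => ∫ s in (0 : ℝ)..t, z s) (z t) t := fun t =>
    intervalIntegral.integral_hasDerivAt_right (hzc.intervalIntegrable _ _)
      (hzc.stronglyMeasurableAtFilter _ _) hzc.continuousAt
  have hgr := le_gronwallBound_of_liminf_deriv_right_le (f := fun t => ∫ s in (0 : ℝ)..t, z s)
    (f' := z) (δ := 0) (K := C) (ε := A) (a := 0) (b := T)
    (fun t _ => (hD t).continuousAt.continuousWithinAt)
    (fun t _ r hr => (hD t).hasDerivWithinAt.liminf_right_slope_le hr) (by simp)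
    (fun t ht => hzz t (Ico_subset_Icc_self ht))
  intro t ht
  rw [← hYeq t ht]
  have h1 := hzz t ht
  have h2 := hgr t ht
  rw [gronwallBound_of_K_ne_0 hC.ne'] at h2
  simp only [zero_mul, zero_add, sub_zero] at h2
  have h3 : C * (∫ s in (0 : ℝ)..t, z s) ≤ A * (Real.exp (C * t) - 1) := by
    calc C * (∫ s in (0 : ℝ)..t, z s) ≤ C * (A / C * (Real.exp (C * t) - 1)) := by gcongr
      _ = _ := by field_simp
  have h4 : Real.exp (C * t) ≤ Real.exp (C * T) := by
    gcongr
    exact ht.2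
  have h5 : z t ≤ A * Real.exp (C * t) := by linarith
  exact h5.trans (by gcongr)

/-! ### Weak measurability and multiplication by a bounded force -/

/-- Distinct members are `√2` apart, so balls of radius `1/2` around them are disjoint, and a second
countable space contains only countably many disjoint nonempty open sets. -/
theorem countable_of_orthonormal {ι K : Type*} [NormedAddCommGroup K] [InnerProductSpace ℝ K]
    [SecondCountableTopology K] {b : ι → K} (hb : Orthonormal ℝ b) : Countable ι := by
  have hd : (univ : Set ι).PairwiseDisjoint fun i => Metric.ball (b i) (1 / 2) := by
    intro i _ j _ hij
    refine Metric.ball_disjoint_ball ?_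
    have h1 : ‖b i - b j‖ ^ 2 = 2 := by
      rw [norm_sub_sq_real, hb.1 i, hb.1 j, hb.2 hij]
      norm_num
    rw [dist_eq_norm]
    nlinarith [norm_nonneg (b i - b j)]
  have := hd.countable_of_isOpen (fun i _ => Metric.isOpen_ball)
    fun i _ => ⟨b i, Metric.mem_ball_self (by norm_num)⟩
  exact countable_univ_iff.1 this

/-- Pettis' theorem for Hilbert spaces: weakly measurable functions with values in a separable
Hilbert space are strongly measurable. -/
theorem aestronglyMeasurable_of_inner {α K : Type*} [MeasurableSpace α] {m : Measure α}
    [NormedAddCommGroup K] [InnerProductSpace ℝ K] [CompleteSpace K] [SecondCountableTopology K]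
    {F : α → K} (hF : ∀ v : K, AEStronglyMeasurable (fun t => ⟪v, F t⟫) m) :
    AEStronglyMeasurable F m := by
  obtain ⟨w, b, -⟩ := exists_hilbertBasis ℝ K
  have : Countable w := countable_of_orthonormal b.orthonormal
  refine aestronglyMeasurable_of_tendsto_ae (atTop : Filter (Finset w))
    (f := fun s t => ∑ i ∈ s, ⟪b i, F t⟫ • b i) (fun s => ?_)
    (Eventually.of_forall fun t => ?_)
  · exact Finset.aestronglyMeasurable_fun_sum s fun i _ => (hF (b i)).smul_const (b i)
  · simpa only [HasSum, b.repr_apply_apply, SummationFilter.unconditional_filter] using b.hasSum_repr (F t)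

instance secondCountableTopology_L2 {d : ℕ} (D : Set (Vec d)) (F : Type) [NormedAddCommGroup F]
    [TopologicalSpace.SeparableSpace F] : SecondCountableTopology (L2 D F) := by
  have : Fact ((2 : ℝ≥0∞) ≠ ⊤) := ⟨by simp⟩
  infer_instance

theorem memLp_inner_bounded {d : ℕ} (D : Set (Vec d)) {φ : Vec d → Vec d} {M : ℝ}
    (hφ : StronglyMeasurable φ) (hM : ∀ x, ‖φ x‖ ≤ M) (v : L2 D (Vec d)) :
    MemLp (fun x => ⟪φ x, v x⟫) 2 (volume.restrict D) := by
  refine (Lp.memLp v).of_le_mul (c := M)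
    (hφ.aestronglyMeasurable.inner (Lp.aestronglyMeasurable v)) (Eventually.of_forall fun x => ?_)
  exact (abs_real_inner_le_norm _ _).trans (by gcongr; exact hM x)

theorem norm_toLp_inner_le {d : ℕ} (D : Set (Vec d)) {φ : Vec d → Vec d} {M : ℝ}
    (hφ : StronglyMeasurable φ) (hM : ∀ x, ‖φ x‖ ≤ M) (v : L2 D (Vec d)) :
    ‖(memLp_inner_bounded D hφ hM v).toLp‖ ≤ M * ‖v‖ := by
  refine Lp.norm_le_mul_norm_of_ae_le_mul ?_
  filter_upwards [(memLp_inner_bounded D hφ hM v).coeFn_toLp] with x hx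
  rw [hx]
  exact (abs_real_inner_le_norm _ _).trans (by gcongr; exact hM x)

/-- For a bounded field `φ`, the operator `v ↦ φ · v` from `L²(D)^d` to `L²(D)`. -/
def innerMul {d : ℕ} (D : Set (Vec d)) {φ : Vec d → Vec d} {M : ℝ}
    (hφ : StronglyMeasurable φ) (hM : ∀ x, ‖φ x‖ ≤ M) : L2 D (Vec d) →L[ℝ] L2 D ℝ :=
  LinearMap.mkContinuous
    { toFun := fun v => (memLp_inner_bounded D hφ hM v).toLp
      map_add' := fun v w => by
        rw [← MemLp.toLp_add]
        refine MemLp.toLp_congr _ _ ?_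
        filter_upwards [Lp.coeFn_add v w] with x hx
        rw [hx, Pi.add_apply, inner_add_right, Pi.add_apply]
      map_smul' := fun c v => by
        rw [RingHom.id_apply, ← MemLp.toLp_const_smul]
        refine MemLp.toLp_congr _ _ ?_
        filter_upwards [Lp.coeFn_smul c v] with x hx
        rw [hx, Pi.smul_apply, inner_smul_right, Pi.smul_apply, smul_eq_mul] }
    M (norm_toLp_inner_le D hφ hM)

theorem norm_innerMul_apply_le {d : ℕ} (D : Set (Vec d)) {φ : Vec d → Vec d} {M : ℝ}
    (hφ : StronglyMeasurable φ) (hM : ∀ x, ‖φ x‖ ≤ M) (v : L2 D (Vec d)) :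
    ‖innerMul D hφ hM v‖ ≤ M * ‖v‖ :=
  norm_toLp_inner_le D hφ hM v

theorem inner_innerMul {d : ℕ} (D : Set (Vec d)) {φ : Vec d → Vec d} {M : ℝ}
    (hφ : StronglyMeasurable φ) (hM : ∀ x, ‖φ x‖ ≤ M) (r : L2 D ℝ) (v : L2 D (Vec d)) :
    ⟪r, innerMul D hφ hM v⟫ = ∫ x in D, r x * ⟪φ x, v x⟫ := by
  rw [L2.inner_def]
  refine integral_congr_ae ?_
  filter_upwards [(memLp_inner_bounded D hφ hM v).coeFn_toLp] with x hx
  have : (innerMul D hφ hM v) x = ⟪φ x, v x⟫ := hx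
  rw [this]
  simp [mul_comm]

/-- A bounded force has a bounded, everywhere strongly measurable representative. -/
theorem exists_bounded_representative {d : ℕ} (D : Set (Vec d)) {T : ℝ}
    {f : Vec d × ℝ → Vec d} (hf : MemLp f ∞ (volume.restrict (D ×ˢ Ioo 0 T))) :
    ∃ (F : Vec d × ℝ → Vec d) (M : ℝ), StronglyMeasurable F ∧ (∀ z, ‖F z‖ ≤ M) ∧ 0 ≤ M ∧
      ∀ᵐ t ∂(timeMeasure T), ∀ᵐ x ∂(volume.restrict D), f (x, t) = F (x, t) := by
  set f₁ := hf.1.mk f with hf₁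
  have hm : StronglyMeasurable f₁ := hf.1.stronglyMeasurable_mk
  set M : ℝ := (eLpNorm f ∞ (volume.restrict (D ×ˢ Ioo 0 T))).toReal with hM
  have hset : MeasurableSet {z | ‖f₁ z‖ ≤ M} := hm.norm.measurable measurableSet_Iic
  -- A strongly measurable version is set to zero where it exceeds the essential bound; the bound
  -- then holds at every point, so multiplication operators exist for every `t`.
  refine ⟨{z | ‖f₁ z‖ ≤ M}.indicator f₁, M, hm.indicator hset, fun z => ?_,
    ENNReal.toReal_nonneg, ?_⟩
  · by_cases h : z ∈ {z | ‖f₁ z‖ ≤ M}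
    · rw [indicator_of_mem h]; exact h
    · rw [indicator_of_notMem h, norm_zero]; exact ENNReal.toReal_nonneg
  · have h1 : ∀ᵐ z ∂(volume.restrict (D ×ˢ Ioo 0 T)),
        f z = {z | ‖f₁ z‖ ≤ M}.indicator f₁ z := by
      have h2 : ∀ᵐ z ∂(volume.restrict (D ×ˢ Ioo 0 T)), ‖f z‖ ≤ M := by
        filter_upwards [enorm_ae_le_eLpNormEssSup f (volume.restrict (D ×ˢ Ioo 0 T))] with z hz
        rw [hM, eLpNorm_exponent_top, ← toReal_enorm]
        refine ENNReal.toReal_mono ?_ hz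
        rw [← eLpNorm_exponent_top]
        exact hf.2.ne
      filter_upwards [h2, hf.1.ae_eq_mk] with z hz hz'
      rw [indicator_of_mem, hz']
      change ‖hf.1.mk f z‖ ≤ M
      rwa [← hz']
    rw [Measure.volume_eq_prod, ← Measure.prod_restrict] at h1
    have h3 := (Measure.measurePreserving_swap (μ := volume.restrict (Ioo 0 T))
      (ν := (volume : Measure (Vec d)).restrict D)).quasiMeasurePreserving.ae h1
    exact Measure.ae_ae_of_ae_prod h3

/-- Multiplication of a square integrable function of time by the adjoint of `innerMul`. -/
theorem memLp_adjoint_innerMul {d : ℕ} (D : Set (Vec d)) {T M : ℝ} {F : Vec d × ℝ → Vec d}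
    (hF : StronglyMeasurable F) (hM : ∀ z, ‖F z‖ ≤ M) (hM0 : 0 ≤ M)
    {r : ℝ → L2 D ℝ} (hr : MemLp r 2 (timeMeasure T)) :
    MemLp (fun t => (innerMul D (hF.comp_measurable measurable_prodMk_right)
      fun x => hM (x, t)).adjoint (r t)) 2 (timeMeasure T) := by
  set N : ℝ → L2 D (Vec d) →L[ℝ] L2 D ℝ := fun t =>
    innerMul D (hF.comp_measurable measurable_prodMk_right) fun x => hM (x, t) with hN
  -- Operator-valued measurability is avoided. Pettis is applied once to `N t v`, whose scalar
  -- products are parameter integrals, and once to the adjoint, through `⟪v, (N t)* r⟫ = ⟪N t v,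
  -- r⟫`.
  have h1 : ∀ v, AEStronglyMeasurable (fun t => N t v) (timeMeasure T) := by
    intro v
    refine aestronglyMeasurable_of_inner fun s => ?_
    have h2 : (fun t => ⟪s, N t v⟫) = fun t => ∫ x in D, s x * ⟪F (x, t), v x⟫ := by
      funext t
      exact inner_innerMul D _ _ s v
    rw [h2]
    refine (StronglyMeasurable.integral_prod_left
      (f := fun x t => s x * ⟪F (x, t), v x⟫) ?_).aestronglyMeasurable
    exact ((Lp.stronglyMeasurable s).comp_measurable measurable_fst).mul
      (hF.inner ((Lp.stronglyMeasurable v).comp_measurable measurable_fst))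
  have h3 : AEStronglyMeasurable (fun t => (N t).adjoint (r t)) (timeMeasure T) := by
    refine aestronglyMeasurable_of_inner fun v => ?_
    simp only [ContinuousLinearMap.adjoint_inner_right]
    exact (h1 v).inner hr.1
  refine hr.of_le_mul (c := M) h3 (Eventually.of_forall fun t => ?_)
  have h4 : ‖N t‖ ≤ M := ContinuousLinearMap.opNorm_le_bound _ hM0
    (norm_innerMul_apply_le D _ _)
  calc ‖(N t).adjoint (r t)‖ ≤ ‖(N t).adjoint‖ * ‖r t‖ := ContinuousLinearMap.le_opNorm _ _
    _ = ‖N t‖ * ‖r t‖ := by rw [LinearIsometryEquiv.norm_map]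
    _ ≤ M * ‖r t‖ := by gcongr

/-! ### Test fields and Sobolev fields -/

theorem continuous_gradField {d : ℕ} {D : Set (Vec d)} {v : Vec d → Vec d}
    (hv : v ∈ testFields D) : Continuous (gradField v) := by
  have h1 : Continuous (fderiv ℝ v) := ContDiff.continuous_fderiv hv.1 (by simp)
  refine (PiLp.continuous_toLp 2 _).comp (continuous_pi fun ij => ?_)
  have h2 : Continuous fun x => fderiv ℝ v x (EuclideanSpace.single ij.1 1) :=
    h1.clm_apply continuous_const
  exact (EuclideanSpace.proj (𝕜 := ℝ) ij.2).continuous.comp h2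

theorem hasCompactSupport_gradField {d : ℕ} {D : Set (Vec d)} {v : Vec d → Vec d}
    (hv : v ∈ testFields D) : HasCompactSupport (gradField v) := by
  refine (HasCompactSupport.fderiv ℝ hv.2.1).mono' ?_
  intro x hx
  refine subset_tsupport _ fun h => hx ?_
  ext ij
  simp [gradField, h]

theorem memLp_testField {d : ℕ} {D : Set (Vec d)} {v : Vec d → Vec d} (hv : v ∈ testFields D) :
    MemLp v 2 (volume.restrict D) :=
  (ContDiff.continuous hv.1).memLp_of_hasCompactSupport hv.2.1

theorem memLp_gradField {d : ℕ} {D : Set (Vec d)} {v : Vec d → Vec d} (hv : v ∈ testFields D) :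
    MemLp (gradField v) 2 (volume.restrict D) :=
  (continuous_gradField hv).memLp_of_hasCompactSupport (hasCompactSupport_gradField hv)

/-- A test field is a Sobolev field. -/
theorem exists_mem_graphOver {d : ℕ} {D : Set (Vec d)} {v : Vec d → Vec d}
    {S : Submodule ℝ (Vec d → Vec d)} (hS : S ≤ testFields D) (hv : v ∈ S) :
    ∃ w ∈ graphOver D S hS, (field D w =ᵐ[volume.restrict D] v) ∧
      (grad D w =ᵐ[volume.restrict D] gradField v) := by
  refine ⟨WithLp.toLp 2 ((memLp_testField (hS hv)).toLp, (memLp_gradField (hS hv)).toLp), ?_, ?_, ?_⟩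
  · exact ⟨v, hv, (memLp_testField (hS hv)).coeFn_toLp, (memLp_gradField (hS hv)).coeFn_toLp⟩
  · exact (memLp_testField (hS hv)).coeFn_toLp
  · exact (memLp_gradField (hS hv)).coeFn_toLp

theorem trace_gradField {d : ℕ} (v : Vec d → Vec d) (x : Vec d) :
    trace d (gradField v x) = divField v x := by
  simp [trace, gradField, divField]

theorem div_ae_eq {d : ℕ} {D : Set (Vec d)} {v : Vec d → Vec d} {w : Pairs D}
    (hw : grad D w =ᵐ[volume.restrict D] gradField v) :
    div D w =ᵐ[volume.restrict D] divField v := by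
  filter_upwards [ContinuousLinearMap.coeFn_compLpL (p := 2) (μ := volume.restrict D) (trace d)
    (grad D w), hw] with x h1 h2
  have h3 : div D w x = trace d (grad D w x) := h1
  rw [h3, h2, trace_gradField]

theorem V_le_H01 {d : ℕ} (D : Set (Vec d)) : V D ≤ H01 D := by
  refine Submodule.topologicalClosure_mono ?_
  rintro w ⟨v, hv, h⟩
  exact ⟨v, hv.1, h⟩

theorem div_eq_zero_of_mem_V {d : ℕ} {D : Set (Vec d)} {w : Pairs D} (hw : w ∈ V D) :
    div D w = 0 := by
  have hcl : IsClosed {w : Pairs D | div D w = 0} := isClosed_eq (div D).continuous continuous_const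
  refine closure_minimal ?_ hcl hw
  rintro w ⟨v, hv, -, h2⟩
  refine Lp.ext ?_
  filter_upwards [div_ae_eq h2, Lp.coeFn_zero ℝ 2 (volume.restrict D)] with x h3 h4
  rw [h3, h4, hv.2]

theorem mem_of_mem_J {d : ℕ} {D : Set (Vec d)} {P : L2 D (Vec d) → Prop}
    (hP : IsClosed {z | P z}) (h : ∀ v ∈ V D, P (field D v)) {z : L2 D (Vec d)} (hz : z ∈ J D) :
    P z := by
  refine closure_minimal ?_ hP hz
  rintro _ ⟨w, hw, rfl⟩
  exact h w (Submodule.le_topologicalClosure _ hw)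

/-- A closed relation that holds for all test fields holds in `H₀¹(D)^d`. -/
theorem H01_induction {d : ℕ} {D : Set (Vec d)} {P : Pairs D → Prop} (hP : IsClosed {w | P w})
    (h : ∀ v ∈ testFields D, ∀ w : Pairs D, field D w =ᵐ[volume.restrict D] v →
      grad D w =ᵐ[volume.restrict D] gradField v → P w) {w : Pairs D} (hw : w ∈ H01 D) : P w := by
  refine closure_minimal ?_ hP hw
  rintro w ⟨v, hv, h1, h2⟩
  exact h v hv w h1 h2

/-- The field has compact support in `D`, so the integral extends to the whole space, where
integration by parts against the constant `1` has no boundary term. -/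
theorem setIntegral_divField_eq_zero {d : ℕ} {D : Set (Vec d)} {v : Vec d → Vec d}
    (hv : v ∈ testFields D) : ∫ x in D, divField v x = 0 := by
  have hd : Differentiable ℝ v := differentiable_of_mem hv
  have hz : ∀ x ∉ D, divField v x = 0 := by
    intro x hx
    have : fderiv ℝ v x = 0 := by
      by_contra h
      exact hx (hv.2.2 (support_fderiv_subset ℝ h))
    simp [divField, this]
  rw [setIntegral_eq_integral_of_forall_compl_eq_zero hz]
  have hcf : Continuous (fderiv ℝ v) := ContDiff.continuous_fderiv hv.1 (by simp)
  have hcomp : ∀ i : Fin d, HasCompactSupport fun x => fderiv ℝ v x (EuclideanSpace.single i 1) i :=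
    fun i => (HasCompactSupport.fderiv ℝ hv.2.1).mono fun x hx h => hx (by simp [h])
  have hint : ∀ i : Fin d,
      Integrable fun x => fderiv ℝ v x (EuclideanSpace.single i 1) i := fun i =>
    ((EuclideanSpace.proj (𝕜 := ℝ) i).continuous.comp
      (hcf.clm_apply continuous_const)).integrable_of_hasCompactSupport (hcomp i)
  unfold divField
  rw [integral_finsetSum _ fun i _ => hint i]
  refine Finset.sum_eq_zero fun i _ => ?_
  have hvi : Integrable fun x => v x i :=
    ((EuclideanSpace.proj (𝕜 := ℝ) i).continuous.comp
      hd.continuous).integrable_of_hasCompactSupport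
      (hv.2.1.mono fun x hx h => hx (by simp [h]))
  have hD : ∀ x, HasFDerivAt (fun x => v x i)
      ((EuclideanSpace.proj (𝕜 := ℝ) i : Vec d →L[ℝ] ℝ).comp (fderiv ℝ v x)) x := fun x =>
    (EuclideanSpace.proj (𝕜 := ℝ) i : Vec d →L[ℝ] ℝ).hasFDerivAt.comp x (hd x).hasFDerivAt
  have := integral_bilinear_hasFDerivAt_right_eq_neg_left_of_integrable
    (B := ContinuousLinearMap.mul ℝ ℝ) (μ := (volume : Measure (Vec d)))
    (f := fun _ => (1 : ℝ)) (f' := 0) (g := fun x => v x i)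
    (g' := fun x => (EuclideanSpace.proj (𝕜 := ℝ) i : Vec d →L[ℝ] ℝ).comp (fderiv ℝ v x))
    (v := EuclideanSpace.single i 1) (by simp)
    (by simpa using hint i) (by simpa using hvi) (fun x _ => hasFDerivAt_const _ _)
    (fun x _ => hD x)
  simpa using this

/-! ### Functions with vanishing gradient -/

/-- Fields of the form `φ eᵢ` have divergence `∂ᵢφ`. They turn orthogonality to divergences into the
vanishing of each weak partial derivative. -/
theorem smul_single_mem_testFields {d : ℕ} {D : Set (Vec d)} {φ : Vec d → ℝ} (hφ : IsTest D φ)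
    (i : Fin d) : (fun x => φ x • (EuclideanSpace.single i 1 : Vec d)) ∈ testFields D := by
  refine ⟨hφ.1.smul contDiff_const, hφ.2.1.smul_right, ?_⟩
  exact (tsupport_smul_subset_left φ _).trans hφ.2.2

theorem divField_smul_single {d : ℕ} {φ : Vec d → ℝ} (hφ : Differentiable ℝ φ) (i : Fin d)
    (x : Vec d) : divField (fun x => φ x • (EuclideanSpace.single i 1 : Vec d)) x
      = fderiv ℝ φ x (EuclideanSpace.single i 1) := by
  have h : fderiv ℝ (fun x => φ x • (EuclideanSpace.single i 1 : Vec d)) x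
      = (fderiv ℝ φ x).smulRight (EuclideanSpace.single i 1) :=
    ((hφ x).hasFDerivAt.smul_const _).fderiv
  simp only [divField, h, ContinuousLinearMap.smulRight_apply, PiLp.smul_apply, smul_eq_mul]
  rw [Finset.sum_eq_single i] <;> simp +contextual

/-- The mollification of a function with vanishing weak gradient is constant on balls. -/
theorem convolution_const_on_ball {d : ℕ} {D : Set (Vec d)} (hD : MeasurableSet D) {r : Vec d → ℝ}
    (hr : IntegrableOn r D) (h0 : ∀ v ∈ testFields D, ∫ x in D, r x * divField v x = 0)
    (b : ContDiffBump (0 : Vec d)) {x₀ : Vec d} {ρ : ℝ}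
    (hsub : Metric.ball x₀ (ρ + b.rOut) ⊆ D) {x y : Vec d}
    (hx : x ∈ Metric.ball x₀ ρ) (hy : y ∈ Metric.ball x₀ ρ) :
    convolution (b.normed volume) (D.indicator r) (ContinuousLinearMap.lsmul ℝ ℝ) volume x
      = convolution (b.normed volume) (D.indicator r) (ContinuousLinearMap.lsmul ℝ ℝ) volume y := by
  set ψ := b.normed (volume : Measure (Vec d)) with hψ
  have hψs : ContDiff ℝ ∞ ψ := b.contDiff_normed
  have hψc : HasCompactSupport ψ := b.hasCompactSupport_normed
  have hR : LocallyIntegrable (D.indicator r) :=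
    ((integrable_indicator_iff hD).2 hr).locallyIntegrable
  have hder := HasCompactSupport.hasFDerivAt_convolution_left (μ := volume)
    (ContinuousLinearMap.lsmul ℝ ℝ : ℝ →L[ℝ] ℝ →L[ℝ] ℝ) hψc (hψs.of_le (by simp)) hR
  refine Metric.isOpen_ball.is_const_of_fderiv_eq_zero (𝕜 := ℝ)
    (convex_ball x₀ ρ).isPreconnected
    (fun z _ => (hder z).differentiableAt.differentiableWithinAt) (fun z hz => ?_) hx hy
  rw [(hder z).fderiv, Pi.zero_apply]
  refine ContinuousLinearMap.coe_injective
    ((EuclideanSpace.basisFun (Fin d) ℝ).toBasis.ext fun i => ?_)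
  simp only [OrthonormalBasis.coe_toBasis, EuclideanSpace.basisFun_apply,
    ContinuousLinearMap.coe_coe, zero_apply]
  have hex := (HasCompactSupport.fderiv ℝ hψc).convolutionExists_left
    (ContinuousLinearMap.precompL (Vec d) (ContinuousLinearMap.lsmul ℝ ℝ : ℝ →L[ℝ] ℝ →L[ℝ] ℝ))
    (hψs.continuous_fderiv (by simp)) hR z
  -- The margin `b.rOut` around the ball keeps the reflected, translated mollifier supported in `D`,
  -- so it is admissible in `h0`; its derivative is minus the one in the convolution formula.
  have hz' : IsTest D fun y => ψ (z - y) := by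
    refine ⟨hψs.comp (contDiff_const.sub contDiff_id), ?_, ?_⟩
    · exact hψc.comp_homeomorph (Homeomorph.subLeft z)
    · intro y hy
      have h1 : z - y ∈ tsupport ψ :=
        tsupport_comp_subset_preimage ψ (f := fun y => z - y) (by fun_prop) hy
      rw [hψ, b.tsupport_normed_eq, mem_closedBall_zero_iff] at h1
      apply hsub
      rw [Metric.mem_ball] at hz ⊢
      calc dist y x₀ ≤ dist y z + dist z x₀ := dist_triangle _ _ _
        _ < ρ + b.rOut := by rw [dist_comm y z, dist_eq_norm z y]; linarith
  have hfd : ∀ y, fderiv ℝ (fun y => ψ (z - y)) y (EuclideanSpace.single i 1)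
      = - fderiv ℝ ψ (z - y) (EuclideanSpace.single i 1) := by
    intro y
    have h1 : HasFDerivAt (fun y => z - y) (-(ContinuousLinearMap.id ℝ (Vec d))) y :=
      (hasFDerivAt_id y).const_sub z
    have h2 := ((hψs.differentiable (by simp)) (z - y)).hasFDerivAt.comp y h1
    have h3 : fderiv ℝ (fun y => ψ (z - y)) y
        = (fderiv ℝ ψ (z - y)).comp (-(ContinuousLinearMap.id ℝ (Vec d))) := h2.fderiv
    rw [h3]
    simp
  have h1 := h0 _ (smul_single_mem_testFields hz' i)
  simp only [divField_smul_single (hz'.1.differentiable (by simp)), hfd, mul_neg] at h1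
  rw [integral_neg, neg_eq_zero] at h1
  rw [convolution_eq_swap, ContinuousLinearMap.integral_apply]
  · rw [← h1, ← integral_indicator hD]
    refine integral_congr_ae (Eventually.of_forall fun y => ?_)
    by_cases hyD : y ∈ D <;>
      simp [ContinuousLinearMap.precompL_apply, hyD, mul_comm]
  · have := hex.integrable_swap
    exact this

/-- An integrable function on a domain whose weak gradient vanishes is constant. -/
theorem ae_eq_const_of_weak_gradient_zero {d : ℕ} {D : Set (Vec d)} (hDo : IsOpen D)
    (hDc : IsConnected D) {r : Vec d → ℝ} (hr : IntegrableOn r D)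
    (h0 : ∀ v ∈ testFields D, ∫ x in D, r x * divField v x = 0) :
    ∃ c : ℝ, ∀ᵐ x ∂(volume.restrict D), r x = c := by
  have hDm := hDo.measurableSet
  have hR : LocallyIntegrable (D.indicator r) :=
    ((integrable_indicator_iff hDm).2 hr).locallyIntegrable
  -- The outer radius tends to zero and is exactly twice the inner one; a bounded ratio is what
  -- almost everywhere convergence of the mollifications requires.
  let b : ℕ → ContDiffBump (0 : Vec d) := fun n =>
    ⟨1 / (2 * ((n : ℝ) + 1)), 1 / ((n : ℝ) + 1), by positivity,
      one_div_lt_one_div_of_lt (by positivity) (by linarith [(n.cast_nonneg : (0 : ℝ) ≤ n)])⟩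
  have hb0 : Tendsto (fun n => (b n).rOut) atTop (𝓝 0) := tendsto_one_div_add_atTop_nhds_zero_nat
  have hconv := ContDiffBump.ae_convolution_tendsto_right_of_locallyIntegrable
    (K := 2) hb0 (Eventually.of_forall fun n => by
      change 1 / ((n : ℝ) + 1) ≤ 2 * (1 / (2 * ((n : ℝ) + 1)))
      apply le_of_eq
      field_simp) hR
  -- On half of a ball contained in `D` all sufficiently fine mollifications are constant. Their
  -- limits at any two convergence points therefore agree, and `c` is the value of `r` at one such
  -- point.
  have hloc : ∀ x : D, ∃ c ρ : ℝ, 0 < ρ ∧ Metric.ball (x : Vec d) ρ ⊆ D ∧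
      ∀ᵐ y, y ∈ Metric.ball (x : Vec d) ρ → r y = c := by
    intro x
    obtain ⟨ε, hε, hball⟩ := Metric.isOpen_iff.1 hDo x x.2
    have hsub : Metric.ball (x : Vec d) (ε / 2) ⊆ D :=
      (Metric.ball_subset_ball (by linarith)).trans hball
    have hne : ∃ z ∈ Metric.ball (x : Vec d) (ε / 2), Tendsto (fun n =>
        convolution ((b n).normed volume) (D.indicator r) (ContinuousLinearMap.lsmul ℝ ℝ)
          volume z) atTop (𝓝 (D.indicator r z)) := by
      have h1 : ∃ᵐ z, z ∈ Metric.ball (x : Vec d) (ε / 2) := by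
        rw [frequently_ae_mem_iff]
        exact (Metric.measure_ball_pos volume _ (half_pos hε)).ne'
      obtain ⟨z, hz⟩ := (h1.and_eventually hconv).exists
      exact ⟨z, hz⟩
    obtain ⟨z, hz, hzlim⟩ := hne
    refine ⟨r z, ε / 2, half_pos hε, hsub, ?_⟩
    filter_upwards [hconv] with y hy hyb
    rw [indicator_of_mem (hsub hz)] at hzlim
    rw [indicator_of_mem (hsub hyb)] at hy
    refine tendsto_nhds_unique hy (hzlim.congr' ?_)
    filter_upwards [hb0.eventually (gt_mem_nhds (half_pos hε))] with n hn
    refine convolution_const_on_ball hDm hr h0 (b n) (x₀ := x) (ρ := ε / 2)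
      ((Metric.ball_subset_ball ?_).trans hball) hz hyb
    linarith
  choose c ρ hρ hρD hcρ using hloc
  -- Overlapping balls meet in an open set of positive measure, where both almost everywhere values
  -- are attained at a common point.
  have hlc : IsLocallyConstant c := by
    rw [IsLocallyConstant.iff_exists_open]
    intro x
    refine ⟨Subtype.val ⁻¹' Metric.ball (x : Vec d) (ρ x),
      Metric.isOpen_ball.preimage continuous_subtype_val, Metric.mem_ball_self (hρ x), ?_⟩
    intro y hy
    have hopen : IsOpen (Metric.ball (x : Vec d) (ρ x) ∩ Metric.ball (y : Vec d) (ρ y)) :=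
      Metric.isOpen_ball.inter Metric.isOpen_ball
    have h1 : ∃ᵐ z, z ∈ Metric.ball (x : Vec d) (ρ x) ∩ Metric.ball (y : Vec d) (ρ y) := by
      rw [frequently_ae_mem_iff]
      exact (hopen.measure_pos volume ⟨y, hy, Metric.mem_ball_self (hρ y)⟩).ne'
    obtain ⟨z, hz, hz1, hz2⟩ := (h1.and_eventually ((hcρ x).and (hcρ y))).exists
    rw [← hz2 hz.2, hz1 hz.1]
  obtain ⟨x₀, hx₀⟩ := hDc.nonempty
  have : PreconnectedSpace D := Subtype.preconnectedSpace hDc.isPreconnected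
  have hconst : ∀ x : D, c x = c ⟨x₀, hx₀⟩ := fun x =>
    hlc.apply_eq_of_isPreconnected isPreconnected_univ (mem_univ _) (mem_univ _)
  refine ⟨c ⟨x₀, hx₀⟩, ?_⟩
  rw [ae_restrict_iff' hDm]
  -- Passing from uncountably many local statements to a global one uses that a locally null set in
  -- a second countable space is null.
  have hnull : volume {x | ¬(x ∈ D → r x = c ⟨x₀, hx₀⟩)} = 0 := by
    refine measure_null_of_locally_null _ fun x hx => ?_
    have hxD : x ∈ D := by
      by_contra h
      exact hx fun h' => absurd h' h
    refine ⟨{y | ¬(y ∈ Metric.ball x (ρ ⟨x, hxD⟩) → r y = c ⟨x, hxD⟩)}, ?_, hcρ ⟨x, hxD⟩⟩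
    filter_upwards [mem_nhdsWithin_of_mem_nhds (Metric.ball_mem_nhds x (hρ ⟨x, hxD⟩)),
      self_mem_nhdsWithin] with y hy1 hy2 h
    exact hy2 fun _ => (h hy1).trans (hconst _)
  exact hnull

/-- The constant function `1` in `L²(D)`. -/
def oneL2 {d : ℕ} (D : Set (Vec d)) [IsFiniteMeasure (volume.restrict D)] : L2 D ℝ :=
  Lp.const 2 (volume.restrict D) 1

theorem inner_oneL2 {d : ℕ} (D : Set (Vec d)) [IsFiniteMeasure (volume.restrict D)]
    (r : L2 D ℝ) : ⟪r, oneL2 D⟫ = ∫ x in D, r x := by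
  rw [L2.inner_def]
  refine integral_congr_ae ?_
  filter_upwards [Lp.coeFn_const 2 (volume.restrict D) (1 : ℝ)] with x hx
  rw [oneL2, hx]
  simp

/-- True for test fields by integration by parts, and preserved in the `H¹` closure because `div` is
continuous into `L²(D)`. -/
theorem inner_div_oneL2 {d : ℕ} (D : Set (Vec d)) [IsFiniteMeasure (volume.restrict D)]
    {w : Pairs D} (hw : w ∈ H01 D) : ⟪div D w, oneL2 D⟫ = 0 := by
  refine H01_induction (P := fun w => ⟪div D w, oneL2 D⟫ = 0)
    (isClosed_eq ((div D).continuous.inner continuous_const) continuous_const) ?_ hw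
  intro v hv w _ h2
  rw [inner_oneL2, ← setIntegral_divField_eq_zero hv]
  exact integral_congr_ae (div_ae_eq h2)

/-- Divergences of Sobolev fields and constants span a dense subspace of `L²(D)`. -/
theorem dense_range_div_sup_const {d : ℕ} {D : Set (Vec d)} (hDo : IsOpen D) (hDc : IsConnected D)
    [IsFiniteMeasure (volume.restrict D)] :
    ((H01 D).map (div D : Pairs D →ₗ[ℝ] L2 D ℝ) ⊔ Submodule.span ℝ {oneL2 D}).topologicalClosure
      = ⊤ := by
  rw [Submodule.topologicalClosure_eq_top_iff, Submodule.eq_bot_iff]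
  intro r hr
  rw [Submodule.mem_orthogonal] at hr
  -- An element of the orthogonal complement has vanishing weak gradient, hence is a constant;
  -- orthogonality to `1` then makes it zero.
  have hdiv : ∀ v ∈ testFields D, ∫ x in D, r x * divField v x = 0 := by
    intro v hv
    obtain ⟨w, hw, -, h2⟩ := exists_mem_graphOver le_rfl hv
    have h3 := hr (div D w) (Submodule.mem_sup_left
      (Submodule.mem_map_of_mem (Submodule.le_topologicalClosure _ hw)))
    rw [← h3, L2.inner_def]
    refine integral_congr_ae ?_
    filter_upwards [div_ae_eq h2] with x hx
    simp [hx]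
  have hri : IntegrableOn r D := (Lp.memLp r).integrable one_le_two
  obtain ⟨c, hc⟩ := ae_eq_const_of_weak_gradient_zero hDo hDc hri hdiv
  have h1 : r = c • oneL2 D := by
    refine Lp.ext ?_
    filter_upwards [hc, Lp.coeFn_smul c (oneL2 D),
      Lp.coeFn_const 2 (volume.restrict D) (1 : ℝ)] with x hx1 hx2 hx3
    rw [hx1, hx2, Pi.smul_apply, oneL2, hx3]
    simp
  have h2 : ⟪oneL2 D, r⟫ = 0 :=
    hr _ (Submodule.mem_sup_right (Submodule.mem_span_singleton_self _))
  rw [← inner_self_eq_zero (𝕜 := ℝ)]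
  nth_rewrite 1 [h1]
  rw [real_inner_smul_left, h2, mul_zero]

/-! ### Evolution equations in Hilbert spaces -/

/-- A uniform Lipschitz bound lets the limit zero pass to limits of the argument. This is the step
from a dense set to the whole space in the density arguments below. -/
theorem isClosed_setOf_tendsto_zero {ι E : Type*} [SeminormedAddCommGroup E] {l : Filter ι}
    {Λ : ι → E → ℝ} {B : ℝ} (hΛ : ∀ᶠ i in l, ∀ y z, |Λ i y - Λ i z| ≤ B * ‖y - z‖) :
    IsClosed {y | Tendsto (fun i => Λ i y) l (𝓝 0)} := by
  refine isClosed_of_closure_subset fun y hy => ?_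
  change Tendsto (fun i => Λ i y) l (𝓝 0)
  rw [Metric.tendsto_nhds]
  intro ε hε
  have hB : 0 < |B| + 1 := by positivity
  obtain ⟨z, hz, hyz⟩ := SeminormedAddCommGroup.mem_closure_iff.1 hy (ε / (2 * (|B| + 1)))
    (by positivity)
  have hz' : Tendsto (fun i => Λ i z) l (𝓝 0) := hz
  filter_upwards [hΛ, (Metric.tendsto_nhds.1 hz') (ε / 2) (half_pos hε)] with i h1 h2
  rw [Real.dist_eq, sub_zero] at h2 ⊢
  have h3 : |Λ i y - Λ i z| ≤ ε / 2 := by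
    refine (h1 y z).trans ?_
    calc B * ‖y - z‖ ≤ (|B| + 1) * (ε / (2 * (|B| + 1))) := by
          gcongr
          linarith [le_abs_self B]
      _ = ε / 2 := by field_simp
  calc |Λ i y| = |(Λ i y - Λ i z) + Λ i z| := by rw [sub_add_cancel]
    _ ≤ |Λ i y - Λ i z| + |Λ i z| := abs_add_le _ _
    _ < ε := by linarith

theorem timeMeasure_ae_neBot {T : ℝ} (hT : 0 < T) : (ae (timeMeasure T)).NeBot := by
  rw [ae_neBot, Ne, Measure.restrict_eq_zero, Real.volume_Ioo]
  simpa using hT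

/-- A property that holds almost everywhere on `(0,T)` holds along a sequence tending to `0`. -/
theorem exists_seq_tendsto_zero_of_ae {T : ℝ} (hT : 0 < T) {P : ℝ → Prop}
    (hP : ∀ᵐ t ∂(timeMeasure T), P t) :
    ∃ t : ℕ → ℝ, (∀ n, t n ∈ Ioo 0 T ∧ P (t n)) ∧ Tendsto t atTop (𝓝 0) := by
  have h1 : ∀ n : ℕ, ∃ t ∈ Ioo 0 (T / (n + 1)), P t := by
    intro n
    have hn : 0 < T / (n + 1) := by positivity
    have hle : T / (n + 1) ≤ T := div_le_self hT.le (by linarith [(n.cast_nonneg : (0 : ℝ) ≤ n)])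
    have := timeMeasure_ae_neBot hn
    obtain ⟨t, ht⟩ := ((ae_restrict_of_ae_restrict_of_subset (Ioo_subset_Ioo_right hle) hP).and
      (ae_restrict_mem measurableSet_Ioo)).exists
    exact ⟨t, ht.2, ht.1⟩
  choose t ht hPt using h1
  refine ⟨t, fun n => ⟨⟨(ht n).1, (ht n).2.trans_le (div_le_self hT.le
    (by linarith [(n.cast_nonneg : (0 : ℝ) ≤ n)]))⟩, hPt n⟩, ?_⟩
  have h2 : Tendsto (fun n : ℕ => T / ((n : ℝ) + 1)) atTop (𝓝 0) := by
    simpa [div_eq_mul_inv] using tendsto_one_div_add_atTop_nhds_zero_nat.const_mul T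
  exact squeeze_zero (fun n => (ht n).1.le) (fun n => (ht n).2.le) h2

theorem tendsto_primitive_zero {E : Type*} [NormedAddCommGroup E] [NormedSpace ℝ E]
    {T : ℝ} (hT : 0 < T) {k : ℝ → E} (hk : IntegrableOn k (Ioo 0 T))
    {t : ℕ → ℝ} (ht : ∀ n, t n ∈ Ioo 0 T) (hlim : Tendsto t atTop (𝓝 0)) :
    Tendsto (fun n => ∫ s in (0 : ℝ)..(t n), k s) atTop (𝓝 0) := by
  have h1 := (continuousOn_primitive_Icc hT.le hk) 0 (left_mem_Icc.2 hT.le)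
  have h2 : Tendsto t atTop (𝓝[Icc 0 T] 0) :=
    tendsto_nhdsWithin_iff.2 ⟨hlim, Eventually.of_forall fun n => Ioo_subset_Icc_self (ht n)⟩
  have h3 := h1.tendsto.comp h2
  rwa [intervalIntegral.integral_same] at h3

/-- An evolution equation whose initial value is known on the subspace containing the solution
attains this initial value in the full space. -/
theorem initial_value_eq {H K : Type*} [NormedAddCommGroup H] [InnerProductSpace ℝ H]
    [CompleteSpace H] [NormedAddCommGroup K] [InnerProductSpace ℝ K] [CompleteSpace K]
    (e : H →L[ℝ] K) (S : Submodule ℝ H) {T : ℝ} (hT : 0 < T) {u k : ℝ → H} {a : K} {c : H}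
    (hu : MemLp u 2 (timeMeasure T)) (hk : MemLp k 2 (timeMeasure T))
    (huS : ∀ᵐ t ∂(timeMeasure T), u t ∈ S)
    (heq : ∀ᵐ t ∂(timeMeasure T), e.adjoint (e (u t)) = c + ∫ s in (0 : ℝ)..t, k s)
    (hc : ∀ v ∈ S, ⟪c, v⟫ = ⟪a, e v⟫) (ha : a ∈ closure (e '' S)) : c = e.adjoint a := by
  have hki : IntegrableOn k (Ioo 0 T) := hk.integrable one_le_two
  have hin : ∀ᵐ t ∂(timeMeasure T), ∀ v : H,
      ⟪e (u t), e v⟫ = ⟪c, v⟫ + ⟪∫ s in (0 : ℝ)..t, k s, v⟫ := by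
    filter_upwards [heq] with t ht v
    rw [← ContinuousLinearMap.adjoint_inner_left, ht, inner_add_left]
  -- Testing with `S` suffices here, so the unknown `c` may be replaced by `a` and the bound starts
  -- from `‖a‖²`.
  have hen := energy_inequality e S (a := a) hu hk huS (by
    filter_upwards [hin] with t ht v hv
    rw [ht, hc v hv])
  obtain ⟨t, ht, hlim⟩ := exists_seq_tendsto_zero_of_ae hT (hin.and hen)
  have hku : IntegrableOn (fun s => ⟪k s, u s⟫) (Ioo 0 T) := integrable_inner_of_memLp hk hu
  have hR := tendsto_primitive_zero hT hku (fun n => (ht n).1) hlim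
  have hG := tendsto_primitive_zero hT hki (fun n => (ht n).1) hlim
  have hweak : ∀ v : H, Tendsto (fun n => ⟪e (u (t n)), e v⟫) atTop (𝓝 ⟪c, v⟫) := by
    intro v
    have h1 : Tendsto (fun n => ⟪c, v⟫ + ⟪∫ s in (0 : ℝ)..(t n), k s, v⟫) atTop
        (𝓝 (⟪c, v⟫ + ⟪(0 : H), v⟫)) := tendsto_const_nhds.add (hG.inner tendsto_const_nhds)
    rw [inner_zero_left, add_zero] at h1
    exact h1.congr fun n => ((ht n).2.1 v).symm
  have hbd : ∀ᶠ n in atTop, ‖e (u (t n)) - a‖ ≤ (‖a‖ + 1) + ‖a‖ := by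
    filter_upwards [hR.eventually (gt_mem_nhds (show (0 : ℝ) < 1 / 2 by norm_num))] with n hn
    refine (norm_sub_le _ _).trans ?_
    gcongr
    have h1 := (ht n).2.2
    refine abs_le_of_sq_le_sq' ?_ (by positivity) |>.2
    nlinarith [norm_nonneg a]
  have hclosed := isClosed_setOf_tendsto_zero (l := atTop)
    (Λ := fun (n : ℕ) (y : K) => ⟪e (u (t n)) - a, y⟫) (B := (‖a‖ + 1) + ‖a‖) (by
      filter_upwards [hbd] with n hn y z
      rw [← inner_sub_right]
      exact (abs_real_inner_le_norm _ _).trans (by gcongr))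
  -- Weak convergence to `a` is known only against `e '' S`. Since the sequence is bounded and `a`
  -- is in the closure of this set, `a` itself may be used as test element.
  have hxa : Tendsto (fun n => ⟪e (u (t n)) - a, a⟫) atTop (𝓝 0) := by
    refine closure_minimal ?_ hclosed ha
    rintro _ ⟨v, hv, rfl⟩
    have h1 := (hweak v).sub_const ⟪a, e v⟫
    rw [hc v hv, sub_self] at h1
    exact h1.congr fun n => (inner_sub_left _ _ _).symm
  -- `‖x - a‖² = ‖x‖² - ‖a‖² - 2 ⟪x - a, a⟫`: the energy inequality controls the first difference
  -- from above, so weak convergence becomes strong. Strong convergence can be tested with every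
  -- `v`, not only those in `S`.
  have hstrong : Tendsto (fun n => e (u (t n)) - a) atTop (𝓝 0) := by
    have h1 : Tendsto (fun n => 2 * (∫ s in (0 : ℝ)..(t n), ⟪k s, u s⟫)
        - 2 * ⟪e (u (t n)) - a, a⟫) atTop (𝓝 (2 * 0 - 2 * 0)) :=
      (hR.const_mul 2).sub (hxa.const_mul 2)
    rw [mul_zero, sub_zero] at h1
    have h2 : Tendsto (fun n => ‖e (u (t n)) - a‖ ^ 2) atTop (𝓝 0) := by
      refine squeeze_zero (fun n => by positivity) (fun n => ?_) h1
      have h3 := (ht n).2.2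
      rw [norm_sub_sq_real, inner_sub_left, real_inner_self_eq_norm_sq]
      linarith
    rw [tendsto_zero_iff_norm_tendsto_zero]
    have h3 := (Real.continuous_sqrt.tendsto 0).comp h2
    rw [Real.sqrt_zero] at h3
    exact h3.congr fun n => Real.sqrt_sq (norm_nonneg _)
  refine ext_inner_right ℝ fun v => ?_
  rw [ContinuousLinearMap.adjoint_inner_left]
  have h1 : Tendsto (fun n => ⟪e (u (t n)) - a, e v⟫) atTop (𝓝 ⟪(0 : K), e v⟫) :=
    hstrong.inner tendsto_const_nhds
  have h2 := (hweak v).sub_const ⟪a, e v⟫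
  rw [inner_zero_left] at h1
  refine sub_eq_zero.1 (tendsto_nhds_unique h2 (h1.congr fun n => inner_sub_left _ _ _))

theorem integral_smul_inner {E : Type*} [NormedAddCommGroup E] [InnerProductSpace ℝ E]
    [CompleteSpace E] {T : ℝ} {h : ℝ → E} (hh : IntegrableOn h (Ioo 0 T)) {φ : ℝ → ℝ}
    (hφ : Continuous φ) (v : E) :
    ⟪∫ t in Ioo 0 T, φ t • h t, v⟫ = ∫ t in Ioo 0 T, ⟪h t, v⟫ * φ t := by
  rw [real_inner_comm, ← integral_inner (integrableOn_smul_of_continuous hφ hh)]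
  refine integral_congr_ae (Eventually.of_forall fun t => ?_)
  simp only
  rw [real_inner_smul_right, real_inner_comm, mul_comm]

/-- A weakly formulated evolution equation with initial value, in integrated form. -/
theorem ae_eq_initial_add_primitive_of_inner {E : Type*} [NormedAddCommGroup E]
    [InnerProductSpace ℝ E] [CompleteSpace E] {T : ℝ} (hT : 0 < T) {h k : ℝ → E} {a : E}
    (hh : IntegrableOn h (Ioo 0 T)) (hk : IntegrableOn k (Ioo 0 T))
    (hweak : ∀ φ : ℝ → ℝ, IsTest (Iio T) φ → ∀ v : E,
      - (∫ t in Ioo 0 T, ⟪h t, v⟫ * deriv φ t) - ⟪a, v⟫ * φ 0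
        = ∫ t in Ioo 0 T, ⟪k t, v⟫ * φ t) :
    ∀ᵐ t ∂(timeMeasure T), h t = a + ∫ s in (0 : ℝ)..t, k s := by
  refine ae_eq_initial_add_primitive hT hh hk fun φ hφ => ext_inner_right ℝ fun v => ?_
  rw [inner_sub_left, inner_neg_left, integral_smul_inner hh hφ.continuous_deriv,
    integral_smul_inner hk hφ.1.continuous, real_inner_smul_left, mul_comm, hweak φ hφ v]

/-- The right hand side of the momentum equation as a function with values in `H`; the operators
`e`, `γ`, `δ` stand for the embedding, the gradient and the divergence. -/
def evolutionRHS {H K P G : Type*}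
    [NormedAddCommGroup H] [InnerProductSpace ℝ H] [CompleteSpace H]
    [NormedAddCommGroup K] [InnerProductSpace ℝ K] [CompleteSpace K]
    [NormedAddCommGroup P] [InnerProductSpace ℝ P] [CompleteSpace P]
    [NormedAddCommGroup G] [InnerProductSpace ℝ G] [CompleteSpace G]
    (e : H →L[ℝ] K) (γ : H →L[ℝ] G) (δ : H →L[ℝ] P) (μ η : ℝ)
    (u : ℝ → H) (p : ℝ → P) (F : ℝ → K) (t : ℝ) : H :=
  δ.adjoint (p t) - μ • γ.adjoint (γ (u t)) - η • δ.adjoint (δ (u t)) + e.adjoint (F t)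

/-- The functional `v ↦ ρ (z, e v)`, as an element of `H`. -/
def massTerm {H K : Type*} [NormedAddCommGroup H] [InnerProductSpace ℝ H] [CompleteSpace H]
    [NormedAddCommGroup K] [InnerProductSpace ℝ K] [CompleteSpace K]
    (e : H →L[ℝ] K) (ρ : ℝ) (z : K) : H :=
  ρ • e.adjoint z

theorem inner_massTerm {H K : Type*}
    [NormedAddCommGroup H] [InnerProductSpace ℝ H] [CompleteSpace H]
    [NormedAddCommGroup K] [InnerProductSpace ℝ K] [CompleteSpace K]
    (e : H →L[ℝ] K) (ρ : ℝ) (z : K) (v : H) : ⟪massTerm e ρ z, v⟫ = ρ * ⟪z, e v⟫ := by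
  rw [massTerm, real_inner_smul_left, ContinuousLinearMap.adjoint_inner_left]

theorem massTerm_sub {H K : Type*}
    [NormedAddCommGroup H] [InnerProductSpace ℝ H] [CompleteSpace H]
    [NormedAddCommGroup K] [InnerProductSpace ℝ K] [CompleteSpace K]
    (e : H →L[ℝ] K) (ρ : ℝ) (y z : K) :
    massTerm e ρ (y - z) = massTerm e ρ y - massTerm e ρ z := by
  simp only [massTerm, map_sub, smul_sub]

theorem memLp_massTerm {H K : Type*}
    [NormedAddCommGroup H] [InnerProductSpace ℝ H] [CompleteSpace H]
    [NormedAddCommGroup K] [InnerProductSpace ℝ K] [CompleteSpace K]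
    (e : H →L[ℝ] K) (ρ : ℝ) {T : ℝ} {u : ℝ → H} (hu : MemLp u 2 (timeMeasure T)) :
    MemLp (fun t => massTerm e ρ (e (u t))) 2 (timeMeasure T) :=
  (e.adjoint.comp_memLp' (e.comp_memLp' hu)).const_smul ρ

theorem inner_evolutionRHS {H K P G : Type*}
    [NormedAddCommGroup H] [InnerProductSpace ℝ H] [CompleteSpace H]
    [NormedAddCommGroup K] [InnerProductSpace ℝ K] [CompleteSpace K]
    [NormedAddCommGroup P] [InnerProductSpace ℝ P] [CompleteSpace P]
    [NormedAddCommGroup G] [InnerProductSpace ℝ G] [CompleteSpace G]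
    (e : H →L[ℝ] K) (γ : H →L[ℝ] G) (δ : H →L[ℝ] P) (μ η : ℝ)
    (u : ℝ → H) (p : ℝ → P) (F : ℝ → K) (t : ℝ) (v : H) :
    ⟪evolutionRHS e γ δ μ η u p F t, v⟫ = ⟪p t, δ v⟫ - μ * ⟪γ (u t), γ v⟫
      - η * ⟪δ (u t), δ v⟫ + ⟪F t, e v⟫ := by
  simp only [evolutionRHS, inner_add_left, inner_sub_left, real_inner_smul_left,
    ContinuousLinearMap.adjoint_inner_left]

theorem memLp_evolutionRHS {H K P G : Type*}
    [NormedAddCommGroup H] [InnerProductSpace ℝ H] [CompleteSpace H]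
    [NormedAddCommGroup K] [InnerProductSpace ℝ K] [CompleteSpace K]
    [NormedAddCommGroup P] [InnerProductSpace ℝ P] [CompleteSpace P]
    [NormedAddCommGroup G] [InnerProductSpace ℝ G] [CompleteSpace G]
    (e : H →L[ℝ] K) (γ : H →L[ℝ] G) (δ : H →L[ℝ] P) (μ η : ℝ) {T : ℝ}
    {u : ℝ → H} {p : ℝ → P} {F : ℝ → K} (hu : MemLp u 2 (timeMeasure T))
    (hp : MemLp p 2 (timeMeasure T)) (hF : MemLp F 2 (timeMeasure T)) :
    MemLp (evolutionRHS e γ δ μ η u p F) 2 (timeMeasure T) :=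
  (((δ.adjoint.comp_memLp' hp).sub ((γ.adjoint.comp_memLp' (γ.comp_memLp' hu)).const_smul μ)).sub
    ((δ.adjoint.comp_memLp' (δ.comp_memLp' hu)).const_smul η)).add (e.adjoint.comp_memLp' hF)

theorem evolutionRHS_sub {H K P G : Type*}
    [NormedAddCommGroup H] [InnerProductSpace ℝ H] [CompleteSpace H]
    [NormedAddCommGroup K] [InnerProductSpace ℝ K] [CompleteSpace K]
    [NormedAddCommGroup P] [InnerProductSpace ℝ P] [CompleteSpace P]
    [NormedAddCommGroup G] [InnerProductSpace ℝ G] [CompleteSpace G]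
    (e : H →L[ℝ] K) (γ : H →L[ℝ] G) (δ : H →L[ℝ] P) (μ η : ℝ)
    (u u' : ℝ → H) (p p' : ℝ → P) (F F' : ℝ → K) (t : ℝ) :
    evolutionRHS e γ δ μ η (fun t => u t - u' t) (fun t => p t - p' t) (fun t => F t - F' t) t
      = evolutionRHS e γ δ μ η u p F t - evolutionRHS e γ δ μ η u' p' F' t := by
  simp only [evolutionRHS, map_sub, smul_sub]
  abel

theorem integrableOn_inner_mul {X : Type*} [NormedAddCommGroup X] [InnerProductSpace ℝ X]
    {T : ℝ} {x : ℝ → X} (hx : MemLp x 2 (timeMeasure T)) {φ : ℝ → ℝ} (hφ : Continuous φ) (v : X) :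
    IntegrableOn (fun t => ⟪x t, v⟫ * φ t) (Ioo 0 T) := by
  have h1 : IntegrableOn (fun t => ⟪x t, v⟫) (Ioo 0 T) :=
    (hx.integrable one_le_two).inner_const v
  refine (integrableOn_smul_of_continuous hφ h1).congr (Eventually.of_forall fun t => ?_)
  simp [mul_comm]

theorem integral_inner_evolutionRHS {H K P G : Type*}
    [NormedAddCommGroup H] [InnerProductSpace ℝ H] [CompleteSpace H]
    [NormedAddCommGroup K] [InnerProductSpace ℝ K] [CompleteSpace K]
    [NormedAddCommGroup P] [InnerProductSpace ℝ P] [CompleteSpace P]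
    [NormedAddCommGroup G] [InnerProductSpace ℝ G] [CompleteSpace G]
    (e : H →L[ℝ] K) (γ : H →L[ℝ] G) (δ : H →L[ℝ] P) (μ η : ℝ) {T : ℝ}
    {u : ℝ → H} {p : ℝ → P} {F : ℝ → K} (hu : MemLp u 2 (timeMeasure T))
    (hp : MemLp p 2 (timeMeasure T)) (hF : MemLp F 2 (timeMeasure T))
    {φ : ℝ → ℝ} (hφ : Continuous φ) (v : H) :
    ∫ t in Ioo 0 T, ⟪evolutionRHS e γ δ μ η u p F t, v⟫ * φ t
      = (∫ t in Ioo 0 T, ⟪p t, δ v⟫ * φ t) - μ * (∫ t in Ioo 0 T, ⟪γ (u t), γ v⟫ * φ t)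
        - η * (∫ t in Ioo 0 T, ⟪δ (u t), δ v⟫ * φ t) + ∫ t in Ioo 0 T, ⟪F t, e v⟫ * φ t := by
  have i1 := integrableOn_inner_mul hp hφ (δ v)
  have i2 : IntegrableOn (fun t => μ * (⟪γ (u t), γ v⟫ * φ t)) (Ioo 0 T) :=
    (integrableOn_inner_mul (x := fun t => γ (u t)) (γ.comp_memLp' hu) hφ (γ v)).const_mul μ
  have i3 : IntegrableOn (fun t => η * (⟪δ (u t), δ v⟫ * φ t)) (Ioo 0 T) :=
    (integrableOn_inner_mul (x := fun t => δ (u t)) (δ.comp_memLp' hu) hφ (δ v)).const_mul η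
  have i4 := integrableOn_inner_mul hF hφ (e v)
  have i12 : IntegrableOn (fun t => ⟪p t, δ v⟫ * φ t - μ * (⟪γ (u t), γ v⟫ * φ t)) (Ioo 0 T) :=
    Integrable.sub i1 i2
  have i123 : IntegrableOn (fun t => ⟪p t, δ v⟫ * φ t - μ * (⟪γ (u t), γ v⟫ * φ t)
      - η * (⟪δ (u t), δ v⟫ * φ t)) (Ioo 0 T) := Integrable.sub i12 i3
  rw [← integral_const_mul, ← integral_const_mul, ← integral_sub i1 i2, ← integral_sub i12 i3,
    ← integral_add i123 i4]
  refine integral_congr_ae (Eventually.of_forall fun t => ?_)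
  simp only [inner_evolutionRHS]
  ring

/-- The weakly formulated momentum equation in integrated form. -/
theorem evolution_eq_of_weak {H K P G : Type*}
    [NormedAddCommGroup H] [InnerProductSpace ℝ H] [CompleteSpace H]
    [NormedAddCommGroup K] [InnerProductSpace ℝ K] [CompleteSpace K]
    [NormedAddCommGroup P] [InnerProductSpace ℝ P] [CompleteSpace P]
    [NormedAddCommGroup G] [InnerProductSpace ℝ G] [CompleteSpace G]
    (e : H →L[ℝ] K) (γ : H →L[ℝ] G) (δ : H →L[ℝ] P) {T μ η ρ : ℝ} (hT : 0 < T)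
    {u : ℝ → H} {p : ℝ → P} {F : ℝ → K} {a : K} (hu : MemLp u 2 (timeMeasure T))
    (hp : MemLp p 2 (timeMeasure T)) (hF : MemLp F 2 (timeMeasure T))
    (hweak : ∀ φ : ℝ → ℝ, IsTest (Iio T) φ → ∀ v : H,
      - (∫ t in Ioo 0 T, ρ * ⟪e (u t), e v⟫ * deriv φ t) - ρ * ⟪a, e v⟫ * φ 0
        - ∫ t in Ioo 0 T, ⟪p t, δ v⟫ * φ t
      = - μ * (∫ t in Ioo 0 T, ⟪γ (u t), γ v⟫ * φ t)
        - η * (∫ t in Ioo 0 T, ⟪δ (u t), δ v⟫ * φ t) + ∫ t in Ioo 0 T, ⟪F t, e v⟫ * φ t) :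
    ∀ᵐ t ∂(timeMeasure T), massTerm e ρ (e (u t))
      = massTerm e ρ a + ∫ s in (0 : ℝ)..t, evolutionRHS e γ δ μ η u p F s := by
  refine ae_eq_initial_add_primitive_of_inner hT
    ((memLp_massTerm e ρ hu).integrable one_le_two)
    ((memLp_evolutionRHS e γ δ μ η hu hp hF).integrable one_le_two) fun φ hφ v => ?_
  rw [integral_inner_evolutionRHS e γ δ μ η hu hp hF hφ.1.continuous v]
  simp only [inner_massTerm]
  linarith [hweak φ hφ v]

/-- A momentum equation that holds in `D'(0,T)` for test elements spanning a dense subspace and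
that has the initial value `a` when tested with a subspace `S` containing the solution, in
integrated form. -/
theorem evolution_eq_of_weak_subspace {H K P G : Type*}
    [NormedAddCommGroup H] [InnerProductSpace ℝ H] [CompleteSpace H]
    [NormedAddCommGroup K] [InnerProductSpace ℝ K] [CompleteSpace K]
    [NormedAddCommGroup P] [InnerProductSpace ℝ P] [CompleteSpace P]
    [NormedAddCommGroup G] [InnerProductSpace ℝ G] [CompleteSpace G]
    (e : H →L[ℝ] K) (γ : H →L[ℝ] G) (δ : H →L[ℝ] P) (S : Submodule ℝ H) {T μ ρ : ℝ}
    (hT : 0 < T) (hρ : 0 < ρ)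
    {u : ℝ → H} {p : ℝ → P} {F : ℝ → K} {a : K} (hu : MemLp u 2 (timeMeasure T))
    (hp : MemLp p 2 (timeMeasure T)) (hF : MemLp F 2 (timeMeasure T))
    (huS : ∀ᵐ t ∂(timeMeasure T), u t ∈ S) (hδ : ∀ v ∈ S, δ v = 0) (ha : a ∈ closure (e '' S))
    {A : Set H} (hA : Dense A)
    (hweak : ∀ φ : ℝ → ℝ, IsTest (Ioo 0 T) φ → ∀ v ∈ A,
      - (∫ t in Ioo 0 T, ρ * ⟪e (u t), e v⟫ * deriv φ t) - ∫ t in Ioo 0 T, ⟪p t, δ v⟫ * φ t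
      = - μ * (∫ t in Ioo 0 T, ⟪γ (u t), γ v⟫ * φ t) + ∫ t in Ioo 0 T, ⟪F t, e v⟫ * φ t)
    (hweakS : ∀ φ : ℝ → ℝ, IsTest (Iio T) φ → ∀ v ∈ S,
      - (∫ t in Ioo 0 T, ρ * ⟪e (u t), e v⟫ * deriv φ t) - ρ * ⟪a, e v⟫ * φ 0
      = - μ * (∫ t in Ioo 0 T, ⟪γ (u t), γ v⟫ * φ t) + ∫ t in Ioo 0 T, ⟪F t, e v⟫ * φ t) :
    ∀ᵐ t ∂(timeMeasure T), massTerm e ρ (e (u t))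
      = massTerm e ρ a + ∫ s in (0 : ℝ)..t, evolutionRHS e γ δ μ 0 u p F s := by
  set k : ℝ → H := evolutionRHS e γ δ μ 0 u p F with hk
  have mk : MemLp k 2 (timeMeasure T) := memLp_evolutionRHS e γ δ μ 0 hu hp hF
  have ik : IntegrableOn k (Ioo 0 T) := mk.integrable one_le_two
  have ih : IntegrableOn (fun t => massTerm e ρ (e (u t))) (Ioo 0 T) :=
    (memLp_massTerm e ρ hu).integrable one_le_two
  -- Test functions vanishing near `t = 0` give no information on the initial value, so `c` is so
  -- far arbitrary in `H`.
  obtain ⟨c, hc⟩ := ae_eq_const_add_primitive hT ih ik fun φ hφ => by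
    rw [← add_eq_zero_iff_eq_neg]
    refine hA.eq_zero_of_inner_left ℝ fun v hv => ?_
    rw [inner_add_left, integral_smul_inner ih hφ.continuous_deriv,
      integral_smul_inner ik hφ.1.continuous,
      integral_inner_evolutionRHS e γ δ μ 0 hu hp hF hφ.1.continuous v]
    simp only [inner_massTerm]
    linarith [hweak φ hφ v hv]
  -- For fixed `v ∈ S` the scalar equation with initial value gives a second primitive
  -- representation, in which the pressure is absent because `δ v = 0`. Comparison at a single time
  -- determines `⟪c, v⟫`.
  have hcS : ∀ v ∈ S, ⟪c, v⟫ = ρ * ⟪a, e v⟫ := by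
    intro v hv
    have h1 := ae_eq_initial_add_primitive_of_inner (E := ℝ) hT
      (h := fun t => ⟪massTerm e ρ (e (u t)), v⟫) (k := fun t => ⟪k t, v⟫)
      (a := ρ * ⟪a, e v⟫) (ih.inner_const v) (ik.inner_const v) (fun φ hφ x => by
        have h2 := hweakS φ hφ v hv
        have h4 := integral_inner_evolutionRHS e γ δ μ 0 hu hp hF hφ.1.continuous v
        simp only [hδ v hv, inner_zero_right, zero_mul, integral_zero, sub_zero, zero_sub] at h4
        simp only [inner_massTerm, RCLike.inner_apply, conj_trivial]
        simp only [mul_assoc, integral_const_mul] at h2 h4 ⊢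
        linear_combination x * h2 - x * h4)
    have := timeMeasure_ae_neBot hT
    obtain ⟨t, ht1, ht2, ht3⟩ := (h1.and (hc.and (ae_restrict_mem measurableSet_Ioo))).exists
    rw [ht2, inner_add_left] at ht1
    have h7 : ⟪∫ s in (0 : ℝ)..t, k s, v⟫ = ∫ s in (0 : ℝ)..t, ⟪k s, v⟫ := by
      rw [intervalIntegral.integral_of_le ht3.1.le, intervalIntegral.integral_of_le ht3.1.le,
        real_inner_comm, ← integral_inner (ik.mono_set fun r hr => ⟨hr.1, hr.2.trans_lt ht3.2⟩)]
      exact integral_congr_ae (Eventually.of_forall fun s => real_inner_comm _ _)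
    rw [h7] at ht1
    exact add_right_cancel ht1
  have hc0 : ρ⁻¹ • c = e.adjoint a := by
    refine initial_value_eq e S hT (k := fun t => ρ⁻¹ • k t) hu (mk.const_smul _) huS ?_ ?_ ha
    · filter_upwards [hc] with t ht
      rw [intervalIntegral.integral_smul, ← smul_add, ← ht, massTerm, inv_smul_smul₀ hρ.ne']
    · intro v hv
      rw [real_inner_smul_left, hcS v hv, inv_mul_cancel_left₀ hρ.ne']
  have hc1 : c = massTerm e ρ a := by rw [massTerm, ← hc0, smul_inv_smul₀ hρ.ne']
  rwa [hc1] at hc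

/-! ### The energy estimate for the coupled system -/

/-- The pointwise estimate behind the energy estimate. -/
theorem coupled_integrand_le {x q s s' F α ρ M : ℝ} (hα : α ∈ Ioo (0 : ℝ) 1) (hρ : 0 < ρ)
    (hM : 0 ≤ M) (hx : 0 ≤ x) (hF : F ≤ M * (q + s)) :
    2 * (α * (F * x)) + 2 * (α / ρ * (s' * q)) ≤
      (M * ρ + 1 + 2 * M / ρ) * (ρ * x ^ 2 + α / ρ * q ^ 2)
        + (α * M * s ^ 2 + α / ρ * s' ^ 2) := by
  obtain ⟨h0, h1⟩ := hα
  have e1 : 2 * (α * (F * x)) ≤ 2 * (α * (M * (q + s) * x)) := by gcongr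
  -- Young's inequality, with `α < 1` used to replace `α x²` by `x²`; the factor `α` stays on `q²`
  -- and `s²`.
  have e2 : 2 * (α * (M * (q + s) * x)) ≤ M * (α * q ^ 2 + x ^ 2) + M * (α * s ^ 2 + x ^ 2) := by
    have a1 : 2 * (α * (q * x)) ≤ α * q ^ 2 + x ^ 2 := by
      nlinarith [mul_nonneg h0.le (sq_nonneg (q - x)), sq_nonneg x]
    have a2 : 2 * (α * (s * x)) ≤ α * s ^ 2 + x ^ 2 := by
      nlinarith [mul_nonneg h0.le (sq_nonneg (s - x)), sq_nonneg x]
    nlinarith [mul_le_mul_of_nonneg_left a1 hM, mul_le_mul_of_nonneg_left a2 hM]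
  have hαρ : 0 < α / ρ := by positivity
  have e3 : 2 * (α / ρ * (s' * q)) ≤ α / ρ * s' ^ 2 + α / ρ * q ^ 2 := by
    nlinarith [mul_nonneg hαρ.le (sq_nonneg (s' - q))]
  have e4 : (M * ρ + 1 + 2 * M / ρ) * (ρ * x ^ 2 + α / ρ * q ^ 2)
      = M * (α * q ^ 2) + α / ρ * q ^ 2 + 2 * M * x ^ 2
        + ((M * ρ + 1) * (ρ * x ^ 2) + 2 * M / ρ * (α / ρ * q ^ 2)) := by
    field_simp
    ring
  -- The three summands of the constant produce exactly `M α q²`, `(α/ρ) q²` and `2M x²`. The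
  -- remaining products are nonnegative and are dropped.
  have e5 : 0 ≤ (M * ρ + 1) * (ρ * x ^ 2) + 2 * M / ρ * (α / ρ * q ^ 2) := by positivity
  rw [e4]
  nlinarith

/-- The energy estimate for the difference `(w, q)` of the compressible and the incompressible
solutions; `s` is the incompressible pressure and `s'` its time derivative. -/
theorem coupled_energy_estimate {H K P G : Type*}
    [NormedAddCommGroup H] [InnerProductSpace ℝ H] [CompleteSpace H]
    [NormedAddCommGroup K] [InnerProductSpace ℝ K] [CompleteSpace K]
    [NormedAddCommGroup P] [InnerProductSpace ℝ P] [CompleteSpace P]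
    [NormedAddCommGroup G] [InnerProductSpace ℝ G] [CompleteSpace G]
    (e : H →L[ℝ] K) (γ : H →L[ℝ] G) (δ : H →L[ℝ] P) {T μ η ρ α M : ℝ}
    (hT : 0 < T) (hμ : 0 < μ) (hη : 0 ≤ η) (hρ : 0 < ρ) (hα : α ∈ Ioo (0 : ℝ) 1) (hM : 0 ≤ M)
    {w : ℝ → H} {q s s' : ℝ → P} {F : ℝ → K} {q₀ : P}
    (hw : MemLp w 2 (timeMeasure T)) (hq : MemLp q 2 (timeMeasure T))
    (hs : MemLp s 2 (timeMeasure T)) (hs' : MemLp s' 2 (timeMeasure T))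
    (hF : MemLp F 2 (timeMeasure T))
    (hFle : ∀ᵐ t ∂(timeMeasure T), ‖F t‖ ≤ M * (‖q t‖ + ‖s t‖))
    (heqw : ∀ᵐ t ∂(timeMeasure T), massTerm e ρ (e (w t)) =
      ∫ r in (0 : ℝ)..t, evolutionRHS e γ δ μ η w q (fun r => α • F r) r)
    (heqq : ∀ᵐ t ∂(timeMeasure T),
      q t = q₀ + ∫ r in (0 : ℝ)..t, (-(ρ / α) • δ (w r) - s' r)) :
    ∀ᵐ t ∂(timeMeasure T), ρ * ‖e (w t)‖ ^ 2 + α / ρ * ‖q t‖ ^ 2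
        + 2 * μ * ∫ r in (0 : ℝ)..t, ‖γ (w r)‖ ^ 2 ≤
      α * (‖q₀‖ ^ 2 / ρ + M * (∫ t in Ioo 0 T, ‖s t‖ ^ 2) + (∫ t in Ioo 0 T, ‖s' t‖ ^ 2) / ρ)
        * Real.exp ((M * ρ + 1 + 2 * M / ρ) * T) := by
  have hα0 := hα.1
  set C : ℝ := M * ρ + 1 + 2 * M / ρ with hC
  have hCpos : 0 < C := by positivity
  set g : ℝ → H := evolutionRHS e γ δ μ η w q (fun r => α • F r) with hg
  set k : ℝ → P := fun r => -(ρ / α) • δ (w r) - s' r with hk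
  have mδ : MemLp (fun r => δ (w r)) 2 (timeMeasure T) := δ.comp_memLp' hw
  have mγ : MemLp (fun r => γ (w r)) 2 (timeMeasure T) := γ.comp_memLp' hw
  have me : MemLp (fun r => e (w r)) 2 (timeMeasure T) := e.comp_memLp' hw
  have mg : MemLp g 2 (timeMeasure T) :=
    memLp_evolutionRHS e γ δ μ η hw hq (hF.const_smul α)
  have mk : MemLp k 2 (timeMeasure T) := (mδ.const_smul _).sub hs'
  have mgρ : MemLp (fun r => ρ⁻¹ • g r) 2 (timeMeasure T) := mg.const_smul ρ⁻¹
  -- The two energy inequalities are later weighted by `ρ` and `α / ρ`, the weights for which the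
  -- coupling terms cancel. The velocity difference starts from zero, the pressure difference from
  -- `q₀`.
  have en1 := energy_inequality e ⊤ (a := 0) hw mgρ (Eventually.of_forall fun _ => trivial) (by
    filter_upwards [heqw] with t ht v _
    rw [intervalIntegral.integral_smul, ← ht, massTerm, inv_smul_smul₀ hρ.ne',
      ContinuousLinearMap.adjoint_inner_left, inner_zero_left, zero_add])
  have en2 := energy_inequality (ContinuousLinearMap.id ℝ P) ⊤ (a := q₀) hq mk
    (Eventually.of_forall fun _ => trivial) (by
    filter_upwards [heqq] with t ht v _
    rw [ContinuousLinearMap.id_apply, ContinuousLinearMap.id_apply, ht, inner_add_left])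
  set X : ℝ → ℝ := fun t => ρ * ‖e (w t)‖ ^ 2 + α / ρ * ‖q t‖ ^ 2 with hX
  set Γ : ℝ → ℝ := fun t => ‖γ (w t)‖ ^ 2 with hΓ
  set b : ℝ → ℝ := fun t => α * M * ‖s t‖ ^ 2 + α / ρ * ‖s' t‖ ^ 2 with hb
  have iX : IntegrableOn X (Ioo 0 T) :=
    ((integrable_norm_sq_of_memLp me).const_mul ρ).add
      ((integrable_norm_sq_of_memLp hq).const_mul (α / ρ))
  have iΓ : IntegrableOn Γ (Ioo 0 T) := integrable_norm_sq_of_memLp mγ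
  have ib : IntegrableOn b (Ioo 0 T) :=
    ((integrable_norm_sq_of_memLp hs).const_mul (α * M)).add
      ((integrable_norm_sq_of_memLp hs').const_mul (α / ρ))
  have ig : IntegrableOn (fun t => ⟪ρ⁻¹ • g t, w t⟫) (Ioo 0 T) := integrable_inner_of_memLp mgρ hw
  have ik : IntegrableOn (fun t => ⟪k t, q t⟫) (Ioo 0 T) := integrable_inner_of_memLp mk hq
  -- The terms `⟪q, δ w⟫` have opposite signs and cancel. This removes the singular factor `ρ / α`;
  -- the `η` term has a good sign and is dropped.
  have hpt : ∀ᵐ t ∂(timeMeasure T), 2 * (ρ * ⟪ρ⁻¹ • g t, w t⟫) + 2 * (α / ρ * ⟪k t, q t⟫) ≤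
      C * X t + b t - 2 * μ * Γ t := by
    filter_upwards [hFle] with t ht
    have h1 : ρ * ⟪ρ⁻¹ • g t, w t⟫ = ⟪q t, δ (w t)⟫ - μ * ‖γ (w t)‖ ^ 2 - η * ‖δ (w t)‖ ^ 2
        + α * ⟪F t, e (w t)⟫ := by
      rw [real_inner_smul_left, mul_inv_cancel_left₀ hρ.ne']
      simp only [hg, inner_evolutionRHS, real_inner_smul_left, real_inner_self_eq_norm_sq]
    have h2 : α / ρ * ⟪k t, q t⟫ = - ⟪q t, δ (w t)⟫ - α / ρ * ⟪s' t, q t⟫ := by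
      simp only [hk, inner_sub_left, real_inner_smul_left]
      rw [real_inner_comm (q t) (δ (w t))]
      field_simp
    have h3 := coupled_integrand_le (s' := ‖s' t‖) hα hρ hM (norm_nonneg (e (w t))) ht
    have h4 : ⟪F t, e (w t)⟫ ≤ ‖F t‖ * ‖e (w t)‖ := real_inner_le_norm _ _
    have h5 : -⟪s' t, q t⟫ ≤ ‖s' t‖ * ‖q t‖ :=
      (neg_le_abs _).trans (abs_real_inner_le_norm _ _)
    have h6 : α * ⟪F t, e (w t)⟫ ≤ α * (‖F t‖ * ‖e (w t)‖) := by gcongr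
    have h7 : α / ρ * -⟪s' t, q t⟫ ≤ α / ρ * (‖s' t‖ * ‖q t‖) := by gcongr
    have h8 : 0 ≤ η * ‖δ (w t)‖ ^ 2 := by positivity
    rw [h1, h2]
    simp only [hX, hb, hΓ]
    linarith
  set A : ℝ := α * (‖q₀‖ ^ 2 / ρ + M * (∫ t in Ioo 0 T, ‖s t‖ ^ 2)
    + (∫ t in Ioo 0 T, ‖s' t‖ ^ 2) / ρ) with hA
  have hA0 : 0 ≤ A := by
    have h1 : 0 ≤ ∫ t in Ioo 0 T, ‖s t‖ ^ 2 := integral_nonneg fun _ => by positivity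
    have h2 : 0 ≤ ∫ t in Ioo 0 T, ‖s' t‖ ^ 2 := integral_nonneg fun _ => by positivity
    positivity
  have hmain : ∀ᵐ t ∂(timeMeasure T), X t + 2 * μ * ∫ r in (0 : ℝ)..t, Γ r ≤
      A + C * ∫ r in (0 : ℝ)..t, X r := by
    filter_upwards [en1, en2, ae_restrict_mem measurableSet_Ioo] with t h1 h2 ht
    have hsub : Ioc 0 t ⊆ Ioo 0 T := fun r hr => ⟨hr.1, hr.2.trans_lt ht.2⟩
    have hII : ∀ {f : ℝ → ℝ}, IntegrableOn f (Ioo 0 T) → IntervalIntegrable f volume 0 t :=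
      fun hf => intervalIntegrable_of_integrableOn_Ioo hf (left_mem_Icc.2 hT.le)
        (Ioo_subset_Icc_self ht)
    have h3 : ∫ r in (0 : ℝ)..t, (2 * (ρ * ⟪ρ⁻¹ • g r, w r⟫) + 2 * (α / ρ * ⟪k r, q r⟫)) ≤
        ∫ r in (0 : ℝ)..t, (C * X r + b r - 2 * μ * Γ r) := by
      rw [intervalIntegral.integral_of_le ht.1.le, intervalIntegral.integral_of_le ht.1.le]
      refine integral_mono_ae ?_ ?_ (ae_restrict_of_ae_restrict_of_subset hsub hpt)
      · exact IntegrableOn.mono_set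
          (((ig.const_mul ρ).const_mul 2).add ((ik.const_mul (α / ρ)).const_mul 2)) hsub
      · exact IntegrableOn.mono_set
          (((iX.const_mul C).add ib).sub (iΓ.const_mul (2 * μ))) hsub
    rw [intervalIntegral.integral_add (((hII ig).const_mul ρ).const_mul 2)
        (((hII ik).const_mul (α / ρ)).const_mul 2),
      intervalIntegral.integral_sub (((hII iX).const_mul C).add (hII ib))
        ((hII iΓ).const_mul (2 * μ)),
      intervalIntegral.integral_add ((hII iX).const_mul C) (hII ib)] at h3
    simp only [intervalIntegral.integral_const_mul] at h3
    have h4 : ∫ r in (0 : ℝ)..t, b r ≤ α * M * (∫ t in Ioo 0 T, ‖s t‖ ^ 2)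
        + α / ρ * ∫ t in Ioo 0 T, ‖s' t‖ ^ 2 := by
      have h5 : ∫ r in Ioo 0 T, b r = α * M * (∫ t in Ioo 0 T, ‖s t‖ ^ 2)
          + α / ρ * ∫ t in Ioo 0 T, ‖s' t‖ ^ 2 := by
        rw [← integral_const_mul, ← integral_const_mul]
        exact integral_add ((integrable_norm_sq_of_memLp hs).const_mul (α * M))
          ((integrable_norm_sq_of_memLp hs').const_mul (α / ρ))
      rw [← h5, intervalIntegral.integral_of_le ht.1.le]
      exact setIntegral_mono_set ib (Eventually.of_forall fun r => by positivity)
        (Eventually.of_forall hsub)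
    rw [norm_zero, zero_pow two_ne_zero, zero_add] at h1
    rw [ContinuousLinearMap.id_apply] at h2
    have h6 := mul_le_mul_of_nonneg_left h1 hρ.le
    have h7 := mul_le_mul_of_nonneg_left h2 (show 0 ≤ α / ρ by positivity)
    have h8 : A = α / ρ * ‖q₀‖ ^ 2 + (α * M * (∫ t in Ioo 0 T, ‖s t‖ ^ 2)
        + α / ρ * ∫ t in Ioo 0 T, ‖s' t‖ ^ 2) := by
      rw [hA]; field_simp; ring
    have h9 : X t = ρ * ‖e (w t)‖ ^ 2 + α / ρ * ‖q t‖ ^ 2 := rfl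
    rw [h8, h9]
    linarith
  have hgr := gronwall_integral hA0 hCpos iX (by
    filter_upwards [hmain, ae_restrict_mem measurableSet_Ioo] with t h1 ht
    have h2 : 0 ≤ ∫ r in (0 : ℝ)..t, Γ r :=
      intervalIntegral.integral_nonneg ht.1.le fun r _ => by positivity
    have h3 : 0 ≤ 2 * μ * ∫ r in (0 : ℝ)..t, Γ r := by positivity
    linarith)
  filter_upwards [hmain, ae_restrict_mem measurableSet_Ioo] with t h1 ht
  exact h1.trans (hgr t (Ioo_subset_Icc_self ht))

/-! ### Weak-star convergence of the pressure differences -/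

/-- Continuity upgrades the almost everywhere equality `max Φ c = c` to all of `[0,T]`. It makes the
integrated bounds available at every time, in particular at `T`. -/
theorem forall_le_of_ae_le {T c : ℝ} (hT : 0 < T) {Φ : ℝ → ℝ} (hΦ : ContinuousOn Φ (Icc 0 T))
    (h : ∀ᵐ t ∂(timeMeasure T), Φ t ≤ c) : ∀ t ∈ Icc 0 T, Φ t ≤ c := by
  have h1 : (fun t => max (Φ t) c) =ᵐ[volume.restrict (Icc 0 T)] fun _ => c := by
    rw [← restrict_Ioo_eq_restrict_Icc]
    filter_upwards [h] with t ht using max_eq_right ht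
  have h2 := Measure.eqOn_Icc_of_ae_eq volume hT.ne h1 (ContinuousOn.sup hΦ continuousOn_const)
    continuousOn_const
  intro t ht
  exact max_eq_right_iff.1 (h2 ht)

theorem integrable_inner_of_bounded {α P : Type*} [MeasurableSpace α] {m : Measure α}
    [NormedAddCommGroup P] [InnerProductSpace ℝ P] {x g : α → P} {B : ℝ}
    (hx : AEStronglyMeasurable x m) (hB : ∀ᵐ t ∂m, ‖x t‖ ≤ B) (hg : Integrable g m) :
    Integrable (fun t => ⟪x t, g t⟫) m := by
  refine (hg.norm.const_mul B).mono' (hx.inner hg.1) ?_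
  filter_upwards [hB] with t ht
  exact (abs_real_inner_le_norm _ _).trans (by gcongr)

theorem abs_integral_inner_le_of_bounded {α P : Type*} [MeasurableSpace α] {m : Measure α}
    [NormedAddCommGroup P] [InnerProductSpace ℝ P] {x g : α → P} {B : ℝ}
    (hB : ∀ᵐ t ∂m, ‖x t‖ ≤ B) (hg : Integrable g m) :
    |∫ t, ⟪x t, g t⟫ ∂m| ≤ B * ∫ t, ‖g t‖ ∂m := by
  rw [← integral_const_mul]
  refine norm_integral_le_of_norm_le (f := fun t => ⟪x t, g t⟫) (hg.norm.const_mul B) ?_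
  filter_upwards [hB] with t ht
  exact (abs_real_inner_le_norm _ _).trans (by gcongr)

/-- A bounded family in `L^∞(0,T;P)` tends to zero weak-star as soon as the integrals of its
scalar products with the elements of a dense subspace tend to zero on all intervals `(0,τ)`. -/
theorem tendsto_integral_inner_zero {ι P : Type*} [NormedAddCommGroup P] [InnerProductSpace ℝ P]
    [CompleteSpace P] {l : Filter ι} {T B : ℝ} (hT : 0 < T)
    {q : ι → ℝ → P} (hq : ∀ᶠ i in l, AEStronglyMeasurable (q i) (timeMeasure T) ∧
      ∀ᵐ t ∂(timeMeasure T), ‖q i t‖ ≤ B)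
    {Z : Submodule ℝ P} (hZ : Z.topologicalClosure = ⊤)
    (h : ∀ r ∈ Z, ∀ τ ∈ Icc 0 T, Tendsto (fun i => ∫ t in (0 : ℝ)..τ, ⟪q i t, r⟫) l (𝓝 0))
    {g : ℝ → P} (hg : MemLp g 1 (timeMeasure T)) :
    Tendsto (fun i => ∫ t in Ioo 0 T, ⟪q i t, g t⟫) l (𝓝 0) := by
  -- From the dense subspace to all `r`, using the uniform bound on `q`.
  have tendsto_interval : ∀ r : P, ∀ τ ∈ Icc 0 T,
      Tendsto (fun i => ∫ t in Ioo 0 τ, ⟪q i t, r⟫) l (𝓝 0) := by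
    intro r τ hτ
    have hsub : Ioo 0 τ ⊆ Ioo 0 T := Ioo_subset_Ioo_right hτ.2
    have hcl := isClosed_setOf_tendsto_zero (l := l)
      (Λ := fun i (r : P) => ∫ t in Ioo 0 τ, ⟪q i t, r⟫) (B := B * τ) (by
        filter_upwards [hq] with i hi y z
        have hb := ae_restrict_of_ae_restrict_of_subset hsub hi.2
        have hm : AEStronglyMeasurable (q i) (volume.restrict (Ioo 0 τ)) := hi.1.mono_set hsub
        have hc : ∀ x : P, Integrable (fun _ : ℝ => x) (volume.restrict (Ioo 0 τ)) := fun x =>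
          integrable_const x
        rw [← integral_sub (integrable_inner_of_bounded hm hb (hc y))
          (integrable_inner_of_bounded hm hb (hc z))]
        simp only [← inner_sub_right]
        refine (abs_integral_inner_le_of_bounded hb (hc (y - z))).trans_eq ?_
        simp [hτ.1]
        ring)
    have hr : r ∈ closure (Z : Set P) := by
      rw [← Submodule.topologicalClosure_coe, hZ]; trivial
    refine closure_minimal (fun y hy => ?_) hcl hr
    simpa [intervalIntegral.integral_of_le hτ.1, integral_Ioc_eq_integral_Ioo] using h y hy τ hτ
  -- A π-λ argument passes from the intervals `(0,τ)` to Borel sets: half-lines cut `(0,T)` in such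
  -- intervals.
  have tendsto_set : ∀ r : P, ∀ A : Set ℝ, MeasurableSet A →
      Tendsto (fun i => ∫ t in A, ⟪q i t, r⟫ ∂(timeMeasure T)) l (𝓝 0) := by
    intro r A hA
    have hint : ∀ᶠ i in l, Integrable (fun t => ⟪q i t, r⟫) (timeMeasure T) := by
      filter_upwards [hq] with i hi
      exact integrable_inner_of_bounded hi.1 hi.2 (integrable_const r)
    induction A, hA using MeasurableSpace.induction_on_inter
      (borel_eq_generateFrom_Iio ℝ ▸ BorelSpace.measurable_eq) isPiSystem_Iio with
    | empty => simpa using tendsto_const_nhds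
    | basic A hA =>
      obtain ⟨a, rfl⟩ := hA
      rw [Measure.restrict_restrict measurableSet_Iio]
      have h1 : Iio a ∩ Ioo 0 T = Ioo 0 (min (max a 0) T) := by
        ext t
        simp only [mem_inter_iff, mem_Iio, mem_Ioo, lt_min_iff, lt_max_iff]
        constructor
        · rintro ⟨h1, h2, h3⟩; exact ⟨h2, Or.inl h1, h3⟩
        · rintro ⟨h1, h2 | h2, h3⟩
          · exact ⟨h2, h1, h3⟩
          · exact absurd h1 (not_lt.2 h2.le)
      rw [h1]
      exact tendsto_interval r _ ⟨le_min (le_max_right _ _) hT.le, min_le_right _ _⟩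
    | compl A hA ih =>
      have h1 := (tendsto_interval r T (right_mem_Icc.2 hT.le)).sub ih
      rw [sub_zero] at h1
      refine h1.congr' ?_
      filter_upwards [hint] with i hi
      rw [← integral_add_compl hA hi, add_sub_cancel_left]
    | iUnion A hd hA ih =>
      have hfin : ∑' n, timeMeasure T (A n) ≠ ⊤ := by
        rw [← measure_iUnion hd hA]
        exact measure_ne_top _ _
      have hsum : Summable fun n => |B| * ‖r‖ * (timeMeasure T).real (A n) :=
        (ENNReal.summable_toReal hfin).mul_left _
      -- The bound `|B| ‖r‖ · |Aₙ|` is summable and independent of the index `i`, so limit and sum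
      -- may be interchanged for disjoint unions.
      have h1 := tendsto_tsum_of_dominated_convergence (𝓕 := l)
        (f := fun i n => ∫ t in A n, ⟪q i t, r⟫ ∂(timeMeasure T)) (g := fun _ => (0 : ℝ))
        hsum ih (by
          filter_upwards [hq] with i hi n
          refine (abs_integral_inner_le_of_bounded (B := |B|) (ae_restrict_of_ae ?_)
            (integrable_const r)).trans_eq ?_
          · filter_upwards [hi.2] with t ht using ht.trans (le_abs_self B)
          · simp only [integral_const, measureReal_restrict_apply_univ, smul_eq_mul]
            ring)
      rw [tsum_zero] at h1
      refine h1.congr' ?_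
      filter_upwards [hint] with i hi
      exact (integral_iUnion hA hd hi.integrableOn).symm
  have hmeas : ∀ {y : ℝ → P}, MemLp y 1 (timeMeasure T) → ∀ᶠ i in l,
      Integrable (fun t => ⟪q i t, y t⟫) (timeMeasure T) := by
    intro y hy
    filter_upwards [hq] with i hi
    exact integrable_inner_of_bounded hi.1 hi.2 (memLp_one_iff_integrable.1 hy)
  -- From indicator functions through finite sums to `L¹`; the closedness step again uses the
  -- uniform bound on `q`.
  refine MemLp.induction (p := 1) (by simp)
    (fun g => Tendsto (fun i => ∫ t in Ioo 0 T, ⟪q i t, g t⟫) l (𝓝 0)) ?_ ?_ ?_ ?_ hg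
  · intro r A hA _
    refine (tendsto_set r A hA).congr fun i => ?_
    rw [← integral_indicator hA]
    refine integral_congr_ae (Eventually.of_forall fun t => ?_)
    by_cases ht : t ∈ A <;> simp [ht]
  · intro x y _ hx hy hx0 hy0
    have h1 := hx0.add hy0
    rw [add_zero] at h1
    refine h1.congr' ?_
    filter_upwards [hmeas hx, hmeas hy] with i h2 h3
    rw [← integral_add h2 h3]
    simp only [Pi.add_apply, inner_add_right]
  · refine isClosed_setOf_tendsto_zero (B := B)
      (Λ := fun i (y : Lp P 1 (timeMeasure T)) => ∫ t in Ioo 0 T, ⟪q i t, y t⟫) ?_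
    filter_upwards [hq] with i hi y z
    have hi1 := fun y : Lp P 1 (timeMeasure T) =>
      integrable_inner_of_bounded hi.1 hi.2 (L1.integrable_coeFn y)
    rw [← integral_sub (hi1 y) (hi1 z)]
    simp only [← inner_sub_right]
    refine (abs_integral_inner_le_of_bounded hi.2
      ((L1.integrable_coeFn y).sub (L1.integrable_coeFn z))).trans_eq ?_
    rw [L1.norm_eq_integral_norm]
    congr 1
    refine integral_congr_ae ?_
    filter_upwards [Lp.coeFn_sub y z] with t ht
    rw [ht]
  · intro x y hxy _ hx
    refine hx.congr fun i => integral_congr_ae ?_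
    filter_upwards [hxy] with t ht
    rw [ht]

/-- The bound for the pressure differences tested with divergences. -/
theorem abs_integral_pressure_le {H K P G : Type*}
    [NormedAddCommGroup H] [InnerProductSpace ℝ H] [CompleteSpace H]
    [NormedAddCommGroup K] [InnerProductSpace ℝ K] [CompleteSpace K]
    [NormedAddCommGroup P] [InnerProductSpace ℝ P] [CompleteSpace P]
    [NormedAddCommGroup G] [InnerProductSpace ℝ G] [CompleteSpace G]
    (e : H →L[ℝ] K) (γ : H →L[ℝ] G) (δ : H →L[ℝ] P) {T μ η ρ α c₁ c₂ c₃ : ℝ}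
    (hT : 0 < T) (hμ : 0 < μ) (hη : 0 ≤ η) (hρ : 0 < ρ) (hα : 0 < α)
    {w : ℝ → H} {q : ℝ → P} {F : ℝ → K}
    (hw2 : MemLp w 2 (timeMeasure T)) (hq2 : MemLp q 2 (timeMeasure T))
    (hF2 : MemLp F 2 (timeMeasure T))
    (heqw : ∀ᵐ t ∂(timeMeasure T), massTerm e ρ (e (w t)) =
      ∫ r in (0 : ℝ)..t, evolutionRHS e γ δ μ η w q (fun r => α • F r) r)
    (h₁ : ∀ᵐ t ∂(timeMeasure T), ‖e (w t)‖ ≤ c₁) (h₂ : ∫ t in Ioo 0 T, ‖w t‖ ≤ c₂)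
    (h₃ : ∫ t in Ioo 0 T, ‖F t‖ ≤ c₃) (v : H) :
    ∀ τ ∈ Icc 0 T, |∫ t in (0 : ℝ)..τ, ⟪q t, δ v⟫| ≤
      ρ * c₁ * ‖e v‖ + (μ * (‖γ‖ * ‖γ v‖) + η * (‖δ‖ * ‖δ v‖)) * c₂ + α * ‖e v‖ * c₃ := by
  set g : ℝ → H := evolutionRHS e γ δ μ η w q (fun r => α • F r) with hg
  have hgi : IntegrableOn g (Ioo 0 T) :=
    (memLp_evolutionRHS e γ δ μ η hw2 hq2 (hF2.const_smul α)).integrable one_le_two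
  have hw : IntegrableOn w (Ioo 0 T) := hw2.integrable one_le_two
  have hF : IntegrableOn F (Ioo 0 T) := hF2.integrable one_le_two
  -- `R` collects the viscous and force terms, so that `⟪q, δ v⟫` equals the tested right hand side
  -- plus `R`.
  set R : ℝ → ℝ := fun r => μ * ⟪γ (w r), γ v⟫ + η * ⟪δ (w r), δ v⟫ - α * ⟪F r, e v⟫ with hR
  have hqg : ∀ r, ⟪q r, δ v⟫ = ⟪v, g r⟫ + R r := by
    intro r
    rw [real_inner_comm (g r) v]
    simp only [hg, hR, inner_evolutionRHS, real_inner_smul_left]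
    ring
  have hgv : IntegrableOn (fun r => ⟪v, g r⟫) (Ioo 0 T) := hgi.const_inner v
  have hγi : IntegrableOn (fun r => ⟪γ (w r), γ v⟫) (Ioo 0 T) :=
    (γ.integrable_comp hw).inner_const (γ v)
  have hδi : IntegrableOn (fun r => ⟪δ (w r), δ v⟫) (Ioo 0 T) :=
    (δ.integrable_comp hw).inner_const (δ v)
  have hFi : IntegrableOn (fun r => ⟪F r, e v⟫) (Ioo 0 T) := hF.inner_const (e v)
  have hRi : IntegrableOn R (Ioo 0 T) :=
    ((hγi.const_mul μ).add (hδi.const_mul η)).sub (hFi.const_mul α)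
  -- By the integrated equation this integral is `ρ ⟪e v, e (w τ)⟫` for almost every `τ`; no bound
  -- on a time derivative of `w` is needed. Continuity of the primitive extends the estimate to
  -- every `τ`.
  have hG : ∀ τ ∈ Icc 0 T, |∫ r in (0 : ℝ)..τ, ⟪v, g r⟫| ≤ ρ * c₁ * ‖e v‖ := by
    refine forall_le_of_ae_le hT (continuousOn_primitive_Icc hT.le hgv).abs ?_
    filter_upwards [heqw, h₁, ae_restrict_mem measurableSet_Ioo] with t ht h1 hmem
    have h2 : ∫ r in (0 : ℝ)..t, ⟪v, g r⟫ = ⟪v, ∫ r in (0 : ℝ)..t, g r⟫ := by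
      rw [intervalIntegral.integral_of_le hmem.1.le, intervalIntegral.integral_of_le hmem.1.le]
      exact integral_inner (hgi.mono_set fun r hr => ⟨hr.1, hr.2.trans_lt hmem.2⟩) v
    rw [h2, ← ht, massTerm, real_inner_smul_right, ContinuousLinearMap.adjoint_inner_right, abs_mul,
      abs_of_pos hρ, mul_assoc]
    have h3 := abs_real_inner_le_norm (e v) (e (w t))
    gcongr
    calc |⟪e v, e (w t)⟫| ≤ ‖e v‖ * ‖e (w t)‖ := h3
      _ ≤ ‖e v‖ * c₁ := by gcongr
      _ = c₁ * ‖e v‖ := mul_comm _ _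
  have hRle : ∀ r, ‖R r‖ ≤ (μ * (‖γ‖ * ‖γ v‖) + η * (‖δ‖ * ‖δ v‖)) * ‖w r‖
      + α * ‖e v‖ * ‖F r‖ := by
    intro r
    have a1 : |⟪γ (w r), γ v⟫| ≤ ‖γ‖ * ‖w r‖ * ‖γ v‖ :=
      (abs_real_inner_le_norm _ _).trans (by gcongr; exact γ.le_opNorm _)
    have a2 : |⟪δ (w r), δ v⟫| ≤ ‖δ‖ * ‖w r‖ * ‖δ v‖ :=
      (abs_real_inner_le_norm _ _).trans (by gcongr; exact δ.le_opNorm _)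
    have a3 : |⟪F r, e v⟫| ≤ ‖F r‖ * ‖e v‖ := abs_real_inner_le_norm _ _
    calc ‖R r‖ ≤ |μ * ⟪γ (w r), γ v⟫| + |η * ⟪δ (w r), δ v⟫| + |α * ⟪F r, e v⟫| :=
          (abs_sub _ _).trans (by gcongr; exact abs_add_le _ _)
      _ = μ * |⟪γ (w r), γ v⟫| + η * |⟪δ (w r), δ v⟫| + α * |⟪F r, e v⟫| := by
          rw [abs_mul, abs_mul, abs_mul, abs_of_pos hμ, abs_of_nonneg hη, abs_of_pos hα]
      _ ≤ μ * (‖γ‖ * ‖w r‖ * ‖γ v‖) + η * (‖δ‖ * ‖w r‖ * ‖δ v‖) + α * (‖F r‖ * ‖e v‖) := by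
          gcongr
      _ = _ := by ring
  intro τ hτ
  have hII : ∀ {f : ℝ → ℝ}, IntegrableOn f (Ioo 0 T) → IntervalIntegrable f volume 0 τ :=
    fun hf => intervalIntegrable_of_integrableOn_Ioo hf (left_mem_Icc.2 hT.le) hτ
  have hb : IntegrableOn (fun r => (μ * (‖γ‖ * ‖γ v‖) + η * (‖δ‖ * ‖δ v‖)) * ‖w r‖
      + α * ‖e v‖ * ‖F r‖) (Ioo 0 T) := (hw.norm.const_mul _).add (hF.norm.const_mul _)
  have hRint : |∫ r in (0 : ℝ)..τ, R r| ≤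
      (μ * (‖γ‖ * ‖γ v‖) + η * (‖δ‖ * ‖δ v‖)) * c₂ + α * ‖e v‖ * c₃ := by
    calc |∫ r in (0 : ℝ)..τ, R r| ≤ ∫ r in Ioo 0 τ, ((μ * (‖γ‖ * ‖γ v‖) + η * (‖δ‖ * ‖δ v‖))
          * ‖w r‖ + α * ‖e v‖ * ‖F r‖) := by
          rw [intervalIntegral.integral_of_le hτ.1, integral_Ioc_eq_integral_Ioo]
          exact norm_integral_le_of_norm_le (hb.mono_set (Ioo_subset_Ioo_right hτ.2))
            (Eventually.of_forall hRle)
      _ ≤ ∫ r in Ioo 0 T, ((μ * (‖γ‖ * ‖γ v‖) + η * (‖δ‖ * ‖δ v‖)) * ‖w r‖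
          + α * ‖e v‖ * ‖F r‖) :=
          setIntegral_mono_set hb (Eventually.of_forall fun r => by positivity)
            (Eventually.of_forall fun r hr => Ioo_subset_Ioo_right hτ.2 hr)
      _ = (μ * (‖γ‖ * ‖γ v‖) + η * (‖δ‖ * ‖δ v‖)) * (∫ r in Ioo 0 T, ‖w r‖)
          + α * ‖e v‖ * ∫ r in Ioo 0 T, ‖F r‖ := by
          rw [← integral_const_mul, ← integral_const_mul]
          exact integral_add (hw.norm.const_mul _) (hF.norm.const_mul _)
      _ ≤ _ := by gcongr
  simp only [hqg]
  rw [intervalIntegral.integral_add (hII hgv) (hII hRi)]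
  calc _ ≤ |∫ r in (0 : ℝ)..τ, ⟪v, g r⟫| + |∫ r in (0 : ℝ)..τ, R r| := abs_add_le _ _
    _ ≤ _ := by linarith [hG τ hτ]

/-! ### The weak formulations in integrated form -/

instance completeSpace_H01 {d : ℕ} (D : Set (Vec d)) : CompleteSpace (H01 D) :=
  (Submodule.isClosed_topologicalClosure _).completeSpace_coe

/-- The gradient on `H₀¹(D)^d`. -/
def gradH01 {d : ℕ} (D : Set (Vec d)) : H01 D →L[ℝ] L2 D (Mat d) :=
  (grad D).comp (H01 D).subtypeL

/-- The divergence on `H₀¹(D)^d`. -/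
def divH01 {d : ℕ} (D : Set (Vec d)) : H01 D →L[ℝ] L2 D ℝ :=
  (div D).comp (H01 D).subtypeL

/-- Multiplication by the force at time `t`. -/
def forceMul {d : ℕ} (D : Set (Vec d)) {M : ℝ} {F : Vec d × ℝ → Vec d}
    (hF : StronglyMeasurable F) (hM : ∀ z, ‖F z‖ ≤ M) (t : ℝ) : L2 D (Vec d) →L[ℝ] L2 D ℝ :=
  innerMul D (hF.comp_measurable measurable_prodMk_right) fun x => hM (x, t)

theorem memLp_adjoint_forceMul {d : ℕ} (D : Set (Vec d)) {T M : ℝ} {F : Vec d × ℝ → Vec d}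
    (hF : StronglyMeasurable F) (hM : ∀ z, ‖F z‖ ≤ M) (hM0 : 0 ≤ M)
    {r : ℝ → L2 D ℝ} (hr : MemLp r 2 (timeMeasure T)) :
    MemLp (fun t => (forceMul D hF hM t).adjoint (r t)) 2 (timeMeasure T) :=
  memLp_adjoint_innerMul D hF hM hM0 hr

theorem norm_adjoint_forceMul_le {d : ℕ} (D : Set (Vec d)) {M : ℝ} {F : Vec d × ℝ → Vec d}
    (hF : StronglyMeasurable F) (hM : ∀ z, ‖F z‖ ≤ M) (hM0 : 0 ≤ M) (t : ℝ) (r : L2 D ℝ) :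
    ‖(forceMul D hF hM t).adjoint r‖ ≤ M * ‖r‖ := by
  refine (ContinuousLinearMap.le_opNorm _ _).trans ?_
  rw [LinearIsometryEquiv.norm_map]
  gcongr
  exact ContinuousLinearMap.opNorm_le_bound _ hM0 (norm_innerMul_apply_le D _ _)

theorem inner_forceMul {d : ℕ} (D : Set (Vec d)) {M : ℝ} {F : Vec d × ℝ → Vec d}
    (hF : StronglyMeasurable F) (hM : ∀ z, ‖F z‖ ≤ M) (t : ℝ) (r : L2 D ℝ) (v : L2 D (Vec d)) :
    ⟪r, forceMul D hF hM t v⟫ = ∫ x in D, r x * ⟪F (x, t), v x⟫ :=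
  inner_innerMul D _ _ r v

theorem coeFn_const_add_smul {d : ℕ} (D : Set (Vec d)) [IsFiniteMeasure (volume.restrict D)]
    (ρ₀ α : ℝ) (p : L2 D ℝ) :
    (ρ₀ • oneL2 D + α • p : L2 D ℝ) =ᵐ[volume.restrict D] fun x => ρ₀ + α * p x := by
  filter_upwards [Lp.coeFn_add (ρ₀ • oneL2 D) (α • p), Lp.coeFn_smul ρ₀ (oneL2 D),
    Lp.coeFn_smul α p, Lp.coeFn_const 2 (volume.restrict D) (1 : ℝ)] with x h1 h2 h3 h4
  rw [h1, Pi.add_apply, h2, h3, Pi.smul_apply, Pi.smul_apply, oneL2, h4]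
  simp

theorem memLp_const_add_smul {d : ℕ} (D : Set (Vec d)) [IsFiniteMeasure (volume.restrict D)]
    {T : ℝ} (ρ₀ α : ℝ) {p : ℝ → L2 D ℝ} (hp : MemLp p 2 (timeMeasure T)) :
    MemLp (fun t => ρ₀ • oneL2 D + α • p t) 2 (timeMeasure T) :=
  MemLp.add (f := fun _ => ρ₀ • oneL2 D) (g := α • p) (memLp_const _) (hp.const_smul α)

/-- The pairing of the force with a test field, for a bounded representative of the force. -/
theorem integral_force_eq_inner {d : ℕ} {D : Set (Vec d)} [IsFiniteMeasure (volume.restrict D)]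
    {M : ℝ} {f F : Vec d × ℝ → Vec d} (hF : StronglyMeasurable F) (hM : ∀ z, ‖F z‖ ≤ M) {t : ℝ}
    (hfF : ∀ᵐ x ∂(volume.restrict D), f (x, t) = F (x, t)) (ρ₀ α : ℝ) (p : L2 D ℝ)
    (v : L2 D (Vec d)) :
    ∫ x in D, (ρ₀ + α * p x) * ⟪f (x, t), v x⟫
      = ⟪(forceMul D hF hM t).adjoint (ρ₀ • oneL2 D + α • p), v⟫ := by
  rw [ContinuousLinearMap.adjoint_inner_left, inner_forceMul]
  refine integral_congr_ae ?_
  filter_upwards [hfF, coeFn_const_add_smul D ρ₀ α p] with x hx1 hx2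
  rw [hx1, hx2]

theorem integral_force_eq_inner_const {d : ℕ} {D : Set (Vec d)}
    [IsFiniteMeasure (volume.restrict D)]
    {M : ℝ} {f F : Vec d × ℝ → Vec d} (hF : StronglyMeasurable F) (hM : ∀ z, ‖F z‖ ≤ M) {t : ℝ}
    (hfF : ∀ᵐ x ∂(volume.restrict D), f (x, t) = F (x, t)) (ρ₀ : ℝ) (v : L2 D (Vec d)) :
    ∫ x in D, ρ₀ * ⟪f (x, t), v x⟫ = ⟪(forceMul D hF hM t).adjoint (ρ₀ • oneL2 D), v⟫ := by
  have h1 := integral_force_eq_inner hF hM hfF ρ₀ 0 0 v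
  simpa only [zero_mul, add_zero, zero_smul] using h1

/-- The momentum equation of the compressible fluid in integrated form. -/
theorem IsCompressibleWeakSolution.velocity_eq {d : ℕ} {D : Set (Vec d)}
    [IsFiniteMeasure (volume.restrict D)] {T μ η ρ₀ α : ℝ} (hT : 0 < T)
    {f : Vec d × ℝ → Vec d} {u₀ : L2 D (Vec d)} {p₀ : L2 D ℝ} {u : ℝ → H01 D} {p : ℝ → L2 D ℝ}
    (hsol : IsCompressibleWeakSolution D T μ η ρ₀ α f u₀ p₀ u p)
    {M : ℝ} {F : Vec d × ℝ → Vec d}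
    (hF : StronglyMeasurable F) (hM : ∀ z, ‖F z‖ ≤ M) (hM0 : 0 ≤ M)
    (hfF : ∀ᵐ t ∂(timeMeasure T), ∀ᵐ x ∂(volume.restrict D), f (x, t) = F (x, t)) :
    ∀ᵐ t ∂(timeMeasure T), massTerm (embL2 D) ρ₀ (embL2 D (u t))
      = massTerm (embL2 D) ρ₀ u₀ + ∫ s in (0 : ℝ)..t,
        evolutionRHS (embL2 D) (gradH01 D) (divH01 D) μ η u p
          (fun t => (forceMul D hF hM t).adjoint (ρ₀ • oneL2 D + α • p t)) s := by
  refine evolution_eq_of_weak (embL2 D) (gradH01 D) (divH01 D) hT hsol.velocity_mem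
    hsol.pressure_mem
    (memLp_adjoint_forceMul D hF hM hM0 (memLp_const_add_smul D ρ₀ α hsol.pressure_mem))
    fun φ hφ v => ?_
  have h1 := hsol.momentum φ hφ v
  have h2 : ∫ t in Ioo 0 T, (∫ x in D, (ρ₀ + α * p t x) * ⟪f (x, t), field D v x⟫) * φ t
      = ∫ t in Ioo 0 T, ⟪(forceMul D hF hM t).adjoint (ρ₀ • oneL2 D + α • p t), embL2 D v⟫
        * φ t := by
    refine integral_congr_ae ?_
    filter_upwards [hfF] with t ht
    rw [integral_force_eq_inner hF hM ht]
    rfl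
  rw [h2] at h1
  exact h1

/-- The continuity equation of the compressible fluid in integrated form. -/
theorem IsCompressibleWeakSolution.pressure_eq {d : ℕ} {D : Set (Vec d)} {T μ η ρ₀ α : ℝ}
    (hT : 0 < T) (hα : 0 < α)
    {f : Vec d × ℝ → Vec d} {u₀ : L2 D (Vec d)} {p₀ : L2 D ℝ} {u : ℝ → H01 D} {p : ℝ → L2 D ℝ}
    (hsol : IsCompressibleWeakSolution D T μ η ρ₀ α f u₀ p₀ u p) :
    ∀ᵐ t ∂(timeMeasure T), p t = p₀ + ∫ s in (0 : ℝ)..t, -(ρ₀ / α) • divH01 D (u s) := by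
  have hdiv : MemLp (fun t => divH01 D (u t)) 2 (timeMeasure T) :=
    (divH01 D).comp_memLp' hsol.velocity_mem
  have hk : IntegrableOn (fun t => -(ρ₀ / α) • divH01 D (u t)) (Ioo 0 T) :=
    (hdiv.integrable one_le_two).smul (-(ρ₀ / α))
  refine ae_eq_initial_add_primitive_of_inner hT (hsol.pressure_mem.integrable one_le_two) hk
    fun φ hφ r => ?_
  have h1 : - (∫ t in Ioo 0 T, α * ⟪p t, r⟫ * deriv φ t) - α * ⟪p₀, r⟫ * φ 0
      + ∫ t in Ioo 0 T, ρ₀ * ⟪divH01 D (u t), r⟫ * φ t = 0 := hsol.continuity φ hφ r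
  simp only [mul_assoc, integral_const_mul] at h1
  have h2 : ∀ t, ⟪-(ρ₀ / α) • divH01 D (u t), r⟫ * φ t
      = -(ρ₀ / α) * (⟪divH01 D (u t), r⟫ * φ t) := fun t => by
    rw [real_inner_smul_left, mul_assoc]
  simp only [h2, integral_const_mul]
  field_simp
  linarith

theorem isTest_smul {d : ℕ} {D : Set (Vec d)} {T : ℝ} {φ : ℝ → ℝ} (hφ : IsTest (Ioo 0 T) φ)
    {v : Vec d → Vec d} (hv : v ∈ testFields D) :
    IsTest (D ×ˢ Ioo 0 T) fun z : Vec d × ℝ => φ z.2 • v z.1 := by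
  have hsub : tsupport (fun z : Vec d × ℝ => φ z.2 • v z.1) ⊆ tsupport v ×ˢ tsupport φ := by
    refine closure_minimal (fun z hz => ?_) ((isClosed_tsupport _).prod (isClosed_tsupport _))
    rw [Function.mem_support] at hz
    exact ⟨subset_tsupport _ (right_ne_zero_of_smul hz),
      subset_tsupport _ (left_ne_zero_of_smul hz)⟩
  refine ⟨(hφ.1.comp contDiff_snd).smul (ContDiff.comp hv.1 contDiff_fst), ?_,
    hsub.trans (prod_mono hv.2.2 hφ.2.2)⟩
  have hv2 : IsCompact (tsupport v) := hv.2.1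
  have hφ2 : IsCompact (tsupport φ) := hφ.2.1
  exact (hv2.prod hφ2).of_isClosed_subset (isClosed_tsupport _) hsub

/-- The Stokes momentum equation tested with a product of a function of time and a Sobolev field
that is represented by a test field. -/
theorem IsStokesWeakSolution.momentum_test {d : ℕ} {D : Set (Vec d)}
    [IsFiniteMeasure (volume.restrict D)] {T μ ρ₀ : ℝ}
    {f : Vec d × ℝ → Vec d} {u₀ : L2 D (Vec d)} {u : ℝ → H01 D} {p : ℝ → L2 D ℝ}
    (hsol : IsStokesWeakSolution D T μ ρ₀ f u₀ u p)
    {M : ℝ} {F : Vec d × ℝ → Vec d}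
    (hF : StronglyMeasurable F) (hM : ∀ z, ‖F z‖ ≤ M)
    (hfF : ∀ᵐ t ∂(timeMeasure T), ∀ᵐ x ∂(volume.restrict D), f (x, t) = F (x, t))
    {φ : ℝ → ℝ} (hφ : IsTest (Ioo 0 T) φ) {v : Vec d → Vec d} (hv : v ∈ testFields D)
    (w : H01 D) (hw1 : field D w =ᵐ[volume.restrict D] v)
    (hw2 : grad D w =ᵐ[volume.restrict D] gradField v) :
    - (∫ t in Ioo 0 T, ρ₀ * ⟪embL2 D (u t), embL2 D w⟫ * deriv φ t)
        - ∫ t in Ioo 0 T, ⟪p t, divH01 D w⟫ * φ t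
      = - μ * (∫ t in Ioo 0 T, ⟪gradH01 D (u t), gradH01 D w⟫ * φ t)
        + ∫ t in Ioo 0 T, ⟪(forceMul D hF hM t).adjoint (ρ₀ • oneL2 D), embL2 D w⟫ * φ t := by
  have h1 := hsol.momentum _ (isTest_smul hφ hv)
  have e1 : ∀ t, ∫ x in D, ρ₀ * ⟪field D (u t) x, deriv (fun s => φ s • v x) t⟫
      = ρ₀ * ⟪field D (u t), field D w⟫ * deriv φ t := by
    intro t
    have hd : ∀ x, deriv (fun s => φ s • v x) t = deriv φ t • v x := fun x =>
      deriv_smul_const ((hφ.1.differentiable (by simp)) t) _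
    rw [L2.inner_def, integral_const_mul, mul_assoc, ← integral_mul_const]
    congr 1
    refine integral_congr_ae ?_
    filter_upwards [hw1] with x hx
    rw [hd, real_inner_smul_right, hx, mul_comm]
  have e2 : ∀ t, ∫ x in D, p t x * divField (fun y => φ t • v y) x
      = ⟪p t, div D w⟫ * φ t := by
    intro t
    have hd : divField (fun y => φ t • v y) = φ t • divField v :=
      divField_smul (φ t) (differentiable_of_mem hv)
    rw [hd, L2.inner_def, ← integral_mul_const]
    refine integral_congr_ae ?_
    filter_upwards [div_ae_eq hw2] with x hx
    simp only [hx, Pi.smul_apply, smul_eq_mul, RCLike.inner_apply, conj_trivial]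
    ring
  have e3 : ∀ t, ∫ x in D, ⟪grad D (u t) x, gradField (fun y => φ t • v y) x⟫
      = ⟪grad D (u t), grad D w⟫ * φ t := by
    intro t
    have hd : gradField (fun y => φ t • v y) = φ t • gradField v :=
      gradField_smul (φ t) (differentiable_of_mem hv)
    rw [hd, L2.inner_def, ← integral_mul_const]
    refine integral_congr_ae ?_
    filter_upwards [hw2] with x hx
    rw [hx, Pi.smul_apply, real_inner_smul_right, mul_comm]
  have e4 : ∫ t in Ioo 0 T, ∫ x in D, ρ₀ * ⟪f (x, t), φ t • v x⟫
      = ∫ t in Ioo 0 T, ⟪(forceMul D hF hM t).adjoint (ρ₀ • oneL2 D), field D w⟫ * φ t := by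
    refine integral_congr_ae ?_
    filter_upwards [hfF] with t ht
    rw [← integral_force_eq_inner_const hF hM ht, ← integral_mul_const]
    refine integral_congr_ae ?_
    filter_upwards [hw1] with x hx
    rw [hx, real_inner_smul_right]
    ring
  simp only [e1, e2, e3] at h1
  rw [e4] at h1
  exact h1

/-- The Sobolev fields that are represented by test fields are dense in `H₀¹(D)^d`. -/
theorem dense_testFields_H01 {d : ℕ} (D : Set (Vec d)) :
    Dense {w : H01 D | (w : Pairs D) ∈ graphOver D (testFields D) le_rfl} := by
  intro w
  rw [closure_subtype]
  refine closure_mono (fun z hz => ?_) w.2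
  exact ⟨⟨z, Submodule.le_topologicalClosure _ hz⟩, hz, rfl⟩

/-- The Stokes momentum equation in integrated form. -/
theorem IsStokesWeakSolution.velocity_eq {d : ℕ} {D : Set (Vec d)}
    [IsFiniteMeasure (volume.restrict D)] {T μ ρ₀ : ℝ} (hT : 0 < T) (hρ₀ : 0 < ρ₀)
    {f : Vec d × ℝ → Vec d} {u₀ : L2 D (Vec d)} (hu₀ : u₀ ∈ J D) {u : ℝ → H01 D}
    {p : ℝ → L2 D ℝ} (hsol : IsStokesWeakSolution D T μ ρ₀ f u₀ u p)
    {M : ℝ} {F : Vec d × ℝ → Vec d}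
    (hF : StronglyMeasurable F) (hM : ∀ z, ‖F z‖ ≤ M) (hM0 : 0 ≤ M)
    (hfF : ∀ᵐ t ∂(timeMeasure T), ∀ᵐ x ∂(volume.restrict D), f (x, t) = F (x, t)) :
    ∀ᵐ t ∂(timeMeasure T), massTerm (embL2 D) ρ₀ (embL2 D (u t))
      = massTerm (embL2 D) ρ₀ u₀ + ∫ s in (0 : ℝ)..t,
        evolutionRHS (embL2 D) (gradH01 D) (divH01 D) μ 0 u p
          (fun t => (forceMul D hF hM t).adjoint (ρ₀ • oneL2 D)) s := by
  refine evolution_eq_of_weak_subspace (embL2 D) (gradH01 D) (divH01 D)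
    ((V D).comap (H01 D).subtype) hT hρ₀ hsol.velocity_mem hsol.pressure_mem
    (memLp_adjoint_forceMul D hF hM hM0 (memLp_const _)) hsol.velocity_mem_V
    (fun v hv => div_eq_zero_of_mem_V hv) ?_ (dense_testFields_H01 D) ?_ ?_
  -- Here `u₀ ∈ J(D)` enters: the initial velocity is an `L²` limit of fields in `V(D)`.
  · refine mem_of_mem_J (P := fun z => z ∈ closure _) isClosed_closure (fun v hv => ?_) hu₀
    exact subset_closure ⟨⟨v, V_le_H01 D hv⟩, hv, rfl⟩
  · rintro φ hφ w ⟨v, hv, hw1, hw2⟩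
    exact hsol.momentum_test hF hM hfF hφ hv w hw1 hw2
  · intro φ hφ v hv
    have h1 := hsol.weak φ hφ v hv
    have h2 : ∫ t in Ioo 0 T, (∫ x in D, ρ₀ * ⟪f (x, t), field D v x⟫) * φ t
        = ∫ t in Ioo 0 T, ⟪(forceMul D hF hM t).adjoint (ρ₀ • oneL2 D), embL2 D v⟫ * φ t := by
      refine integral_congr_ae ?_
      filter_upwards [hfF] with t ht
      rw [integral_force_eq_inner_const hF hM ht]
      rfl
    rw [h2] at h1
    exact h1

/-! ### The difference of the two solutions -/

theorem integral_primitive_sub {E : Type*} [NormedAddCommGroup E] [NormedSpace ℝ E] {T t : ℝ}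
    (ht : t ∈ Ioo 0 T) {k₁ k₂ k : ℝ → E} (h₁ : IntegrableOn k₁ (Ioo 0 T))
    (h₂ : IntegrableOn k₂ (Ioo 0 T)) (h : ∀ᵐ s ∂(timeMeasure T), k s = k₁ s - k₂ s) :
    ∫ s in (0 : ℝ)..t, k s = (∫ s in (0 : ℝ)..t, k₁ s) - ∫ s in (0 : ℝ)..t, k₂ s := by
  have hsub : Ioc 0 t ⊆ Ioo 0 T := fun s hs => ⟨hs.1, hs.2.trans_lt ht.2⟩
  simp only [intervalIntegral.integral_of_le ht.1.le]
  rw [← integral_sub (h₁.mono_set hsub) (h₂.mono_set hsub)]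
  exact integral_congr_ae (ae_restrict_of_ae_restrict_of_subset hsub h)

/-- The common initial term cancels. The second equation has no `η` term, but may be given one
because `δ (u' t)` vanishes almost everywhere. -/
theorem evolution_eq_sub {H K P G : Type*}
    [NormedAddCommGroup H] [InnerProductSpace ℝ H] [CompleteSpace H]
    [NormedAddCommGroup K] [InnerProductSpace ℝ K] [CompleteSpace K]
    [NormedAddCommGroup P] [InnerProductSpace ℝ P] [CompleteSpace P]
    [NormedAddCommGroup G] [InnerProductSpace ℝ G] [CompleteSpace G]
    (e : H →L[ℝ] K) (γ : H →L[ℝ] G) (δ : H →L[ℝ] P) {T μ η ρ α : ℝ}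
    {u u' : ℝ → H} {p p' : ℝ → P} {F₁ F₂ F : ℝ → K} {a : H}
    (hu : MemLp u 2 (timeMeasure T)) (hu' : MemLp u' 2 (timeMeasure T))
    (hp : MemLp p 2 (timeMeasure T)) (hp' : MemLp p' 2 (timeMeasure T))
    (hF₁ : MemLp F₁ 2 (timeMeasure T)) (hF₂ : MemLp F₂ 2 (timeMeasure T))
    (hF : ∀ t, α • F t = F₁ t - F₂ t) (hδ : ∀ᵐ t ∂(timeMeasure T), δ (u' t) = 0)
    (h₁ : ∀ᵐ t ∂(timeMeasure T), massTerm e ρ (e (u t))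
      = a + ∫ s in (0 : ℝ)..t, evolutionRHS e γ δ μ η u p F₁ s)
    (h₂ : ∀ᵐ t ∂(timeMeasure T), massTerm e ρ (e (u' t))
      = a + ∫ s in (0 : ℝ)..t, evolutionRHS e γ δ μ 0 u' p' F₂ s) :
    ∀ᵐ t ∂(timeMeasure T), massTerm e ρ (e (u t - u' t)) = ∫ s in (0 : ℝ)..t,
      evolutionRHS e γ δ μ η (fun t => u t - u' t) (fun t => p t - p' t) (fun t => α • F t) s := by
  have i₁ : IntegrableOn (evolutionRHS e γ δ μ η u p F₁) (Ioo 0 T) :=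
    (memLp_evolutionRHS e γ δ μ η hu hp hF₁).integrable one_le_two
  have i₂ : IntegrableOn (evolutionRHS e γ δ μ 0 u' p' F₂) (Ioo 0 T) :=
    (memLp_evolutionRHS e γ δ μ 0 hu' hp' hF₂).integrable one_le_two
  have hk : ∀ᵐ s ∂(timeMeasure T),
      evolutionRHS e γ δ μ η (fun t => u t - u' t) (fun t => p t - p' t) (fun t => α • F t) s
        = evolutionRHS e γ δ μ η u p F₁ s - evolutionRHS e γ δ μ 0 u' p' F₂ s := by
    filter_upwards [hδ] with s hs
    simp only [hF]
    rw [evolutionRHS_sub]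
    simp [evolutionRHS, hs]
  filter_upwards [h₁, h₂, ae_restrict_mem measurableSet_Ioo] with t ht₁ ht₂ ht
  rw [map_sub, massTerm_sub, ht₁, ht₂, integral_primitive_sub ht i₁ i₂ hk]
  abel

/-- Since `δ u'` vanishes, `δ u` may be written as `δ (u - u')`. The derivative of `p'` becomes a
source, and the initial mismatch `p₀ - c` remains. -/
theorem pressure_eq_sub {H P : Type*} [NormedAddCommGroup H] [InnerProductSpace ℝ H]
    [NormedAddCommGroup P] [InnerProductSpace ℝ P]
    (δ : H →L[ℝ] P) {T κ : ℝ} {u u' : ℝ → H} {p p' s' : ℝ → P} {p₀ c : P}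
    (hu : MemLp u 2 (timeMeasure T)) (hs' : MemLp s' 2 (timeMeasure T))
    (hδ : ∀ᵐ t ∂(timeMeasure T), δ (u' t) = 0)
    (h₁ : ∀ᵐ t ∂(timeMeasure T), p t = p₀ + ∫ s in (0 : ℝ)..t, κ • δ (u s))
    (h₂ : ∀ᵐ t ∂(timeMeasure T), p' t = c + ∫ s in (0 : ℝ)..t, s' s) :
    ∀ᵐ t ∂(timeMeasure T), p t - p' t
      = (p₀ - c) + ∫ r in (0 : ℝ)..t, (κ • δ (u r - u' r) - s' r) := by
  have i₁ : IntegrableOn (fun t => κ • δ (u t)) (Ioo 0 T) :=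
    (δ.integrable_comp (hu.integrable one_le_two)).smul κ
  have hk : ∀ᵐ s ∂(timeMeasure T), κ • δ (u s - u' s) - s' s = κ • δ (u s) - s' s := by
    filter_upwards [hδ] with s hs
    rw [map_sub, hs, sub_zero]
  filter_upwards [h₁, h₂, ae_restrict_mem measurableSet_Ioo] with t ht₁ ht₂ ht
  rw [ht₁, ht₂, integral_primitive_sub ht i₁ (hs'.integrable one_le_two) hk]
  abel

/-- The bounds contained in the energy estimate. -/
theorem difference_bounds {H K P G : Type*}
    [NormedAddCommGroup H] [InnerProductSpace ℝ H]
    [NormedAddCommGroup K] [InnerProductSpace ℝ K]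
    [NormedAddCommGroup P] [InnerProductSpace ℝ P]
    [NormedAddCommGroup G] [InnerProductSpace ℝ G]
    (e : H →L[ℝ] K) (γ : H →L[ℝ] G) (hnorm : ∀ v, ‖v‖ ^ 2 = ‖e v‖ ^ 2 + ‖γ v‖ ^ 2)
    {T μ ρ α C : ℝ} (hT : 0 < T) (hμ : 0 < μ) (hρ : 0 < ρ) (hα : 0 < α)
    {w : ℝ → H} {q : ℝ → P} (hw : MemLp w 2 (timeMeasure T))
    (h : ∀ᵐ t ∂(timeMeasure T), ρ * ‖e (w t)‖ ^ 2 + α / ρ * ‖q t‖ ^ 2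
        + 2 * μ * ∫ r in (0 : ℝ)..t, ‖γ (w r)‖ ^ 2 ≤ α * C) :
    (∀ᵐ t ∂(timeMeasure T), ‖q t‖ ≤ √(ρ * C)) ∧
    (∀ᵐ t ∂(timeMeasure T), ‖e (w t)‖ ≤ √(C / ρ) * √α) ∧
    ∫ t in Ioo 0 T, ‖w t‖ ^ 2 ≤ α * (T * (C / ρ) + C / (2 * μ)) := by
  have hγ : IntegrableOn (fun t => ‖γ (w t)‖ ^ 2) (Ioo 0 T) :=
    (memLp_two_iff_integrable_sq_norm (γ.comp_memLp' hw).1).1 (γ.comp_memLp' hw)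
  have he : IntegrableOn (fun t => ‖e (w t)‖ ^ 2) (Ioo 0 T) :=
    (memLp_two_iff_integrable_sq_norm (e.comp_memLp' hw).1).1 (e.comp_memLp' hw)
  have hpos : ∀ᵐ t ∂(timeMeasure T), 0 ≤ ∫ r in (0 : ℝ)..t, ‖γ (w r)‖ ^ 2 := by
    filter_upwards [ae_restrict_mem measurableSet_Ioo] with t ht
    exact intervalIntegral.integral_nonneg ht.1.le fun _ _ => by positivity
  have he1 : ∀ᵐ t ∂(timeMeasure T), ‖e (w t)‖ ^ 2 ≤ α * (C / ρ) := by
    filter_upwards [h, hpos] with t ht ht0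
    rw [mul_div_assoc', le_div_iff₀ hρ]
    have h1 : 0 ≤ α / ρ * ‖q t‖ ^ 2 := by positivity
    have h2 : 0 ≤ 2 * μ * ∫ r in (0 : ℝ)..t, ‖γ (w r)‖ ^ 2 := by positivity
    linarith
  refine ⟨?_, ?_, ?_⟩
  · filter_upwards [h, hpos] with t ht ht0
    refine Real.le_sqrt_of_sq_le ?_
    have h1 : 0 ≤ ρ * ‖e (w t)‖ ^ 2 := by positivity
    have h2 : 0 ≤ 2 * μ * ∫ r in (0 : ℝ)..t, ‖γ (w r)‖ ^ 2 := by positivity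
    have h3 : α / ρ * ‖q t‖ ^ 2 ≤ α / ρ * (ρ * C) := by
      rw [show α / ρ * (ρ * C) = α * C by field_simp]
      linarith
    exact le_of_mul_le_mul_left h3 (by positivity)
  · filter_upwards [he1] with t ht
    rw [← Real.sqrt_mul' _ hα.le, mul_comm]
    exact Real.le_sqrt_of_sq_le ht
  -- The energy bound holds for almost every time; continuity of the primitive carries the
  -- dissipation part to the endpoint `T`.
  · have h1 : ∫ r in (0 : ℝ)..T, ‖γ (w r)‖ ^ 2 ≤ α * (C / (2 * μ)) := by
      refine forall_le_of_ae_le hT (continuousOn_primitive_Icc hT.le hγ) ?_ T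
        (right_mem_Icc.2 hT.le)
      filter_upwards [h] with t ht
      rw [mul_div_assoc', le_div_iff₀ (by positivity)]
      have h1 : 0 ≤ ρ * ‖e (w t)‖ ^ 2 := by positivity
      have h2 : 0 ≤ α / ρ * ‖q t‖ ^ 2 := by positivity
      linarith
    rw [intervalIntegral.integral_of_le hT.le, integral_Ioc_eq_integral_Ioo] at h1
    have h2 : ∫ t in Ioo 0 T, ‖e (w t)‖ ^ 2 ≤ T * (α * (C / ρ)) := by
      refine (integral_mono_ae he (integrable_const (α * (C / ρ))) he1).trans_eq ?_
      simp [hT.le]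
    simp only [hnorm]
    rw [integral_add he hγ]
    linarith

theorem eLpNorm_two_le {H : Type*} [NormedAddCommGroup H] {T c α : ℝ} {w : ℝ → H}
    (hw : MemLp w 2 (timeMeasure T)) (hα : 0 < α) (h : ∫ t in Ioo 0 T, ‖w t‖ ^ 2 ≤ α * c) :
    eLpNorm w 2 (timeMeasure T) ≤ ENNReal.ofReal (√c * √α) := by
  rw [hw.eLpNorm_eq_integral_rpow_norm (by simp) (by simp)]
  refine ENNReal.ofReal_le_ofReal ?_
  rw [← Real.sqrt_mul' _ hα.le, mul_comm c, Real.sqrt_eq_rpow]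
  simp only [ENNReal.toReal_ofNat, Real.rpow_ofNat, ← one_div]
  exact Real.rpow_le_rpow (by positivity) h (by norm_num)

/-- Integrate the Young-type inequality `‖w‖ ≤ √α + ‖w‖² / √α`. -/
theorem integral_norm_le_mul_sqrt {H : Type*} [NormedAddCommGroup H] {T c α : ℝ} {w : ℝ → H}
    (hT : 0 < T) (hw : MemLp w 2 (timeMeasure T)) (hα : 0 < α)
    (h : ∫ t in Ioo 0 T, ‖w t‖ ^ 2 ≤ α * c) :
    ∫ t in Ioo 0 T, ‖w t‖ ≤ (T + c) * √α := by
  have hs : 0 < √α := Real.sqrt_pos.2 hα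
  have hw2 : IntegrableOn (fun t => ‖w t‖ ^ 2) (Ioo 0 T) :=
    (memLp_two_iff_integrable_sq_norm hw.1).1 hw
  have h1 : ∫ t in Ioo 0 T, ‖w t‖ ≤ ∫ t in Ioo 0 T, (√α + (√α)⁻¹ * ‖w t‖ ^ 2) := by
    refine integral_mono (hw.integrable one_le_two).norm
      ((integrable_const _).add (hw2.const_mul _)) fun t => ?_
    have h2 : √α * ‖w t‖ ≤ √α * (√α + (√α)⁻¹ * ‖w t‖ ^ 2) := by
      rw [mul_add, mul_inv_cancel_left₀ hs.ne']
      nlinarith [sq_nonneg (√α - ‖w t‖)]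
    exact le_of_mul_le_mul_left h2 hs
  rw [integral_add (integrable_const _) (hw2.const_mul _), integral_const_mul] at h1
  have h3 : (√α)⁻¹ * ∫ t in Ioo 0 T, ‖w t‖ ^ 2 ≤ (√α)⁻¹ * (α * c) := by gcongr
  have h4 : (√α)⁻¹ * (α * c) = c * √α := by
    rw [inv_mul_eq_iff_eq_mul₀ hs.ne']
    linear_combination (-c) * Real.mul_self_sqrt hα.le
  have h5 : ∫ _ in Ioo 0 T, √α = T * √α := by simp [hT.le]
  rw [h5] at h1
  linarith

/-- The full `H¹` norm splits into the two quantities controlled by the energy, so no Poincaré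
inequality is needed. -/
theorem norm_sq_H01 {d : ℕ} (D : Set (Vec d)) (v : H01 D) :
    ‖v‖ ^ 2 = ‖embL2 D v‖ ^ 2 + ‖gradH01 D v‖ ^ 2 :=
  WithLp.prod_norm_sq_eq_of_L2 (v : Pairs D)

theorem exists_ae_norm_le_of_primitive {P : Type*} [NormedAddCommGroup P] [NormedSpace ℝ P]
    {T : ℝ} (hT : 0 < T) {p s' : ℝ → P} {c : P} (hs' : IntegrableOn s' (Ioo 0 T))
    (h : ∀ᵐ t ∂(timeMeasure T), p t = c + ∫ s in (0 : ℝ)..t, s' s) :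
    ∃ B : ℝ, ∀ᵐ t ∂(timeMeasure T), ‖p t‖ ≤ B := by
  have hc : ContinuousOn (fun t => c + ∫ s in (0 : ℝ)..t, s' s) (Icc 0 T) :=
    continuousOn_const.add (continuousOn_primitive_Icc hT.le hs')
  obtain ⟨B, hB⟩ := isCompact_Icc.exists_bound_of_continuousOn hc
  refine ⟨B, ?_⟩
  filter_upwards [h, ae_restrict_mem measurableSet_Ioo] with t ht hmem
  rw [ht]
  exact hB t (Ioo_subset_Icc_self hmem)

/-- The pressure differences tested with divergences are of order `√α`, and they are orthogonal
to the constants; hence they tend to zero weak-star. -/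
theorem tendsto_integral_pressure_zero {d : ℕ} {D : Set (Vec d)} (hDo : IsOpen D)
    (hDc : IsConnected D) [IsFiniteMeasure (volume.restrict D)] {T μ η ρ B c₁ c₂ c₃ : ℝ}
    (hT : 0 < T) (hμ : 0 < μ) (hη : 0 ≤ η) (hρ : 0 < ρ)
    {w : ℝ → ℝ → H01 D} {q : ℝ → ℝ → L2 D ℝ} {F : ℝ → ℝ → L2 D (Vec d)}
    (hw : ∀ α ∈ Ioo (0 : ℝ) 1, MemLp (w α) 2 (timeMeasure T))
    (hq : ∀ α ∈ Ioo (0 : ℝ) 1, MemLp (q α) 2 (timeMeasure T))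
    (hF : ∀ α ∈ Ioo (0 : ℝ) 1, MemLp (F α) 2 (timeMeasure T))
    (heqw : ∀ α ∈ Ioo (0 : ℝ) 1, ∀ᵐ t ∂(timeMeasure T), massTerm (embL2 D) ρ (embL2 D (w α t)) =
      ∫ r in (0 : ℝ)..t, evolutionRHS (embL2 D) (gradH01 D) (divH01 D) μ η (w α) (q α)
        (fun r => α • F α r) r)
    (hqB : ∀ α ∈ Ioo (0 : ℝ) 1, ∀ᵐ t ∂(timeMeasure T), ‖q α t‖ ≤ B)
    (h₁ : ∀ α ∈ Ioo (0 : ℝ) 1, ∀ᵐ t ∂(timeMeasure T), ‖embL2 D (w α t)‖ ≤ c₁ * √α)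
    (h₂ : ∀ α ∈ Ioo (0 : ℝ) 1, ∫ t in Ioo 0 T, ‖w α t‖ ≤ c₂ * √α)
    (h₃ : ∀ α ∈ Ioo (0 : ℝ) 1, ∫ t in Ioo 0 T, ‖F α t‖ ≤ c₃)
    (hmean : ∀ α ∈ Ioo (0 : ℝ) 1, ∀ᵐ t ∂(timeMeasure T), ⟪q α t, oneL2 D⟫ = 0)
    {g : ℝ → L2 D ℝ} (hg : MemLp g 1 (timeMeasure T)) :
    Tendsto (fun α => ∫ t in Ioo 0 T, ⟪q α t, g t⟫) (𝓝[>] 0) (𝓝 0) := by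
  have hα : ∀ᶠ α in 𝓝[>] (0 : ℝ), α ∈ Ioo (0 : ℝ) 1 := Ioo_mem_nhdsGT one_pos
  refine tendsto_integral_inner_zero (B := B) hT ?_ (dense_range_div_sup_const hDo hDc) ?_ hg
  · filter_upwards [hα] with α h using ⟨(hq α h).1, hqB α h⟩
  intro r hr τ hτ
  -- The test element is a divergence plus a constant; the constant contributes nothing because `q`
  -- has mean zero.
  obtain ⟨_, ⟨v, hv, rfl⟩, y, hy, rfl⟩ := Submodule.mem_sup.1 hr
  obtain ⟨c, rfl⟩ := Submodule.mem_span_singleton.1 hy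
  set v' : H01 D := ⟨v, hv⟩ with hv'
  have hsub : Ioc 0 τ ⊆ Icc 0 T := fun s hs => ⟨hs.1.le, hs.2.trans hτ.2⟩
  have hbound : ∀ᶠ α in 𝓝[>] (0 : ℝ),
      ‖∫ t in (0 : ℝ)..τ, ⟪q α t, (div D : Pairs D →ₗ[ℝ] L2 D ℝ) v + c • oneL2 D⟫‖ ≤
      ρ * (c₁ * √α) * ‖embL2 D v'‖ + (μ * (‖gradH01 D‖ * ‖gradH01 D v'‖)
        + η * (‖divH01 D‖ * ‖divH01 D v'‖)) * (c₂ * √α) + α * ‖embL2 D v'‖ * c₃ := by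
    filter_upwards [hα] with α h
    have h1 := abs_integral_pressure_le (embL2 D) (gradH01 D) (divH01 D) hT hμ hη hρ h.1 (hw α h)
      (hq α h) (hF α h) (heqw α h) (h₁ α h) (h₂ α h) (h₃ α h) v' τ hτ
    refine le_trans (le_of_eq ?_) h1
    rw [Real.norm_eq_abs, intervalIntegral.integral_of_le hτ.1,
      intervalIntegral.integral_of_le hτ.1]
    congr 1
    refine integral_congr_ae ?_
    have h2 := hmean α h
    rw [timeMeasure, restrict_Ioo_eq_restrict_Icc] at h2
    filter_upwards [ae_restrict_of_ae_restrict_of_subset hsub h2] with t ht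
    rw [inner_add_right, real_inner_smul_right, ht, mul_zero, add_zero]
    rfl
  refine squeeze_zero_norm' hbound ?_
  have hcont : Continuous fun α : ℝ => ρ * (c₁ * √α) * ‖embL2 D v'‖
      + (μ * (‖gradH01 D‖ * ‖gradH01 D v'‖)
        + η * (‖divH01 D‖ * ‖divH01 D v'‖)) * (c₂ * √α) + α * ‖embL2 D v'‖ * c₃ := by
    fun_prop
  have h0 := (hcont.tendsto 0).mono_left (nhdsWithin_le_nhds (s := Ioi 0))
  simpa using h0

/-- The difference of the two pressures has mean value zero. -/
theorem inner_pressure_sub_oneL2 {d : ℕ} {D : Set (Vec d)} [IsFiniteMeasure (volume.restrict D)]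
    {T κ : ℝ} {u : ℝ → H01 D} {p p' : ℝ → L2 D ℝ} {p₀ : L2 D ℝ}
    (hu : MemLp u 2 (timeMeasure T))
    (h : ∀ᵐ t ∂(timeMeasure T), p t = p₀ + ∫ s in (0 : ℝ)..t, κ • divH01 D (u s))
    (hmean : ∀ᵐ t ∂(timeMeasure T), ∫ x in D, p' t x = ∫ x in D, p₀ x) :
    ∀ᵐ t ∂(timeMeasure T), ⟪p t - p' t, oneL2 D⟫ = 0 := by
  have hk : IntegrableOn (fun t => κ • divH01 D (u t)) (Ioo 0 T) :=
    ((divH01 D).integrable_comp (hu.integrable one_le_two)).smul κ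
  filter_upwards [h, hmean, ae_restrict_mem measurableSet_Ioo] with t ht hm hmem
  have h1 : ⟪oneL2 D, ∫ s in (0 : ℝ)..t, κ • divH01 D (u s)⟫ = 0 := by
    rw [intervalIntegral.integral_of_le hmem.1.le,
      ← integral_inner (hk.mono_set fun r hr => ⟨hr.1, hr.2.trans_lt hmem.2⟩)]
    refine integral_eq_zero_of_ae (Eventually.of_forall fun s => ?_)
    have h2 : ⟪divH01 D (u s), oneL2 D⟫ = 0 := inner_div_oneL2 D (u s).2
    simp only [Pi.zero_apply]
    rw [real_inner_smul_right, real_inner_comm, h2, mul_zero]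
  rw [real_inner_comm] at h1
  rw [inner_sub_left, ht, inner_add_left, h1, inner_oneL2, inner_oneL2, hm, add_zero, sub_self]

theorem integral_norm_force_le {X P : Type*} [NormedAddCommGroup X] [NormedAddCommGroup P]
    {T M B : ℝ} (hT : 0 < T) (hM : 0 ≤ M) {F : ℝ → X} {q s : ℝ → P}
    (hF : IntegrableOn F (Ioo 0 T)) (hs : IntegrableOn s (Ioo 0 T))
    (hFle : ∀ᵐ t ∂(timeMeasure T), ‖F t‖ ≤ M * (‖q t‖ + ‖s t‖))
    (hq : ∀ᵐ t ∂(timeMeasure T), ‖q t‖ ≤ B) :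
    ∫ t in Ioo 0 T, ‖F t‖ ≤ M * (T * B + ∫ t in Ioo 0 T, ‖s t‖) := by
  have h1 : ∫ t in Ioo 0 T, ‖F t‖ ≤ ∫ t in Ioo 0 T, M * (B + ‖s t‖) := by
    refine integral_mono_ae hF.norm (((integrable_const B).add hs.norm).const_mul M) ?_
    filter_upwards [hFle, hq] with t h2 h3
    exact h2.trans (by gcongr)
  refine h1.trans_eq ?_
  rw [integral_const_mul, integral_add (integrable_const B) hs.norm]
  simp [hT.le]

end LowCompressible

end

/-! ### The main theorem -/

open LowCompressible
theorem mainTheorem4 (d : ℕ) (hd : 2 ≤ d) (D : Set (Vec d)) (hDo : IsOpen D)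
    (hDc : IsConnected D) (hDb : Bornology.IsBounded D)
    (T μ η ρ₀ : ℝ) (hT : 0 < T) (hμ : 0 < μ) (hη : 0 ≤ η) (hρ₀ : 0 < ρ₀)
    (f : Vec d × ℝ → Vec d) (hf : MemLp f ∞ (volume.restrict (D ×ˢ Ioo 0 T)))
    (u₀ : L2 D (Vec d)) (hu₀ : u₀ ∈ J D) (p₀ : L2 D ℝ)
    (u : ℝ → ℝ → H01 D) (p : ℝ → ℝ → L2 D ℝ)
    (hcomp : ∀ α ∈ Ioo (0 : ℝ) 1,
      IsCompressibleWeakSolution D T μ η ρ₀ α f u₀ p₀ (u α) (p α))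
    (uinc : ℝ → H01 D) (pinc : ℝ → L2 D ℝ)
    (hinc : IsStokesWeakSolution D T μ ρ₀ f u₀ uinc pinc)
    (huinc : MemSobolevLions D T uinc) (hpinc : MemW12 T pinc)
    (hmean : ∀ᵐ t ∂(timeMeasure T), ∫ x in D, pinc t x = ∫ x in D, p₀ x) :
    WeakStarTendsto T p (𝓝[>] (0 : ℝ)) pinc ∧
    ∃ C : ℝ, ∀ α ∈ Ioo (0 : ℝ) 1,
      eLpNorm (fun t => u α t - uinc t) 2 (timeMeasure T)
        + eLpNorm (fun t => embL2 D (u α t - uinc t)) ∞ (timeMeasure T)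
        ≤ ENNReal.ofReal (C * √α) := by
  have hfin : IsFiniteMeasure (volume.restrict D) :=
    isFiniteMeasure_restrict.2 hDb.measure_lt_top.ne
  obtain ⟨F, M, hF, hM, hM0, hfF⟩ := exists_bounded_representative D hf
  obtain ⟨hp2, s', hs', hweak⟩ := hpinc
  have hp1 : IntegrableOn pinc (Ioo 0 T) := hp2.integrable one_le_two
  have hs1 : IntegrableOn s' (Ioo 0 T) := hs'.integrable one_le_two
  -- `c` is the initial value of the continuous representative of `p_inc`. It need not equal `p₀`,
  -- so `q` is bounded but in general not small.
  obtain ⟨c, hc⟩ := ae_eq_const_add_primitive hT hp1 hs1 hweak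
  have hδ : ∀ᵐ t ∂(timeMeasure T), divH01 D (uinc t) = 0 :=
    hinc.velocity_mem_V.mono fun t ht => div_eq_zero_of_mem_V ht
  set w : ℝ → ℝ → H01 D := fun α t => u α t - uinc t with hw
  set q : ℝ → ℝ → L2 D ℝ := fun α t => p α t - pinc t with hq
  set G : ℝ → ℝ → L2 D (Vec d) := fun α t => (forceMul D hF hM t).adjoint (p α t) with hG
  have hw2 : ∀ α ∈ Ioo (0 : ℝ) 1, MemLp (w α) 2 (timeMeasure T) := fun α h =>
    (hcomp α h).velocity_mem.sub hinc.velocity_mem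
  have hq2 : ∀ α ∈ Ioo (0 : ℝ) 1, MemLp (q α) 2 (timeMeasure T) := fun α h =>
    (hcomp α h).pressure_mem.sub hp2
  have hG2 : ∀ α ∈ Ioo (0 : ℝ) 1, MemLp (G α) 2 (timeMeasure T) := fun α h =>
    memLp_adjoint_forceMul D hF hM hM0 (hcomp α h).pressure_mem
  have hGle : ∀ α ∈ Ioo (0 : ℝ) 1, ∀ᵐ t ∂(timeMeasure T),
      ‖G α t‖ ≤ M * (‖q α t‖ + ‖pinc t‖) := fun α _ => Eventually.of_forall fun t => by
    refine (norm_adjoint_forceMul_le D hF hM hM0 t _).trans ?_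
    gcongr
    calc ‖p α t‖ = ‖(p α t - pinc t) + pinc t‖ := by rw [sub_add_cancel]
      _ ≤ _ := norm_add_le _ _
  have heqp := fun α (h : α ∈ Ioo (0 : ℝ) 1) => (hcomp α h).pressure_eq hT h.1
  have heqw : ∀ α ∈ Ioo (0 : ℝ) 1, ∀ᵐ t ∂(timeMeasure T),
      massTerm (embL2 D) ρ₀ (embL2 D (w α t)) = ∫ r in (0 : ℝ)..t,
        evolutionRHS (embL2 D) (gradH01 D) (divH01 D) μ η (w α) (q α)
          (fun r => α • G α r) r := fun α h =>
    evolution_eq_sub (embL2 D) (gradH01 D) (divH01 D) (hcomp α h).velocity_mem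
      hinc.velocity_mem (hcomp α h).pressure_mem hp2
      (memLp_adjoint_forceMul D hF hM hM0
        (memLp_const_add_smul D ρ₀ α (hcomp α h).pressure_mem))
      (memLp_adjoint_forceMul D hF hM hM0 (memLp_const (ρ₀ • oneL2 D)))
      -- The density `ρ₀ + α p_α` minus `ρ₀` leaves `α p_α`, so the force acts on the difference
      -- with a factor `α`.
      (fun t => by simp only [hG, map_add, map_smul, add_sub_cancel_left]) hδ
      ((hcomp α h).velocity_eq hT hF hM hM0 hfF) (hinc.velocity_eq hT hρ₀ hu₀ hF hM hM0 hfF)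
  -- Every quantity in `C` comes from the data and the incompressible pressure, so it does not
  -- depend on `α`.
  set C : ℝ := (‖p₀ - c‖ ^ 2 / ρ₀ + M * (∫ t in Ioo 0 T, ‖pinc t‖ ^ 2)
    + (∫ t in Ioo 0 T, ‖s' t‖ ^ 2) / ρ₀) * Real.exp ((M * ρ₀ + 1 + 2 * M / ρ₀) * T) with hC
  have henergy : ∀ α ∈ Ioo (0 : ℝ) 1, ∀ᵐ t ∂(timeMeasure T),
      ρ₀ * ‖embL2 D (w α t)‖ ^ 2 + α / ρ₀ * ‖q α t‖ ^ 2
        + 2 * μ * ∫ r in (0 : ℝ)..t, ‖gradH01 D (w α r)‖ ^ 2 ≤ α * C := fun α h => by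
    rw [hC, ← mul_assoc]
    exact coupled_energy_estimate (embL2 D) (gradH01 D) (divH01 D) hT hμ hη hρ₀ h hM0 (hw2 α h)
      (hq2 α h) hp2 hs' (hG2 α h) (hGle α h) (heqw α h)
      (pressure_eq_sub (divH01 D) (hcomp α h).velocity_mem hs' hδ (heqp α h) hc)
  have hbounds := fun α (h : α ∈ Ioo (0 : ℝ) 1) =>
    difference_bounds (embL2 D) (gradH01 D) (norm_sq_H01 D) hT hμ hρ₀ h.1 (hw2 α h) (henergy α h)
  obtain ⟨B, hB⟩ := exists_ae_norm_le_of_primitive hT hs1 hc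
  have hpinf : MemLp pinc ∞ (timeMeasure T) := memLp_top_of_bound hp2.1 B hB
  have hqinf : ∀ α ∈ Ioo (0 : ℝ) 1, MemLp (q α) ∞ (timeMeasure T) := fun α h =>
    memLp_top_of_bound (hq2 α h).1 _ (hbounds α h).1
  have hev : ∀ᶠ α in 𝓝[>] (0 : ℝ), α ∈ Ioo (0 : ℝ) 1 := Ioo_mem_nhdsGT one_pos
  refine ⟨⟨?_, hpinf, fun g hg => ?_⟩,
    √(T * (C / ρ₀) + C / (2 * μ)) + √(C / ρ₀), fun α h => ?_⟩
  · filter_upwards [hev] with α h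
    have h1 := (hqinf α h).add hpinf
    have h2 : q α + pinc = p α := by
      funext t
      simp [hq]
    rwa [h2] at h1
  · have h1 := tendsto_integral_pressure_zero hDo hDc hT hμ hη hρ₀ hw2 hq2 hG2 heqw
      (fun α h => (hbounds α h).1) (fun α h => (hbounds α h).2.1)
      (fun α h => integral_norm_le_mul_sqrt hT (hw2 α h) h.1 (hbounds α h).2.2)
      (fun α h => integral_norm_force_le hT hM0 ((hG2 α h).integrable one_le_two) hp1
        (hGle α h) (hbounds α h).1)
      (fun α h => inner_pressure_sub_oneL2 (hcomp α h).velocity_mem (heqp α h) hmean) hg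
    have hg1 : Integrable g (timeMeasure T) := memLp_one_iff_integrable.1 hg
    have h2 := h1.add_const (∫ t in Ioo 0 T, ⟪pinc t, g t⟫)
    rw [zero_add] at h2
    refine h2.congr' ?_
    filter_upwards [hev] with α h
    rw [← integral_add (integrable_inner_of_bounded (hq2 α h).1 (hbounds α h).1 hg1)
      (integrable_inner_of_bounded hp2.1 hB hg1)]
    refine integral_congr_ae (Eventually.of_forall fun t => ?_)
    simp only [hq]
    rw [← inner_add_left, sub_add_cancel]
  · rw [add_mul, ENNReal.ofReal_add (by positivity) (by positivity)]
    refine add_le_add (eLpNorm_two_le (hw2 α h) h.1 (hbounds α h).2.2) ?_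
    exact eLpNormEssSup_le_of_ae_bound (hbounds α h).2.1
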